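/- **Setting.** Let $m\ge 1$, $N>m$, $n$ be integers and write $X=(x,y)\in\mathbb R^m\times\mathbb R^{N-m}=\mathbb R^N$, $\nabla=(\nabla_x,\nabla_y)$, $B_R=\{X:|X|<R\}$. Let $F=F(x,\xi)$, $x\in\mathbb R^m$, $\xi=(\xi^1,\dots,\xi^n)\in\mathbb R^n$, be of class $C^2$ in $\xi$ for every $x$, with $F_i=\partial_{\xi^i}F$, $F_{ij}=\partial^2_{\xi^i\xi^j}F$. Let $a_i=a_i(x,t)$ ($i=1,\dots,n$; $x\in\mathbb R^m$, $t\ge 0$) satisfy: $a_i\in L^\infty(\mathbb R^m\times[\alpha,\beta])$ for all $0<\alpha<\beta$; $\inf_x a_i(x,t)>0$ for each $t>0$; $a_i(x,\cdot)\in C^1((0,\infty))$ for each $x$. Put $$\mathcal A^i(x,\eta)=a_i(x,|\eta|)\,\mathrm{Id}+\partial_ta_i(x,|\eta|)\,\frac{\eta\otimes\eta}{|\eta|}\quad(\eta\in\mathbb R^N\setminus\{0\}),\qquad \mathcal A^i(x,0)=a_i(x,0)\,\mathrm{Id}.$$ **Hypotheses.** For $i=1,\dots,n$ let $u^i\in C^1(\mathbb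 R^N)\cap C^2(\{\nabla u^i\ne0\})\cap L^\infty(\mathbb R^N)$ with $\nabla u^i\in L^\infty\cap W^{1,2}_{loc}(\mathbb R^N,\mathbb R^N)$. Assume: 1. $(u^1,\dots,u^n)$ is a weak solution of $-\mathrm{div}(a_i(x,|\nabla u^i|)\nabla u^i)=F_i(x,u^1,\dots,u^n)$ in $\mathbb R^N$: the functions $a_i(x,|\nabla u^i|)\nabla u^i$ and $F_i(x,u^1,\dots,u^n)$ are locally integrable and, for all $\psi^i\in C_c^\infty(\mathbb R^N)$, $\int a_i(x,|\nabla u^i|)\langle\nabla u^i,\nabla\psi^i\rangle\,dX=\int F_i(x,u^1,\dots,u^n)\psi^i\,dX$. 2. It is stable: the entries of $\mathcal A^i(x,\nabla u^i)$ and the functions $F_{ij}(x,u^1,\dots,u^n)$ are locally integrable and $$\sum_i\int\langle\mathcal A^i(x,\nabla u^i)\nabla\psi^i,\nabla\psi^i\rangle\,dX-\sum_{i,j}\int F_{ij}(x,u^1,\dots,u^n)\psi^i\psi^j\,dX\ge0\qquad\forall\,\psi\in C_c^\infty(\mathbb R^N,\mathbb R^n).$$ 3. There are $\theta^1,\dots,\theta^n\in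 C^1(\mathbb R^N)$, each everywhere positive or everywhere negative, with $F_{ij}(x,u^1(X),\dots,u^n(X))\,\theta^i(X)\theta^j(X)\ge0$ for all $X$ and $i<j$. 4. $X\mapsto\mathcal A^i(x,\nabla u^i(X))$ belongs to $L^\infty(\{\nabla u^i\ne0\}\cap B_R)$ for every $R>0$ and is positive definite for almost every $X\in\mathbb R^N$; and there are $C_1,\dots,C_n\ge1$ such that the largest eigenvalue $\overline{\mathcal A}^i(X)$ of $\mathcal A^i(x,\nabla u^i(X))$ satisfies $\int_{B_R}\overline{\mathcal A}^i|\nabla u^i|^2\,dX\le C_iR^2$ (with an integrable integrand) for all $R\ge\max_jC_j$. 5. For every $x\in\mathbb R^m$ there are open intervals $I_1^x,\dots,I_n^x\subset\mathbb R$ whose product contains $(u^1(x,y),\dots,u^n(x,y))$ for at least one $y\in\mathbb R^{N-m}$, such that, for every pair $j\neq k$, either $F_{kj}(x,\cdot)>0$ on all of $I_1^x\times\dots\times I_n^x$ or $F_{kj}(x,\cdot)<0$ on all of it. **Conclusion.** There are $\bar u^i:\mathbb R^m\times\mathbb R\to\mathbb R$ and $\omega_i:\mathbb R^m\to\mathbb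 S^{N-m-1}$ such that, for every $i$, $u^i(x,y)=\bar u^i(x,\langle\omega_i(x),y\rangle)$ for all $(x,y)\in\mathbb R^N$ and $\omega_i(x)$ is constant on each connected component of $\{\nabla_yu^i\ne0\}\subset\mathbb R^N$, and there are $C_{jk}:\mathbb R^N\to\mathbb R$, $D_{jk}:\mathbb R^m\to\{-1,1\}$ such that, for all $j,k$, $$\nabla_yu^j(X)=C_{jk}(X)\,\nabla_yu^k(X)\ \text{ at every }X\text{ with }\nabla_yu^k(X)\neq0,\qquad \omega_j(x)=D_{jk}(x)\,\omega_k(x)\ \text{ for every }x\in\mathbb R^m.$$ Moreover, if $\mathcal I=\bigcap_{i=1}^n\{\nabla_yu^i\neq0\}$ is nonempty and connected, then all the $\omega_i(x)$ with $(x,y)\in\mathcal I$ equal one and the same vector. -/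

import Mathlib

open MeasureTheory

noncomputable section

/-- The space of the variables `X = (x, y) ∈ ℝ^m × ℝ^d`, with the Euclidean norm and Lebesgue
measure of `ℝ^(m + d)`. -/
abbrev FibSpace (m d : ℕ) : Type := EuclideanSpace ℝ (Fin m ⊕ Fin d)

/-- The component `x` of `X = (x, y)`. -/
def xPart {m d : ℕ} (X : FibSpace m d) : EuclideanSpace ℝ (Fin m) :=
  WithLp.toLp 2 fun i => X (Sum.inl i)

/-- The component `y` of `X = (x, y)`. -/
def yPart {m d : ℕ} (X : FibSpace m d) : EuclideanSpace ℝ (Fin d) :=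
  WithLp.toLp 2 fun i => X (Sum.inr i)

/-- The point `(x, y)`. -/
def pairXY {m d : ℕ} (x : EuclideanSpace ℝ (Fin m)) (y : EuclideanSpace ℝ (Fin d)) :
    FibSpace m d :=
  WithLp.toLp 2 (Sum.elim (fun i => x i) (fun i => y i))

/-- `∇_y v (X)`: the part of the full gradient in the variables `y`. -/
def gradY {m d : ℕ} (v : FibSpace m d → ℝ) (X : FibSpace m d) : EuclideanSpace ℝ (Fin d) :=
  yPart (gradient v X)

/-- `C_c^∞` test functions. -/
def IsTestFun {m d : ℕ} (φ : FibSpace m d → ℝ) : Prop :=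
  ContDiff ℝ ((⊤ : ℕ∞) : WithTop ℕ∞) φ ∧ HasCompactSupport φ

/-- `L²_loc`. -/
def MemL2Loc {m d : ℕ} (g : FibSpace m d → ℝ) : Prop :=
  ∀ R : ℝ, MemLp g 2 (volume.restrict (Metric.ball (0 : FibSpace m d) R))

/-- `g` is the weak (distributional) partial derivative of `f` in the coordinate `l`. -/
def IsWeakPartial {m d : ℕ} (l : Fin m ⊕ Fin d) (f g : FibSpace m d → ℝ) : Prop :=
  ∀ φ : FibSpace m d → ℝ, IsTestFun φ →
    ∫ X, f X * gradient φ X l = - ∫ X, g X * φ X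

/-- `W^{1,2}_loc`. -/
def MemW12Loc {m d : ℕ} (f : FibSpace m d → ℝ) : Prop :=
  MemL2Loc f ∧ ∀ l, ∃ g, MemL2Loc g ∧ IsWeakPartial l f g

/-- `v ∈ C¹ ∩ C²({∇v ≠ 0}) ∩ L^∞` and `∇v ∈ L^∞ ∩ W^{1,2}_loc` on the whole space. -/
def IsRegularSol {m d : ℕ} (v : FibSpace m d → ℝ) : Prop :=
  ContDiff ℝ 1 v ∧
  ContDiffOn ℝ 2 v {X | gradient v X ≠ 0} ∧
  MemLp v ⊤ volume ∧
  MemLp (fun X => gradient v X) ⊤ volume ∧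
  ∀ k, MemW12Loc fun X => gradient v X k

/-- The standing assumptions on a coefficient `a = a(x, t)`. -/
def IsCoefficient {m : ℕ} (a : EuclideanSpace ℝ (Fin m) → ℝ → ℝ) : Prop :=
  (∀ α β : ℝ, 0 < α → α < β →
    MemLp (fun p : EuclideanSpace ℝ (Fin m) × ℝ => a p.1 p.2) ⊤
      (volume.restrict (Set.univ ×ˢ Set.Icc α β))) ∧
  (∀ t : ℝ, 0 < t → ∃ c : ℝ, 0 < c ∧ ∀ x, c ≤ a x t) ∧
  (∀ x, ContDiffOn ℝ 1 (a x) (Set.Ioi 0))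

/-- The matrix `𝒜(x, η) = a(x, |η|) δ_kl + ∂_t a(x, |η|) η_k η_l / |η|`.
For `η = 0` the second term is zero, so that `𝒜(x, 0) = a(x, 0) Id`. -/
def coefMatrix {m d : ℕ} (a : EuclideanSpace ℝ (Fin m) → ℝ → ℝ)
    (x : EuclideanSpace ℝ (Fin m)) (η : FibSpace m d) :
    Matrix (Fin m ⊕ Fin d) (Fin m ⊕ Fin d) ℝ :=
  Matrix.of fun k l =>
    a x ‖η‖ * (if k = l then 1 else 0) + deriv (a x) ‖η‖ * (η k * η l / ‖η‖)

/-- The matrix field `X ↦ 𝒜(x, ∇v(X))`. -/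
def matrixAlong {m d : ℕ} (a : EuclideanSpace ℝ (Fin m) → ℝ → ℝ) (v : FibSpace m d → ℝ)
    (X : FibSpace m d) : Matrix (Fin m ⊕ Fin d) (Fin m ⊕ Fin d) ℝ :=
  coefMatrix a (xPart X) (gradient v X)

/-- `𝒜(x, ∇v(X)) ∈ L^∞({∇v ≠ 0} ∩ B_R)` for every `R > 0`. -/
def HasBoundedMatrix {m d : ℕ} (a : EuclideanSpace ℝ (Fin m) → ℝ → ℝ)
    (v : FibSpace m d → ℝ) : Prop :=
  ∀ R : ℝ, 0 < R → ∀ k l, MemLp (fun X => matrixAlong a v X k l) ⊤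
    (volume.restrict ({X | gradient v X ≠ 0} ∩ Metric.ball 0 R))

/-- The largest eigenvalue of a (real symmetric) matrix. -/
def largestEigenvalue {ι : Type*} [Fintype ι] [DecidableEq ι] (M : Matrix ι ι ℝ) : ℝ :=
  sSup (spectrum ℝ M)

/-- The partial derivative of `f : ℝ^n → ℝ` in the variable `ξ^i`. -/
def pderivXi {n : ℕ} (i : Fin n) (f : (Fin n → ℝ) → ℝ) (ξ : Fin n → ℝ) : ℝ :=
  fderiv ℝ f ξ (Pi.single i 1)

/-- `F_i = ∂F/∂ξ^i`. -/
def nlF {m n : ℕ} (F : EuclideanSpace ℝ (Fin m) → (Fin n → ℝ) → ℝ) (i : Fin n)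
    (x : EuclideanSpace ℝ (Fin m)) (ξ : Fin n → ℝ) : ℝ :=
  pderivXi i (F x) ξ

/-- `F_ij = ∂²F/∂ξ^i∂ξ^j`. -/
def nlFF {m n : ℕ} (F : EuclideanSpace ℝ (Fin m) → (Fin n → ℝ) → ℝ) (i j : Fin n)
    (x : EuclideanSpace ℝ (Fin m)) (ξ : Fin n → ℝ) : ℝ :=
  pderivXi j (nlF F i x) ξ

/-- Weak solutions on the whole space of `-div(a_i(x,|∇u^i|)∇u^i) = F_i(x,u^1,…,u^n)`, `i ≤ n`.
The two local integrability conditions say that the integrals make sense. -/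
def IsWeakSolution {m d n : ℕ} (a : Fin n → EuclideanSpace ℝ (Fin m) → ℝ → ℝ)
    (F : EuclideanSpace ℝ (Fin m) → (Fin n → ℝ) → ℝ) (u : Fin n → FibSpace m d → ℝ) : Prop :=
  (∀ i, LocallyIntegrable
    (fun X => a i (xPart X) ‖gradient (u i) X‖ • gradient (u i) X) volume) ∧
  (∀ i, LocallyIntegrable (fun X => nlF F i (xPart X) (fun k => u k X)) volume) ∧
  ∀ ψ : Fin n → FibSpace m d → ℝ, (∀ i, IsTestFun (ψ i)) → ∀ i,
    ∫ X, inner ℝ (a i (xPart X) ‖gradient (u i) X‖ • gradient (u i) X) (gradient (ψ i) X)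
      = ∫ X, nlF F i (xPart X) (fun k => u k X) * ψ i X

/-- Stability of `(u^1,…,u^n)` on the whole space.
The two local integrability conditions say that the integrals make sense. -/
def IsStable {m d n : ℕ} (a : Fin n → EuclideanSpace ℝ (Fin m) → ℝ → ℝ)
    (F : EuclideanSpace ℝ (Fin m) → (Fin n → ℝ) → ℝ) (u : Fin n → FibSpace m d → ℝ) : Prop :=
  (∀ i k l, LocallyIntegrable (fun X => matrixAlong (a i) (u i) X k l) volume) ∧
  (∀ i j, LocallyIntegrable (fun X => nlFF F i j (xPart X) (fun k => u k X)) volume) ∧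
  ∀ ψ : Fin n → FibSpace m d → ℝ, (∀ i, IsTestFun (ψ i)) →
    0 ≤ (∑ i, ∫ X, ∑ k, ∑ l,
          matrixAlong (a i) (u i) X k l * gradient (ψ i) X l * gradient (ψ i) X k)
        - ∑ i, ∑ j, ∫ X, nlFF F i j (xPart X) (fun k => u k X) * ψ i X * ψ j X

end

/-! The system has no explicit dependence on y, so it may be differentiated in y: every ∂_{y_l}u^i
solves the linearized equation on {∇u^i ≠ 0} (`linearized_of_isTestC1`). Let r_i = |∇_y u^i| and let
s_i = ±1 be the sign of θ^i. Insert ψ^i = s_i r_i ζ_i into the stability inequality, test the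
linearized equation with ∂_{y_l}u^i ζ_i², sum over l, and subtract. The outcome is a geometric
Poincaré inequality (`geometric_poincare`): a curvature term plus a coupling term with kernel F_ij
(s_i s_j r_i r_j − ⟨∇_y u^i, ∇_y u^j⟩) is at most ∑ ∫ r_i² ⟨𝒜^i ∇ζ_i, ∇ζ_i⟩.

Since r_i is C¹ only off its zeros, the ζ_i must at first vanish near them;
`geometric_poincare_limit` removes this restriction and puts one φ in place of all ζ_i. Then both
terms on the left have nonnegative integrands: the curvature is a sum of squares in the metric 𝒜^i
(`curv_eq_sum`), and the coupling is a Cauchy–Schwarz defect weighted by F_ij s_i s_j ≥ 0. Quadratic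
energy growth and a logarithmic cut-off drive the right-hand side to zero, so both integrands vanish
almost everywhere (`curv_and_reaction_eq_zero`).

Zero curvature means ∇(∂_{y_l}u^i / r_i) = 0: the direction of ∇_y u^i is locally constant on {∇_y
u^i ≠ 0}, jointly in x and y (`dirY_eq_of_isPreconnected`). Zero coupling means that ∇_y u^i and ∇_y
u^j are parallel wherever F_ij ≠ 0. On a fixed fibre, a function whose gradient has locally constant
direction has constant gradient along the hyperplanes orthogonal to it
(`HasLocallyConstDir.gradient_add`); this spreads parallelism from the box where the F_ij have a
strict sign to the whole fibre (`parallel_of_parallel_on_box`). Fubini gives this for almost every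
x, and local constancy in x gives it for every x (`parallel_of_ae_parallel`). One unit vector chosen
on the common line of each fibre then serves all the components at once. -/

noncomputable section

/-! ### Partial derivatives, C¹ test functions, mollification, quadratic forms. -/

section Calculus

open Set Filter Topology

set_option linter.unusedSectionVars false

variable {ι : Type} [Fintype ι] [DecidableEq ι]

/-- The partial derivative of `f` in the coordinate `k`. -/
def pd (k : ι) (f : EuclideanSpace ℝ ι → ℝ) (X : EuclideanSpace ℝ ι) : ℝ :=
  fderiv ℝ f X (EuclideanSpace.single k 1)

/-- The vector of the partial derivatives. -/
def pdv (f : EuclideanSpace ℝ ι → ℝ) (X : EuclideanSpace ℝ ι) : ι → ℝ := fun k => pd k f X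

/-- `C¹` functions with compact support in `U`. -/
structure IsTestC1 (U : Set (EuclideanSpace ℝ ι)) (ψ : EuclideanSpace ℝ ι → ℝ) : Prop where
  contDiff : ContDiff ℝ 1 ψ
  compact : HasCompactSupport ψ
  subset : tsupport ψ ⊆ U

theorem gradient_coord (f : EuclideanSpace ℝ ι → ℝ) (X : EuclideanSpace ℝ ι) (k : ι) :
    gradient f X k = pd k f X := by
  have h : inner ℝ (gradient f X) (EuclideanSpace.single k (1 : ℝ)) = gradient f X k := by
    rw [EuclideanSpace.inner_single_right]; simp
  rw [← h, gradient, InnerProductSpace.toDual_symm_apply, pd]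

theorem pd_mul {f g : EuclideanSpace ℝ ι → ℝ} {X : EuclideanSpace ℝ ι}
    (hf : DifferentiableAt ℝ f X) (hg : DifferentiableAt ℝ g X) (k : ι) :
    pd k (fun X => f X * g X) X = f X * pd k g X + pd k f X * g X := by
  unfold pd
  rw [fderiv_fun_mul hf hg]
  simp [mul_comm]

theorem pd_const_mul {f : EuclideanSpace ℝ ι → ℝ} {X : EuclideanSpace ℝ ι}
    (hf : DifferentiableAt ℝ f X) (c : ℝ) (k : ι) :
    pd k (fun X => c * f X) X = c * pd k f X := by
  unfold pd
  rw [fderiv_const_mul hf]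
  simp

theorem pd_comp {h : ℝ → ℝ} {f : EuclideanSpace ℝ ι → ℝ} {X : EuclideanSpace ℝ ι}
    (hh : DifferentiableAt ℝ h (f X)) (hf : DifferentiableAt ℝ f X) (k : ι) :
    pd k (fun X => h (f X)) X = deriv h (f X) * pd k f X := by
  have := (hh.hasDerivAt.comp_hasFDerivAt X hf.hasFDerivAt).fderiv
  unfold pd
  rw [show (fun X => h (f X)) = h ∘ f from rfl, this]
  simp

theorem pd_congr {f g : EuclideanSpace ℝ ι → ℝ} {X : EuclideanSpace ℝ ι} (h : f =ᶠ[𝓝 X] g)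
    (k : ι) : pd k f X = pd k g X := by
  unfold pd; rw [h.fderiv_eq]

theorem pd_eq_zero_of_notMem_tsupport {f : EuclideanSpace ℝ ι → ℝ} {X : EuclideanSpace ℝ ι}
    (h : X ∉ tsupport f) (k : ι) : pd k f X = 0 := by
  unfold pd; rw [fderiv_of_notMem_tsupport ℝ h]; rfl

theorem hasLineDerivAt_pd {f : EuclideanSpace ℝ ι → ℝ} {X : EuclideanSpace ℝ ι}
    (hf : DifferentiableAt ℝ f X) (k : ι) :
    HasLineDerivAt ℝ f (pd k f X) X (EuclideanSpace.single k 1) :=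
  hf.hasFDerivAt.hasLineDerivAt _

theorem continuous_pd {f : EuclideanSpace ℝ ι → ℝ} (hf : ContDiff ℝ 1 f) (k : ι) :
    Continuous (pd k f) :=
  (hf.continuous_fderiv one_ne_zero).clm_apply continuous_const

theorem contDiff_pd {f : EuclideanSpace ℝ ι → ℝ} {n m : WithTop ℕ∞} (hf : ContDiff ℝ n f)
    (h : m + 1 ≤ n) (k : ι) : ContDiff ℝ m (pd k f) :=
  (hf.fderiv_right h).clm_apply contDiff_const

theorem contDiffOn_pd {f : EuclideanSpace ℝ ι → ℝ} {U : Set (EuclideanSpace ℝ ι)} (hU : IsOpen U)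
    {n m : WithTop ℕ∞} (hf : ContDiffOn ℝ n f U) (h : m + 1 ≤ n) (k : ι) :
    ContDiffOn ℝ m (pd k f) U :=
  (hf.fderiv_of_isOpen hU h).clm_apply contDiffOn_const

theorem continuousOn_pd {f : EuclideanSpace ℝ ι → ℝ} {U : Set (EuclideanSpace ℝ ι)}
    (hU : IsOpen U) (hf : ContDiffOn ℝ 1 f U) (k : ι) : ContinuousOn (pd k f) U :=
  (hf.continuousOn_fderiv_of_isOpen hU le_rfl).clm_apply continuousOn_const

theorem tsupport_pd_subset (f : EuclideanSpace ℝ ι → ℝ) (k : ι) : tsupport (pd k f) ⊆ tsupport f :=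
  tsupport_fderiv_apply_subset ℝ _

theorem HasCompactSupport.pd {f : EuclideanSpace ℝ ι → ℝ} (hf : HasCompactSupport f) (k : ι) :
    HasCompactSupport (pd k f) :=
  hf.fderiv_apply ℝ _

/-- Pure second derivatives commute. -/
theorem pd_pd_comm {f : EuclideanSpace ℝ ι → ℝ} {X : EuclideanSpace ℝ ι}
    (hf : ContDiffAt ℝ 2 f X) (k l : ι) : pd k (pd l f) X = pd l (pd k f) X := by
  have hs : IsSymmSndFDerivAt ℝ f X := hf.isSymmSndFDerivAt (by simp)
  have hd : DifferentiableAt ℝ (fderiv ℝ f) X :=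
    (hf.fderiv_right (m := 1) (by norm_num)).differentiableAt one_ne_zero
  have key : ∀ a b : ι, _root_.pd a (_root_.pd b f) X =
      fderiv ℝ (fderiv ℝ f) X (EuclideanSpace.single a 1) (EuclideanSpace.single b 1) := by
    intro a b
    have : HasFDerivAt (_root_.pd b f)
        ((ContinuousLinearMap.apply ℝ ℝ (EuclideanSpace.single b (1 : ℝ))).comp
          (fderiv ℝ (fderiv ℝ f) X)) X :=
      (ContinuousLinearMap.apply ℝ ℝ
        (EuclideanSpace.single b (1 : ℝ))).hasFDerivAt.comp X hd.hasFDerivAt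
    unfold _root_.pd at this ⊢
    rw [this.fderiv]
    rfl
  rw [key, key, hs.eq]

/-- A function with compact support which is regular near its support is regular. -/
theorem ContDiffOn.contDiff_of_tsupport {f : EuclideanSpace ℝ ι → ℝ}
    {U : Set (EuclideanSpace ℝ ι)} {n : WithTop ℕ∞} (hU : IsOpen U) (hf : ContDiffOn ℝ n f U)
    (h : tsupport f ⊆ U) : ContDiff ℝ n f := by
  rw [contDiff_iff_contDiffAt]
  intro X
  by_cases hX : X ∈ tsupport f
  · exact hf.contDiffAt (hU.mem_nhds (h hX))
  · have : f =ᶠ[𝓝 X] fun _ => 0 := notMem_tsupport_iff_eventuallyEq.mp hX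
    exact contDiffAt_const.congr_of_eventuallyEq this

theorem continuous_mul_of_tsupport {g ψ : EuclideanSpace ℝ ι → ℝ} {U : Set (EuclideanSpace ℝ ι)}
    (hU : IsOpen U) (hg : ContinuousOn g U) (hψ : Continuous ψ) (h : tsupport ψ ⊆ U) :
    Continuous fun X => g X * ψ X := by
  rw [continuous_iff_continuousAt]
  intro X
  by_cases hX : X ∈ tsupport ψ
  · exact (hg.continuousAt (hU.mem_nhds (h hX))).mul hψ.continuousAt
  · have : ψ =ᶠ[𝓝 X] fun _ => 0 := notMem_tsupport_iff_eventuallyEq.mp hX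
    have h2 : (fun X => g X * ψ X) =ᶠ[𝓝 X] fun _ => 0 := by
      filter_upwards [this] with Y hY
      simp [hY]
    exact continuousAt_const.congr h2.symm

theorem IsTestC1.mono {U V : Set (EuclideanSpace ℝ ι)} {ψ : EuclideanSpace ℝ ι → ℝ}
    (h : IsTestC1 U ψ) (hUV : U ⊆ V) : IsTestC1 V ψ :=
  ⟨h.contDiff, h.compact, h.subset.trans hUV⟩

theorem IsTestC1.differentiableAt {U : Set (EuclideanSpace ℝ ι)} {ψ : EuclideanSpace ℝ ι → ℝ}
    (h : IsTestC1 U ψ) (X : EuclideanSpace ℝ ι) : DifferentiableAt ℝ ψ X :=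
  h.contDiff.differentiable one_ne_zero X

/-- Regularity of g outside U is irrelevant, because the product vanishes near every point there.
This makes test functions out of r and of the first derivatives of the solution, which are C¹ only
away from zeros of a gradient. -/
theorem IsTestC1.mul_left {U : Set (EuclideanSpace ℝ ι)} {g ψ : EuclideanSpace ℝ ι → ℝ}
    (hU : IsOpen U) (hg : ContDiffOn ℝ 1 g U) (h : IsTestC1 U ψ) :
    IsTestC1 U fun X => g X * ψ X := by
  have hs : tsupport (fun X => g X * ψ X) ⊆ tsupport ψ := tsupport_mul_subset_right
  exact ⟨(hg.mul h.contDiff.contDiffOn).contDiff_of_tsupport hU (hs.trans h.subset),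
    h.compact.mul_left, hs.trans h.subset⟩

/-- The product rule holds at every point: where g may fail to be differentiable, ψ and its
derivatives are zero, so the default value of the derivative of g is multiplied by zero. -/
theorem IsTestC1.pd_mul {U : Set (EuclideanSpace ℝ ι)} {g ψ : EuclideanSpace ℝ ι → ℝ}
    (hU : IsOpen U) (hg : ContDiffOn ℝ 1 g U) (h : IsTestC1 U ψ) (k : ι)
    (X : EuclideanSpace ℝ ι) :
    pd k (fun X => g X * ψ X) X = g X * pd k ψ X + pd k g X * ψ X := by
  by_cases hX : X ∈ tsupport ψ
  · exact _root_.pd_mul ((hg.contDiffAt (hU.mem_nhds (h.subset hX))).differentiableAt one_ne_zero)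
      (h.differentiableAt X) k
  · have hs : tsupport (fun X => g X * ψ X) ⊆ tsupport ψ := tsupport_mul_subset_right
    rw [pd_eq_zero_of_notMem_tsupport (fun h' => hX (hs h')), pd_eq_zero_of_notMem_tsupport hX,
      image_eq_zero_of_notMem_tsupport hX]
    simp

/-- The average of g differs from g X by at most the oscillation 2B. The resulting 3B is crude, but
only a bound independent of the bump matters. -/
theorem norm_normed_convolution_le {G : Type*} [NormedAddCommGroup G] [NormedSpace ℝ G]
    [CompleteSpace G] (b : ContDiffBump (0 : EuclideanSpace ℝ ι)) {g : EuclideanSpace ℝ ι → G}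
    (hg : Continuous g) {B : ℝ} (hB : ∀ X, ‖g X‖ ≤ B) (X : EuclideanSpace ℝ ι) :
    ‖convolution (b.normed volume) g (ContinuousLinearMap.lsmul ℝ ℝ) volume X‖
      ≤ B + (B + B) := by
  have := b.dist_normed_convolution_le (μ := volume) (x₀ := X) (ε := B + B)
    hg.aestronglyMeasurable (fun x _ => by
      rw [dist_eq_norm]; exact (norm_sub_le _ _).trans (add_le_add (hB x) (hB X)))
  rw [dist_eq_norm] at this
  have h2 := norm_sub_norm_le
    (convolution (b.normed volume) g (ContinuousLinearMap.lsmul ℝ ℝ) volume X) (g X)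
  linarith [hB X]

/-- Mollification of `C¹` functions with compact support. -/
theorem IsTestC1.exists_smooth_approx {U : Set (EuclideanSpace ℝ ι)} (hU : IsOpen U)
    {ψ : EuclideanSpace ℝ ι → ℝ} (h : IsTestC1 U ψ) :
    ∃ (φ : ℕ → EuclideanSpace ℝ ι → ℝ) (K : Set (EuclideanSpace ℝ ι)) (B : ℝ),
      IsCompact K ∧ K ⊆ U ∧
      (∀ n, ContDiff ℝ ((⊤ : ℕ∞) : WithTop ℕ∞) (φ n)) ∧ (∀ n, HasCompactSupport (φ n)) ∧
      (∀ n, tsupport (φ n) ⊆ K) ∧ (∀ n X, |φ n X| ≤ B) ∧ (∀ n k X, |pd k (φ n) X| ≤ B) ∧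
      (∀ X, Tendsto (fun n => φ n X) atTop (𝓝 (ψ X))) ∧
      (∀ k X, Tendsto (fun n => pd k (φ n) X) atTop (𝓝 (pd k ψ X))) := by
  obtain ⟨δ, hδ, hδU⟩ := h.compact.exists_cthickening_subset_open hU h.subset
  -- The outer radii tend to zero and never exceed δ, so all the mollifications are supported in one
  -- compact thickening of the support that stays inside U.
  let b : ℕ → ContDiffBump (0 : EuclideanSpace ℝ ι) := fun n =>
    ⟨δ / (n + 1) / 2, δ / (n + 1), by positivity, half_lt_self (by positivity)⟩
  have hb : ∀ n, (b n).rOut ≤ δ := fun n => div_le_self hδ.le (by simp)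
  have hblim : Tendsto (fun n => (b n).rOut) atTop (𝓝 0) := by
    have := (tendsto_const_nhds (x := δ)).mul
      (tendsto_one_div_add_atTop_nhds_zero_nat (𝕜 := ℝ))
    simpa [b, div_eq_mul_inv] using this
  let L := ContinuousLinearMap.lsmul ℝ ℝ (E := ℝ)
  let φ : ℕ → EuclideanSpace ℝ ι → ℝ := fun n => convolution ((b n).normed volume) ψ L volume
  have hψc := h.contDiff.continuous
  have hdc := h.contDiff.continuous_fderiv one_ne_zero
  have hloc : ∀ n, LocallyIntegrable ((b n).normed volume) volume := fun n =>
    ((b n).continuous_normed).locallyIntegrable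
  have hsupp : ∀ n, tsupport (φ n) ⊆ Metric.cthickening δ (tsupport ψ) := by
    intro n
    refine closure_minimal ?_ Metric.isClosed_cthickening
    refine (support_convolution_subset L).trans ?_
    rintro _ ⟨y, hy, z, hz, rfl⟩
    rw [(b n).support_normed_eq] at hy
    refine Metric.mem_cthickening_of_dist_le _ z _ _ (subset_tsupport _ hz) ?_
    have : ‖y‖ < (b n).rOut := by simpa using hy
    simpa [dist_eq_norm] using this.le.trans (hb n)
  have hKc : IsCompact (Metric.cthickening δ (tsupport ψ)) := h.compact.isCompact.cthickening
  have hfd : ∀ n X, fderiv ℝ (φ n) X = convolution ((b n).normed volume) (fderiv ℝ ψ)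
      (ContinuousLinearMap.lsmul ℝ ℝ) volume X := by
    intro n X
    have := (h.compact.hasFDerivAt_convolution_right L (hloc n) h.contDiff X).fderiv
    refine this.trans ?_
    congr 1
  obtain ⟨B1, hB1⟩ := h.compact.exists_bound_of_continuous hψc
  obtain ⟨B2, hB2⟩ := (h.compact.fderiv ℝ).exists_bound_of_continuous hdc
  refine ⟨φ, Metric.cthickening δ (tsupport ψ), max (B1 + (B1 + B1)) (B2 + (B2 + B2)), hKc, hδU,
    ?_, ?_, hsupp, ?_, ?_, ?_, ?_⟩
  · intro n
    exact (b n).hasCompactSupport_normed.contDiff_convolution_left L (b n).contDiff_normed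
      hψc.locallyIntegrable
  · intro n
    exact hKc.of_isClosed_subset (isClosed_tsupport _) (hsupp n)
  · intro n X
    exact (norm_normed_convolution_le (b n) hψc hB1 X).trans (le_max_left _ _)
  · intro n k X
    have h1 : ‖fderiv ℝ (φ n) X‖ ≤ B2 + (B2 + B2) := by
      rw [hfd]; exact norm_normed_convolution_le (b n) hdc hB2 X
    have h2 := (fderiv ℝ (φ n) X).le_opNorm (EuclideanSpace.single k (1 : ℝ))
    simp only [PiLp.norm_single, norm_one, mul_one] at h2
    exact (h2.trans h1).trans (le_max_right _ _)
  · intro X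
    exact ContDiffBump.convolution_tendsto_right_of_continuous hblim hψc X
  · intro k X
    have := ContDiffBump.convolution_tendsto_right_of_continuous (μ := volume) hblim hdc X
    simp only [pd, hfd]
    exact ((ContinuousLinearMap.apply ℝ ℝ
      (EuclideanSpace.single k (1 : ℝ))).continuous.tendsto _).comp this

/-- The bilinear form of a matrix. -/
def quad (M : Matrix ι ι ℝ) (ξ η : ι → ℝ) : ℝ := ∑ k, ∑ l, M k l * ξ l * η k

theorem quad_add_left (M : Matrix ι ι ℝ) (ξ ξ' η : ι → ℝ) :
    quad M (ξ + ξ') η = quad M ξ η + quad M ξ' η := by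
  simp only [quad, ← Finset.sum_add_distrib, Pi.add_apply, mul_add, add_mul]

theorem quad_add_right (M : Matrix ι ι ℝ) (ξ η η' : ι → ℝ) :
    quad M ξ (η + η') = quad M ξ η + quad M ξ η' := by
  simp only [quad, ← Finset.sum_add_distrib, Pi.add_apply, mul_add]

theorem quad_smul_left (M : Matrix ι ι ℝ) (c : ℝ) (ξ η : ι → ℝ) :
    quad M (c • ξ) η = c * quad M ξ η := by
  simp only [quad, Finset.mul_sum, Pi.smul_apply, smul_eq_mul]
  congr! 2; ring

theorem quad_smul_right (M : Matrix ι ι ℝ) (c : ℝ) (ξ η : ι → ℝ) :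
    quad M ξ (c • η) = c * quad M ξ η := by
  simp only [quad, Finset.mul_sum, Pi.smul_apply, smul_eq_mul]
  congr! 2; ring

theorem quad_comm {M : Matrix ι ι ℝ} (hM : M.IsHermitian) (ξ η : ι → ℝ) :
    quad M ξ η = quad M η ξ := by
  unfold quad
  rw [Finset.sum_comm]
  refine Finset.sum_congr rfl fun k _ => Finset.sum_congr rfl fun l _ => ?_
  have : M l k = M k l := by simpa using hM.apply k l
  rw [this]; ring

theorem quad_zero_left (M : Matrix ι ι ℝ) (η : ι → ℝ) : quad M 0 η = 0 := by simp [quad]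

theorem quad_eq_dotProduct (M : Matrix ι ι ℝ) (ξ : ι → ℝ) :
    quad M ξ ξ = star ξ ⬝ᵥ (M.mulVec ξ) := by
  simp only [quad, dotProduct, Matrix.mulVec, Finset.mul_sum, star_trivial]
  congr! 2; ring

theorem quad_pos {M : Matrix ι ι ℝ} (hM : M.PosDef) {ξ : ι → ℝ} (hξ : ξ ≠ 0) :
    0 < quad M ξ ξ := by
  rw [quad_eq_dotProduct]; exact hM.dotProduct_mulVec_pos hξ

theorem quad_nonneg {M : Matrix ι ι ℝ} (hM : M.PosDef) (ξ : ι → ℝ) : 0 ≤ quad M ξ ξ := by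
  rw [quad_eq_dotProduct]; exact hM.posSemidef.dotProduct_mulVec_nonneg ξ

/-- Parallelogram law with the nonnegative term at ξ − η discarded. -/
theorem quad_add_self_le {M : Matrix ι ι ℝ} (hM : M.PosDef) (ξ η : ι → ℝ) :
    quad M (ξ + η) (ξ + η) ≤ 2 * quad M ξ ξ + 2 * quad M η η := by
  have h := quad_nonneg hM (ξ + (-1 : ℝ) • η)
  simp only [quad_add_left, quad_add_right, quad_smul_left, quad_smul_right] at h ⊢
  linarith

/-- A positive definite matrix is bounded by its largest eigenvalue. -/
theorem quad_le_largestEigenvalue {M : Matrix ι ι ℝ} (hM : M.PosDef) (ξ : ι → ℝ) :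
    quad M ξ ξ ≤ largestEigenvalue M * ∑ k, ξ k ^ 2 := by
  -- The supremum defining the largest eigenvalue is meaningful because the spectrum is finite; the
  -- bound is then positivity of c − M, whose eigenvalues are c minus those of M.
  have hfin : BddAbove (spectrum ℝ M) := by
    rw [hM.isHermitian.spectrum_real_eq_range_eigenvalues]
    exact (Set.finite_range _).bddAbove
  set c := largestEigenvalue M with hc
  have hH : (c • (1 : Matrix ι ι ℝ) - M).IsHermitian := by
    refine Matrix.IsHermitian.sub ?_ hM.isHermitian
    simp [Matrix.IsHermitian]
  have hps : (c • (1 : Matrix ι ι ℝ) - M).PosSemidef := by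
    rw [hH.posSemidef_iff_eigenvalues_nonneg]
    intro i
    have h1 : hH.eigenvalues i ∈ spectrum ℝ (c • (1 : Matrix ι ι ℝ) - M) := by
      rw [hH.spectrum_real_eq_range_eigenvalues]; exact ⟨i, rfl⟩
    generalize hH.eigenvalues i = e at h1 ⊢
    rw [← Algebra.algebraMap_eq_smul_one, ← spectrum.singleton_sub_eq] at h1
    obtain ⟨a, ha, b, hb, hab⟩ := h1
    have h2 : b ≤ c := le_csSup hfin hb
    simp only [Set.mem_singleton_iff] at ha
    simp only [Pi.zero_apply]
    rw [← hab, ha]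
    exact sub_nonneg.mpr h2
  have := hps.dotProduct_mulVec_nonneg ξ
  rw [Matrix.sub_mulVec, dotProduct_sub, ← quad_eq_dotProduct M, Matrix.smul_mulVec,
    Matrix.one_mulVec, dotProduct_smul] at this
  have h3 : star ξ ⬝ᵥ ξ = ∑ k, ξ k ^ 2 := by simp [dotProduct, sq]
  rw [h3, smul_eq_mul] at this
  linarith

end Calculus

/-! ### Limits of integrals; stability for C¹ test functions. -/

section Linearized

open Set Filter Topology

set_option linter.unusedSectionVars false

section General

variable {ι : Type} [Fintype ι] [DecidableEq ι]

/-- The Euclidean norm of a family of differentiable functions. -/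
theorem differentiableAt_sqrt_sum_sq {κ : Type*} [Fintype κ] {w : κ → EuclideanSpace ℝ ι → ℝ}
    {X : EuclideanSpace ℝ ι} (hw : ∀ p, DifferentiableAt ℝ (w p) X)
    (h0 : ∑ p, w p X ^ 2 ≠ 0) :
    DifferentiableAt ℝ (fun Y => √(∑ p, w p Y ^ 2)) X :=
  (DifferentiableAt.fun_sum fun p _ => (hw p).pow 2).sqrt h0

/-- The index family is arbitrary because the formula serves both |∇v| (all coordinates) and |∇_y v|
(fibre coordinates only). -/
theorem pd_sqrt_sum_sq {κ : Type*} [Fintype κ] {w : κ → EuclideanSpace ℝ ι → ℝ}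
    {X : EuclideanSpace ℝ ι} (hw : ∀ p, DifferentiableAt ℝ (w p) X)
    (h0 : ∑ p, w p X ^ 2 ≠ 0) (q : ι) :
    pd q (fun Y => √(∑ p, w p Y ^ 2)) X
      = (∑ p, w p X * pd q (w p) X) / √(∑ p, w p X ^ 2) := by
  have h1 : HasFDerivAt (fun Y => ∑ p, w p Y ^ 2)
      (∑ p, (2 * w p X) • fderiv ℝ (w p) X) X := by
    refine HasFDerivAt.fun_sum fun p _ => ?_
    simpa using (hw p).hasFDerivAt.pow 2
  unfold pd
  rw [(h1.sqrt h0).fderiv]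
  have hpos : √(∑ p, w p X ^ 2) ≠ 0 := by
    rw [Real.sqrt_ne_zero (Finset.sum_nonneg fun _ _ => sq_nonneg _)]; exact h0
  simp only [smul_apply, sum_apply, smul_eq_mul]
  field_simp
  rw [Finset.mul_sum]
  congr! 1 with p; ring

/-- Dominated convergence with majorant B|f| on K. The coefficients of the system are only locally
integrable, so a common set carrying all the g n takes the place of global integrability. -/
theorem tendsto_integral_mul_of_bounded {f : EuclideanSpace ℝ ι → ℝ}
    {K : Set (EuclideanSpace ℝ ι)} (hf : IntegrableOn f K)
    {g : ℕ → EuclideanSpace ℝ ι → ℝ} {g₀ : EuclideanSpace ℝ ι → ℝ} {B : ℝ}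
    (hg : ∀ n, AEStronglyMeasurable (g n) volume) (hs : ∀ n X, X ∉ K → g n X = 0)
    (hB : ∀ n X, |g n X| ≤ B) (hlim : ∀ X, Tendsto (fun n => g n X) atTop (𝓝 (g₀ X))) :
    Tendsto (fun n => ∫ X, f X * g n X) atTop (𝓝 (∫ X, f X * g₀ X)) := by
  have hs0 : ∀ X, X ∉ K → g₀ X = 0 := fun X hX =>
    tendsto_nhds_unique (hlim X) (by simp [hs _ X hX])
  have e : ∀ g : EuclideanSpace ℝ ι → ℝ, (∀ X, X ∉ K → g X = 0) →
      ∫ X, f X * g X = ∫ X in K, f X * g X := fun g hg =>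
    (setIntegral_eq_integral_of_forall_compl_eq_zero fun X hX => by simp [hg X hX]).symm
  rw [e g₀ hs0]
  simp_rw [fun n => e (g n) (hs n)]
  refine tendsto_integral_of_dominated_convergence (fun X => |f X| * B) ?_ ?_ ?_ ?_
  · exact fun n => hf.aestronglyMeasurable.mul (hg n).restrict
  · exact hf.abs.mul_const B
  · intro n
    refine Eventually.of_forall fun X => ?_
    rw [norm_mul]
    exact mul_le_mul_of_nonneg_left (hB n X) (abs_nonneg _)
  · exact Eventually.of_forall fun X => (hlim X).const_mul _

theorem integral_quad {μ : Measure (EuclideanSpace ℝ ι)}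
    {A : EuclideanSpace ℝ ι → Matrix ι ι ℝ} {ξ η : EuclideanSpace ℝ ι → ι → ℝ}
    (h : ∀ k l, Integrable (fun X => A X k l * (ξ X l * η X k)) μ) :
    ∫ X, quad (A X) (ξ X) (η X) ∂μ = ∑ k, ∑ l, ∫ X, A X k l * (ξ X l * η X k) ∂μ := by
  unfold quad
  simp_rw [mul_assoc]
  rw [integral_finsetSum _ fun k _ => integrable_finsetSum _ fun l _ => h k l]
  exact Finset.sum_congr rfl fun k _ => integral_finsetSum _ fun l _ => h k l

theorem integrable_quad {μ : Measure (EuclideanSpace ℝ ι)}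
    {A : EuclideanSpace ℝ ι → Matrix ι ι ℝ} {ξ η : EuclideanSpace ℝ ι → ι → ℝ}
    (h : ∀ k l, Integrable (fun X => A X k l * (ξ X l * η X k)) μ) :
    Integrable (fun X => quad (A X) (ξ X) (η X)) μ := by
  unfold quad
  simp_rw [mul_assoc]
  exact integrable_finsetSum _ fun k _ => integrable_finsetSum _ fun l _ => h k l

theorem integrable_mul_of_tsupport {f g : EuclideanSpace ℝ ι → ℝ}
    (hf : LocallyIntegrable f volume) (hg : Continuous g) (hc : HasCompactSupport g) :
    Integrable fun X => f X * g X :=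
  hf.integrable_smul_right_of_hasCompactSupport hg hc

end General

variable {m d n : ℕ}

theorem IsTestC1.isTestFun_mono {U : Set (FibSpace m d)} {φ : FibSpace m d → ℝ}
    (h : IsTestFun φ) (hs : tsupport φ ⊆ U) : IsTestC1 U φ :=
  ⟨h.1.of_le (by exact_mod_cast le_top), h.2, hs⟩

theorem coefMatrix_isHermitian (a : EuclideanSpace ℝ (Fin m) → ℝ → ℝ)
    (x : EuclideanSpace ℝ (Fin m)) (η : FibSpace m d) : (coefMatrix a x η).IsHermitian := by
  ext k l
  simp only [coefMatrix, Matrix.conjTranspose_apply, Matrix.of_apply, star_trivial,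
    eq_comm (a := l) (b := k), mul_comm (η l)]

theorem norm_gradient (v : FibSpace m d → ℝ) (X : FibSpace m d) :
    ‖gradient v X‖ = √(∑ p, pd p v X ^ 2) := by
  rw [EuclideanSpace.norm_eq]
  simp [gradient_coord]

theorem continuous_gradient {v : FibSpace m d → ℝ} (hv : ContDiff ℝ 1 v) :
    Continuous (fun X => gradient v X) := by
  unfold gradient
  exact (LinearIsometryEquiv.continuous _).comp (hv.continuous_fderiv one_ne_zero)

theorem isOpen_gradient_ne {v : FibSpace m d → ℝ} (hv : ContDiff ℝ 1 v) :
    IsOpen {X | gradient v X ≠ 0} :=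
  isOpen_ne_fun (continuous_gradient hv) continuous_const

/-- Stability holds for `C¹` functions with compact support. -/
theorem IsStable.nonneg_of_isTestC1 {a : Fin n → EuclideanSpace ℝ (Fin m) → ℝ → ℝ}
    {F : EuclideanSpace ℝ (Fin m) → (Fin n → ℝ) → ℝ} {u : Fin n → FibSpace m d → ℝ}
    (h : IsStable a F u) {ψ : Fin n → FibSpace m d → ℝ} (hψ : ∀ i, IsTestC1 univ (ψ i)) :
    0 ≤ (∑ i, ∫ X, quad (matrixAlong (a i) (u i) X) (pdv (ψ i) X) (pdv (ψ i) X))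
        - ∑ i, ∑ j, ∫ X, nlFF F i j (xPart X) (fun k => u k X) * (ψ i X * ψ j X) := by
  obtain ⟨hA, hf, hst⟩ := h
  -- Mollify each component: the test functions s_i r_i ζ_i used later are only C¹, while stability
  -- is assumed for smooth ones.
  choose φ K B hK _ hsm hcs hsub hb hbd hlim hdlim using fun i =>
    (hψ i).exists_smooth_approx isOpen_univ
  have hzero : ∀ i n X, X ∉ K i → φ i n X = 0 := fun i n X hX =>
    image_eq_zero_of_notMem_tsupport fun h' => hX (hsub i n h')
  have hdzero : ∀ i n k X, X ∉ K i → pd k (φ i n) X = 0 := fun i n k X hX =>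
    pd_eq_zero_of_notMem_tsupport (fun h' => hX (hsub i n h')) k
  have hC1 : ∀ i n, IsTestC1 univ (φ i n) := fun i n =>
    IsTestC1.isTestFun_mono ⟨hsm i n, hcs i n⟩ (subset_univ _)
  have hq : ∀ (i : Fin n) (ψ : FibSpace m d → ℝ), IsTestC1 univ ψ → ∀ k l,
      Integrable fun X => matrixAlong (a i) (u i) X k l * (pdv ψ X l * pdv ψ X k) := by
    intro i ψ hψ k l
    exact integrable_mul_of_tsupport (hA i k l)
      ((continuous_pd hψ.contDiff l).mul (continuous_pd hψ.contDiff k))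
      ((hψ.compact.pd l).mul_right)
  refine ge_of_tendsto (x := atTop) (f := fun N => (∑ i, ∫ X, quad (matrixAlong (a i) (u i) X)
      (pdv (φ i N) X) (pdv (φ i N) X))
      - ∑ i, ∑ j, ∫ X, nlFF F i j (xPart X) (fun k => u k X) * (φ i N X * φ j N X))
    ?_ (Eventually.of_forall fun N => ?_)
  · refine Tendsto.sub (tendsto_finsetSum _ fun i _ => ?_)
      (tendsto_finsetSum _ fun i _ => tendsto_finsetSum _ fun j _ => ?_)
    · rw [integral_quad (hq i _ (hψ i))]
      simp_rw [fun N => integral_quad (hq i _ (hC1 i N))]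
      refine tendsto_finsetSum _ fun k _ => tendsto_finsetSum _ fun l _ => ?_
      refine tendsto_integral_mul_of_bounded (B := B i * B i)
        ((hA i k l).integrableOn_isCompact (hK i)) (fun N => ?_) (fun N X hX => ?_)
        (fun N X => ?_) (fun X => (hdlim i l X).mul (hdlim i k X))
      · exact ((continuous_pd (hC1 i N).contDiff l).mul
          (continuous_pd (hC1 i N).contDiff k)).aestronglyMeasurable
      · simp [pdv, hdzero i N _ X hX]
      · rw [abs_mul]
        exact mul_le_mul (hbd i N l X) (hbd i N k X) (abs_nonneg _)
          ((abs_nonneg _).trans (hbd i N l X))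
    · refine tendsto_integral_mul_of_bounded (B := B i * B j)
        ((hf i j).integrableOn_isCompact (hK i)) (fun N => ?_) (fun N X hX => ?_)
        (fun N X => ?_) (fun X => (hlim i X).mul (hlim j X))
      · exact ((hC1 i N).contDiff.continuous.mul
          (hC1 j N).contDiff.continuous).aestronglyMeasurable
      · simp [hzero i N X hX]
      · rw [abs_mul]
        exact mul_le_mul (hb i N X) (hb j N X) (abs_nonneg _)
          ((abs_nonneg _).trans (hb i N X))
  · have := hst (fun i => φ i N) fun i => ⟨hsm i N, hcs i N⟩
    simpa only [quad, pdv, gradient_coord, mul_assoc] using this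

end Linearized

/-! ### The linearized equation for the derivatives along the fibres. -/

section Linearized2

open Set Filter Topology

variable {m d n : ℕ}

theorem xPart_add_smul_single (X : FibSpace m d) (t : ℝ) (l : Fin d) :
    xPart (X + t • EuclideanSpace.single (Sum.inr l) (1 : ℝ)) = xPart X := by
  ext i
  simp [xPart]

/-- The flux has a line derivative in the fibre directions, given by the linearized matrix. -/
theorem hasLineDerivAt_flux {a : EuclideanSpace ℝ (Fin m) → ℝ → ℝ} (ha : IsCoefficient a)
    {v : FibSpace m d → ℝ} (hv : ContDiff ℝ 1 v)
    (hv2 : ContDiffOn ℝ 2 v {X | gradient v X ≠ 0}) {X : FibSpace m d} (hX : gradient v X ≠ 0)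
    (l : Fin d) (k : Fin m ⊕ Fin d) :
    HasLineDerivAt ℝ (fun Y => a (xPart Y) ‖gradient v Y‖ * pd k v Y)
      (∑ p, matrixAlong a v X k p * pd p (pd (Sum.inr l) v) X) X
      (EuclideanSpace.single (Sum.inr l) 1) := by
  have hΩ := isOpen_gradient_ne hv
  have hat : ContDiffAt ℝ 2 v X := hv2.contDiffAt (hΩ.mem_nhds hX)
  have hd : ∀ p, DifferentiableAt ℝ (pd p v) X := fun p =>
    ((contDiffOn_pd hΩ hv2 (m := 1) (by norm_num) p).contDiffAt
      (hΩ.mem_nhds hX)).differentiableAt one_ne_zero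
  have hpos : 0 < ‖gradient v X‖ := norm_pos_iff.mpr hX
  have h0 : ∑ p, pd p v X ^ 2 ≠ 0 := by
    intro h; rw [norm_gradient, h] at hpos; simp at hpos
  have hN : HasLineDerivAt ℝ (fun Y => ‖gradient v Y‖)
      ((∑ p, pd p v X * pd (Sum.inr l) (pd p v) X) / ‖gradient v X‖) X
      (EuclideanSpace.single (Sum.inr l) 1) := by
    simp_rw [norm_gradient]
    rw [← pd_sqrt_sum_sq hd h0]
    exact hasLineDerivAt_pd (differentiableAt_sqrt_sum_sq hd h0) _
  -- Here |∇v(X)| > 0 is essential: `a x` is C¹ only on the open half-line. The derivative in x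
  -- never enters, since shifts along the fibre fix x.
  have hda : HasDerivAt (a (xPart X)) (deriv (a (xPart X)) ‖gradient v X‖) ‖gradient v X‖ :=
    (((ha.2.2 (xPart X)).contDiffAt (Ioi_mem_nhds hpos)).differentiableAt one_ne_zero).hasDerivAt
  have hprod := (HasDerivAt.comp_of_eq (0 : ℝ) hda hN (by simp)).mul
    (hasLineDerivAt_pd (hd k) (Sum.inr l))
  have hgoal : HasDerivAt (fun t : ℝ => a (xPart (X + t • EuclideanSpace.single (Sum.inr l) (1 : ℝ)))
      ‖gradient v (X + t • EuclideanSpace.single (Sum.inr l) (1 : ℝ))‖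
      * pd k v (X + t • EuclideanSpace.single (Sum.inr l) (1 : ℝ)))
      (∑ p, matrixAlong a v X k p * pd p (pd (Sum.inr l) v) X) 0 := by
    simp_rw [xPart_add_smul_single]
    refine hprod.congr_deriv ?_
    simp only [Function.comp, zero_smul, add_zero, matrixAlong, coefMatrix, Matrix.of_apply, gradient_coord]
    simp_rw [add_mul, Finset.sum_add_distrib]
    rw [add_comm]
    congr 1
    · rw [Finset.sum_eq_single k]
      · simp [pd_pd_comm hat]
      · intro b _ hb; simp [hb.symm]
      · simp
    · rw [Finset.sum_div, Finset.mul_sum, Finset.sum_mul]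
      refine Finset.sum_congr rfl fun p _ => ?_
      rw [pd_pd_comm hat p]; ring
  exact hgoal

/-- The reaction term has a line derivative in the fibre directions. -/
theorem hasLineDerivAt_reaction {F : EuclideanSpace ℝ (Fin m) → (Fin n → ℝ) → ℝ}
    (hF : ∀ x, ContDiff ℝ 2 (F x)) {u : Fin n → FibSpace m d → ℝ}
    (hu : ∀ i, ContDiff ℝ 1 (u i)) (i : Fin n) (l : Fin d) (X : FibSpace m d) :
    HasLineDerivAt ℝ (fun Y => nlF F i (xPart Y) (fun k => u k Y))
      (∑ j, nlFF F i j (xPart X) (fun k => u k X) * pd (Sum.inr l) (u j) X) X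
      (EuclideanSpace.single (Sum.inr l) 1) := by
  have hG : DifferentiableAt ℝ (nlF F i (xPart X)) (fun k => u k X) := by
    have : ContDiff ℝ 1 (nlF F i (xPart X)) :=
      ((hF (xPart X)).fderiv_right (m := 1) (by norm_num)).clm_apply contDiff_const
    exact this.differentiable one_ne_zero _
  have hU : HasDerivAt (fun t : ℝ => fun k => u k (X + t • EuclideanSpace.single (Sum.inr l) (1 : ℝ)))
      (fun k => pd (Sum.inr l) (u k) X) 0 :=
    hasDerivAt_pi.mpr fun k => hasLineDerivAt_pd ((hu k).differentiable one_ne_zero X) _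
  have hc := HasFDerivAt.comp_hasDerivAt_of_eq (0 : ℝ) hG.hasFDerivAt hU (by simp)
  have hgoal : HasDerivAt (fun t : ℝ =>
      nlF F i (xPart (X + t • EuclideanSpace.single (Sum.inr l) (1 : ℝ)))
        (fun k => u k (X + t • EuclideanSpace.single (Sum.inr l) (1 : ℝ))))
      (∑ j, nlFF F i j (xPart X) (fun k => u k X) * pd (Sum.inr l) (u j) X) 0 := by
    simp_rw [xPart_add_smul_single]
    refine hc.congr_deriv ?_
    refine (LinearMap.pi_apply_eq_sum_univ (fderiv ℝ (nlF F i (xPart X))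
      (fun k => u k X)).toLinearMap _).trans ?_
    refine Finset.sum_congr rfl fun j _ => ?_
    have hs : (fun q => if j = q then (1 : ℝ) else 0) = Pi.single j 1 := by
      ext q; simp [Pi.single_apply, eq_comm]
    rw [hs, smul_eq_mul, mul_comm]
    rfl
  exact hgoal

/-- Integration by parts in a single direction. The flux and the reaction term need not even be
continuous in x, so only line derivatives are available, and for f only on the support of g. -/
theorem integral_mul_lineDeriv {f f' g g' : FibSpace m d → ℝ} {v : FibSpace m d}
    (hf'g : Integrable fun X => f' X * g X) (hfg' : Integrable fun X => f X * g' X)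
    (hfg : Integrable fun X => f X * g X)
    (hf : ∀ X ∈ tsupport g, HasLineDerivAt ℝ f (f' X) X v)
    (hg : ∀ X, HasLineDerivAt ℝ g (g' X) X v) :
    ∫ X, f X * g' X = - ∫ X, f' X * g X := by
  have := integral_bilinear_hasLineDerivAt_right_eq_neg_left_of_integrable (μ := volume)
    (B := ContinuousLinearMap.mul ℝ ℝ) (f := f) (f' := f') (g := g) (g' := g') (v := v)
    (by simpa using hf'g) (by simpa using hfg') (by simpa using hfg) hf (fun X _ => hg X)
  simpa using this

theorem locallyIntegrable_coord {G : FibSpace m d → FibSpace m d}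
    (h : LocallyIntegrable G volume) (k : Fin m ⊕ Fin d) :
    LocallyIntegrable (fun X => G X k) volume := by
  intro X
  obtain ⟨s, hs, hi⟩ := h X
  exact ⟨s, hs, (EuclideanSpace.proj (𝕜 := ℝ) k).integrable_comp hi⟩

/-- The linearized equation for the fibre derivatives, tested with smooth functions. -/
theorem linearized_of_isTestFun {a : Fin n → EuclideanSpace ℝ (Fin m) → ℝ → ℝ}
    {F : EuclideanSpace ℝ (Fin m) → (Fin n → ℝ) → ℝ} {u : Fin n → FibSpace m d → ℝ}
    (ha : ∀ i, IsCoefficient (a i)) (hF : ∀ x, ContDiff ℝ 2 (F x))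
    (hreg : ∀ i, IsRegularSol (u i)) (hsol : IsWeakSolution a F u) (hst : IsStable a F u)
    (i : Fin n) (l : Fin d) {φ : FibSpace m d → ℝ} (hφ : IsTestFun φ)
    (hs : tsupport φ ⊆ {X | gradient (u i) X ≠ 0}) :
    ∫ X, quad (matrixAlong (a i) (u i) X) (pdv (pd (Sum.inr l) (u i)) X) (pdv φ X)
      = ∫ X, (∑ j, nlFF F i j (xPart X) (fun k => u k X) * pd (Sum.inr l) (u j) X) * φ X := by
  have hu1 := fun i => (hreg i).1
  have hu2 := (hreg i).2.1
  have hΩ := isOpen_gradient_ne (hu1 i)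
  have hT : IsTestC1 {X | gradient (u i) X ≠ 0} φ := IsTestC1.isTestFun_mono hφ hs
  have hφd : ∀ k, ContDiff ℝ ((⊤ : ℕ∞) : WithTop ℕ∞) (pd k φ) := fun k =>
    contDiff_pd hφ.1 (by exact_mod_cast le_top) k
  have hφdd : ∀ k q, ContDiff ℝ ((⊤ : ℕ∞) : WithTop ℕ∞) (pd q (pd k φ)) := fun k q =>
    contDiff_pd (hφd k) (by exact_mod_cast le_top) q
  have htest : IsTestFun (pd (Sum.inr l) φ) := ⟨hφd _, hφ.2.pd _⟩
  -- Testing with ∂_{y_l}φ and moving ∂_{y_l} onto the flux and the reaction term differentiates the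
  -- equation in y without differentiating it in x.
  have hweak := hsol.2.2 (fun _ => pd (Sum.inr l) φ) (fun _ => htest) i
  have hw : ∀ q, ContDiffOn ℝ 1 (pd q (u i)) {X | gradient (u i) X ≠ 0} := fun q =>
    contDiffOn_pd hΩ hu2 (by norm_num) q
  have hflux : ∀ k, LocallyIntegrable
      (fun X => a i (xPart X) ‖gradient (u i) X‖ * pd k (u i) X) volume := by
    intro k
    have := locallyIntegrable_coord (hsol.1 i) k
    simpa [gradient_coord] using this
  have hAint : ∀ k p, Integrable fun X =>
      matrixAlong (a i) (u i) X k p * (pd p (pd (Sum.inr l) (u i)) X * pd k φ X) := by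
    intro k p
    have hsk := (tsupport_pd_subset φ k).trans hs
    exact integrable_mul_of_tsupport (hst.1 i k p)
      (continuous_mul_of_tsupport hΩ (continuousOn_pd hΩ (hw _) p) (hφd k).continuous hsk)
      ((hφ.2.pd k).mul_left)
  have hdφ : ∀ X k, DifferentiableAt ℝ (pd k φ) X := fun X k =>
    (hφd k).differentiable (by simp) X
  -- the left-hand side
  have hL : ∫ X, inner ℝ (a i (xPart X) ‖gradient (u i) X‖ • gradient (u i) X)
      (gradient (pd (Sum.inr l) φ) X)
      = - ∫ X, quad (matrixAlong (a i) (u i) X) (pdv (pd (Sum.inr l) (u i)) X) (pdv φ X) := by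
    have h1 : ∀ X, inner ℝ (a i (xPart X) ‖gradient (u i) X‖ • gradient (u i) X)
        (gradient (pd (Sum.inr l) φ) X) = ∑ k, (a i (xPart X) ‖gradient (u i) X‖ * pd k (u i) X)
          * pd (Sum.inr l) (pd k φ) X := by
      intro X
      rw [PiLp.inner_apply]
      refine Finset.sum_congr rfl fun k _ => ?_
      -- The derivatives of φ are interchanged so that the fibre derivative is outermost and can be
      -- integrated by parts.
      rw [pd_pd_comm (contDiff_infty.mp hφ.1 2).contDiffAt (Sum.inr l) k]
      simp [gradient_coord, mul_comm]
    simp_rw [h1]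
    rw [integral_finsetSum _ fun k _ => integrable_mul_of_tsupport (hflux k)
      (hφdd k _).continuous ((hφ.2.pd k).pd _), 
      integral_quad (ξ := pdv (pd (Sum.inr l) (u i))) (η := pdv φ) hAint, ← Finset.sum_neg_distrib]
    refine Finset.sum_congr rfl fun k _ => ?_
    simp only [pdv]
    rw [← integral_finsetSum _ fun p _ => hAint k p]
    have hsum : ∀ X, ∑ p, matrixAlong (a i) (u i) X k p *
        (pd p (pd (Sum.inr l) (u i)) X * pd k φ X)
        = (∑ p, matrixAlong (a i) (u i) X k p * pd p (pd (Sum.inr l) (u i)) X) * pd k φ X := by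
      intro X; rw [Finset.sum_mul]; simp_rw [mul_assoc]
    have hint := integrable_finsetSum Finset.univ fun p _ => hAint k p
    simp_rw [hsum] at hint ⊢
    refine integral_mul_lineDeriv hint
      (integrable_mul_of_tsupport (hflux k) (hφdd k _).continuous ((hφ.2.pd k).pd _))
      (integrable_mul_of_tsupport (hflux k) (hφd k).continuous (hφ.2.pd k))
      (fun X hX => hasLineDerivAt_flux (ha i) (hu1 i) hu2
        (hs (tsupport_pd_subset φ k hX)) l k) (fun X => hasLineDerivAt_pd (hdφ X k) _)
  have hR : ∫ X, nlF F i (xPart X) (fun k => u k X) * pd (Sum.inr l) φ X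
      = - ∫ X, (∑ j, nlFF F i j (xPart X) (fun k => u k X) * pd (Sum.inr l) (u j) X) * φ X := by
    have hint : Integrable fun X =>
        (∑ j, nlFF F i j (xPart X) (fun k => u k X) * pd (Sum.inr l) (u j) X) * φ X := by
      simp_rw [Finset.sum_mul, mul_assoc]
      exact integrable_finsetSum _ fun j _ => integrable_mul_of_tsupport (hst.2.1 i j)
        ((continuous_pd (hu1 j) _).mul hφ.1.continuous) hφ.2.mul_left
    exact integral_mul_lineDeriv hint
      (integrable_mul_of_tsupport (hsol.2.1 i) (hφd _).continuous (hφ.2.pd _))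
      (integrable_mul_of_tsupport (hsol.2.1 i) hφ.1.continuous hφ.2)
      (fun X _ => hasLineDerivAt_reaction hF hu1 i l X)
      (fun X => hasLineDerivAt_pd (hT.differentiableAt X) _)
  rw [hL, hR] at hweak
  exact neg_injective hweak

/-- The linearized equation for the fibre derivatives, tested with `C¹` functions. -/
theorem linearized_of_isTestC1 {a : Fin n → EuclideanSpace ℝ (Fin m) → ℝ → ℝ}
    {F : EuclideanSpace ℝ (Fin m) → (Fin n → ℝ) → ℝ} {u : Fin n → FibSpace m d → ℝ}
    (ha : ∀ i, IsCoefficient (a i)) (hF : ∀ x, ContDiff ℝ 2 (F x))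
    (hreg : ∀ i, IsRegularSol (u i)) (hsol : IsWeakSolution a F u) (hst : IsStable a F u)
    (i : Fin n) (l : Fin d) {ψ : FibSpace m d → ℝ}
    (hψ : IsTestC1 {X | gradient (u i) X ≠ 0} ψ) :
    ∫ X, quad (matrixAlong (a i) (u i) X) (pdv (pd (Sum.inr l) (u i)) X) (pdv ψ X)
      = ∫ X, (∑ j, nlFF F i j (xPart X) (fun k => u k X) * pd (Sum.inr l) (u j) X) * ψ X := by
  have hu1 := fun i => (hreg i).1
  have hu2 := (hreg i).2.1
  have hΩ := isOpen_gradient_ne (hu1 i)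
  have hw : ∀ q, ContDiffOn ℝ 1 (pd q (u i)) {X | gradient (u i) X ≠ 0} := fun q =>
    contDiffOn_pd hΩ hu2 (by norm_num) q
  obtain ⟨φ, K, B, hK, hKΩ, hsm, hcs, hsub, hb, hbd, hlim, hdlim⟩ :=
    hψ.exists_smooth_approx hΩ
  -- The second derivatives of the solution are continuous on {∇u^i ≠ 0}, hence bounded on the
  -- compact K inside it; this gives the integrable factor for the limit.
  have hAK : ∀ k p, IntegrableOn (fun X => matrixAlong (a i) (u i) X k p
      * pd p (pd (Sum.inr l) (u i)) X) K := fun k p =>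
    ((hst.1 i k p).integrableOn_isCompact hK).mul_continuousOn
      ((continuousOn_pd hΩ (hw _) p).mono hKΩ) hK
  have hC1 : ∀ N, IsTestC1 {X | gradient (u i) X ≠ 0} (φ N) := fun N =>
    IsTestC1.isTestFun_mono ⟨hsm N, hcs N⟩ ((hsub N).trans hKΩ)
  have hq : ∀ ψ : FibSpace m d → ℝ, IsTestC1 {X | gradient (u i) X ≠ 0} ψ → ∀ k p,
      Integrable fun X => matrixAlong (a i) (u i) X k p *
        (pdv (pd (Sum.inr l) (u i)) X p * pdv ψ X k) := by
    intro ψ hψ k p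
    exact integrable_mul_of_tsupport (hst.1 i k p)
      (continuous_mul_of_tsupport hΩ (continuousOn_pd hΩ (hw _) p) (continuous_pd hψ.contDiff k)
        ((tsupport_pd_subset ψ k).trans hψ.subset)) ((hψ.compact.pd k).mul_left)
  have hlin : ∀ N, ∫ X, quad (matrixAlong (a i) (u i) X) (pdv (pd (Sum.inr l) (u i)) X)
      (pdv (φ N) X) = ∫ X, (∑ j, nlFF F i j (xPart X) (fun k => u k X)
        * pd (Sum.inr l) (u j) X) * φ N X := fun N =>
    linearized_of_isTestFun ha hF hreg hsol hst i l ⟨hsm N, hcs N⟩ ((hsub N).trans hKΩ)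
  have h1 : Tendsto (fun N => ∫ X, quad (matrixAlong (a i) (u i) X)
      (pdv (pd (Sum.inr l) (u i)) X) (pdv (φ N) X)) atTop
      (𝓝 (∫ X, quad (matrixAlong (a i) (u i) X) (pdv (pd (Sum.inr l) (u i)) X) (pdv ψ X))) := by
    rw [integral_quad (hq _ hψ)]
    simp_rw [fun N => integral_quad (hq _ (hC1 N))]
    refine tendsto_finsetSum _ fun k _ => tendsto_finsetSum _ fun p _ => ?_
    simp only [pdv, ← mul_assoc]
    exact tendsto_integral_mul_of_bounded (hAK k p)
      (fun N => (continuous_pd (hC1 N).contDiff k).aestronglyMeasurable)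
      (fun N X hX => pd_eq_zero_of_notMem_tsupport (fun h' => hX (hsub N h')) k)
      (fun N X => hbd N k X) (hdlim k)
  have h2 : Tendsto (fun N => ∫ X, (∑ j, nlFF F i j (xPart X) (fun k => u k X)
        * pd (Sum.inr l) (u j) X) * φ N X) atTop
      (𝓝 (∫ X, (∑ j, nlFF F i j (xPart X) (fun k => u k X)
        * pd (Sum.inr l) (u j) X) * ψ X)) := by
    refine tendsto_integral_mul_of_bounded (K := K) (integrable_finsetSum _ fun j _ =>
        ((hst.2.1 i j).integrableOn_isCompact hK).mul_continuousOn
          (continuous_pd (hu1 j) _).continuousOn hK)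
      (fun N => (hC1 N).contDiff.continuous.aestronglyMeasurable)
      (fun N X hX => image_eq_zero_of_notMem_tsupport fun h' => hX (hsub N h')) hb hlim
  exact tendsto_nhds_unique h1 (h2.congr fun N => (hlin N).symm)

end Linearized2

/-! ### The geometric Poincaré inequality away from the zeros of ∇_y u^i. -/

section Poincare

open Set Filter Topology

variable {m d n : ℕ}

theorem quad_sum_left {ι κ : Type} [Fintype ι] [Fintype κ] (M : Matrix ι ι ℝ) (c : κ → ℝ)
    (ξ : κ → ι → ℝ) (η : ι → ℝ) :
    quad M (fun k => ∑ l, c l * ξ l k) η = ∑ l, c l * quad M (ξ l) η := by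
  simp only [quad, Finset.mul_sum, Finset.sum_mul]
  symm
  rw [Finset.sum_comm]
  refine Finset.sum_congr rfl fun k _ => ?_
  rw [Finset.sum_comm]
  congr! 2; ring

/-- The length of the fibre gradient. -/
def rY (v : FibSpace m d → ℝ) (X : FibSpace m d) : ℝ := √(∑ l : Fin d, pd (Sum.inr l) v X ^ 2)

theorem gradY_coord (v : FibSpace m d → ℝ) (X : FibSpace m d) (l : Fin d) :
    gradY v X l = pd (Sum.inr l) v X := by
  simp [gradY, yPart, gradient_coord]

theorem norm_gradY (v : FibSpace m d → ℝ) (X : FibSpace m d) : ‖gradY v X‖ = rY v X := by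
  rw [EuclideanSpace.norm_eq]
  simp [gradY_coord, rY]

theorem rY_sq (v : FibSpace m d → ℝ) (X : FibSpace m d) :
    rY v X ^ 2 = ∑ l : Fin d, pd (Sum.inr l) v X ^ 2 :=
  Real.sq_sqrt (Finset.sum_nonneg fun _ _ => sq_nonneg _)

theorem rY_nonneg (v : FibSpace m d → ℝ) (X : FibSpace m d) : 0 ≤ rY v X := Real.sqrt_nonneg _

theorem rY_pos_iff (v : FibSpace m d → ℝ) (X : FibSpace m d) : 0 < rY v X ↔ gradY v X ≠ 0 := by
  rw [← norm_gradY, norm_pos_iff]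

theorem rY_le_norm_gradient (v : FibSpace m d → ℝ) (X : FibSpace m d) :
    rY v X ≤ ‖gradient v X‖ := by
  rw [norm_gradient, rY, Fintype.sum_sum_type]
  exact Real.sqrt_le_sqrt (le_add_of_nonneg_left (Finset.sum_nonneg fun _ _ => sq_nonneg _))

theorem continuous_rY {v : FibSpace m d → ℝ} (hv : ContDiff ℝ 1 v) : Continuous (rY v) :=
  Real.continuous_sqrt.comp (continuous_finsetSum _ fun _ _ => (continuous_pd hv _).pow 2)

theorem isOpen_gradY_ne {v : FibSpace m d → ℝ} (hv : ContDiff ℝ 1 v) :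
    IsOpen {X | gradY v X ≠ 0} := by
  simp_rw [← rY_pos_iff]
  exact isOpen_lt continuous_const (continuous_rY hv)

theorem gradY_ne_subset (v : FibSpace m d → ℝ) :
    {X | gradY v X ≠ 0} ⊆ {X | gradient v X ≠ 0} := by
  intro X hX h
  refine hX ?_
  ext i
  simp [gradY, yPart, h]

theorem contDiffOn_pd_gradY {v : FibSpace m d → ℝ} (hv : IsRegularSol v)
    (k : Fin m ⊕ Fin d) : ContDiffOn ℝ 1 (pd k v) {X | gradY v X ≠ 0} :=
  (contDiffOn_pd (isOpen_gradient_ne hv.1) hv.2.1 (by norm_num) k).mono (gradY_ne_subset v)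

theorem sum_sq_ne_zero {v : FibSpace m d → ℝ} {X : FibSpace m d} (hX : gradY v X ≠ 0) :
    ∑ l : Fin d, pd (Sum.inr l) v X ^ 2 ≠ 0 := by
  rw [← rY_sq]
  exact pow_ne_zero 2 ((rY_pos_iff v X).mpr hX).ne'

theorem contDiffOn_rY {v : FibSpace m d → ℝ} (hv : IsRegularSol v) :
    ContDiffOn ℝ 1 (rY v) {X | gradY v X ≠ 0} :=
  ContDiffOn.sqrt (ContDiffOn.sum fun _ _ => (contDiffOn_pd_gradY hv _).pow 2)
    fun _ hX => sum_sq_ne_zero hX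

/-- The chain rule for r with the denominator cleared. It links the gradient of r to those of the
∂_{y_l}v, both in the cross terms of the Poincaré identity and in the square decomposition of the
curvature. -/
theorem rY_mul_pd_rY {v : FibSpace m d → ℝ} (hv : IsRegularSol v) {X : FibSpace m d}
    (hX : gradY v X ≠ 0) (q : Fin m ⊕ Fin d) :
    rY v X * pd q (rY v) X = ∑ l : Fin d, pd (Sum.inr l) v X * pd q (pd (Sum.inr l) v) X := by
  have hΩ := isOpen_gradY_ne hv.1
  have h := pd_sqrt_sum_sq (w := fun l : Fin d => pd (Sum.inr l) v) (X := X)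
    (fun l => ((contDiffOn_pd_gradY hv _).contDiffAt (hΩ.mem_nhds hX)).differentiableAt
      one_ne_zero) (sum_sq_ne_zero hX) q
  have h2 : pd q (rY v) X = _ := h
  have hpos : √(∑ l : Fin d, pd (Sum.inr l) v X ^ 2) ≠ 0 := ((rY_pos_iff v X).mpr hX).ne'
  rw [h2, rY]
  field_simp

/-- The geometric quantity in the Poincaré inequality. -/
def curv (a : EuclideanSpace ℝ (Fin m) → ℝ → ℝ) (v : FibSpace m d → ℝ) (X : FibSpace m d) : ℝ :=
  (∑ l : Fin d, quad (matrixAlong a v X) (pdv (pd (Sum.inr l) v) X) (pdv (pd (Sum.inr l) v) X))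
    - quad (matrixAlong a v X) (pdv (rY v) X) (pdv (rY v) X)

/-- Compact support in U is enough here: ∇w is continuous there, and nothing is required near the
boundary of U. -/
theorem integrable_quad_mul_sq {U : Set (FibSpace m d)} (hU : IsOpen U)
    {A : FibSpace m d → Matrix (Fin m ⊕ Fin d) (Fin m ⊕ Fin d) ℝ}
    (hA : ∀ k l, LocallyIntegrable (fun X => A X k l) volume)
    {w : FibSpace m d → ℝ} (hw : ContDiffOn ℝ 1 w U) {ζ : FibSpace m d → ℝ}
    (hζ : IsTestC1 U ζ) :
    Integrable fun X => quad (A X) (pdv w X) (pdv w X) * ζ X ^ 2 := by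
  simp only [quad, Finset.sum_mul, pdv]
  refine integrable_finsetSum _ fun k _ => integrable_finsetSum _ fun l _ => ?_
  have hsub : tsupport (fun X => ζ X ^ 2) ⊆ U := by
    simp_rw [sq]; exact tsupport_mul_subset_left.trans hζ.subset
  have hcs : HasCompactSupport (fun X => ζ X ^ 2) := by
    simp_rw [sq]; exact hζ.compact.mul_left
  have := integrable_mul_of_tsupport (hA k l) (continuous_mul_of_tsupport hU
    ((continuousOn_pd hU hw l).mul (continuousOn_pd hU hw k))
    (hζ.contDiff.continuous.pow 2) hsub) hcs.mul_left
  refine this.congr (Eventually.of_forall fun X => ?_)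
  simp only [Pi.mul_apply, Pi.pow_apply]
  ring

theorem integrable_curv_mul_sq {a : EuclideanSpace ℝ (Fin m) → ℝ → ℝ} {v : FibSpace m d → ℝ}
    (hv : IsRegularSol v)
    (hA : ∀ k l, LocallyIntegrable (fun X => matrixAlong a v X k l) volume)
    {ζ : FibSpace m d → ℝ} (hζ : IsTestC1 {X | gradY v X ≠ 0} ζ) :
    Integrable fun X => curv a v X * ζ X ^ 2 := by
  simp only [curv, sub_mul, Finset.sum_mul]
  exact (integrable_finsetSum _ fun l _ => integrable_quad_mul_sq (isOpen_gradY_ne hv.1) hA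
    (contDiffOn_pd_gradY hv _) hζ).sub
    (integrable_quad_mul_sq (isOpen_gradY_ne hv.1) hA (contDiffOn_rY hv) hζ)

/-- The pointwise identity behind the geometric Poincaré inequality. -/
theorem quad_pdv_rY_mul {a : EuclideanSpace ℝ (Fin m) → ℝ → ℝ} {v : FibSpace m d → ℝ}
    (hv : IsRegularSol v) {ζ : FibSpace m d → ℝ} (hζ : IsTestC1 {X | gradY v X ≠ 0} ζ)
    (X : FibSpace m d) :
    quad (matrixAlong a v X) (pdv (fun Y => rY v Y * ζ Y) X) (pdv (fun Y => rY v Y * ζ Y) X)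
      = rY v X ^ 2 * quad (matrixAlong a v X) (pdv ζ X) (pdv ζ X) - curv a v X * ζ X ^ 2
        + ∑ l : Fin d, quad (matrixAlong a v X) (pdv (pd (Sum.inr l) v) X)
          (pdv (fun Y => pd (Sum.inr l) v Y * (ζ Y * ζ Y)) X) := by
  have hΩ := isOpen_gradY_ne hv.1
  have hζ2 : IsTestC1 {X | gradY v X ≠ 0} fun Y => ζ Y * ζ Y :=
    hζ.mul_left hΩ hζ.contDiff.contDiffOn
  have e1 : pdv (fun Y => rY v Y * ζ Y) X = rY v X • pdv ζ X + ζ X • pdv (rY v) X := by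
    ext k
    simp only [pdv, hζ.pd_mul hΩ (contDiffOn_rY hv) k X, Pi.add_apply, Pi.smul_apply, smul_eq_mul]
    ring
  have e2 : ∀ l : Fin d, pdv (fun Y => pd (Sum.inr l) v Y * (ζ Y * ζ Y)) X
      = (2 * ζ X * pd (Sum.inr l) v X) • pdv ζ X + ζ X ^ 2 • pdv (pd (Sum.inr l) v) X := by
    intro l
    ext k
    simp only [pdv, hζ2.pd_mul hΩ (contDiffOn_pd_gradY hv _) k X, Pi.add_apply, Pi.smul_apply,
      smul_eq_mul, pd_mul (hζ.differentiableAt X) (hζ.differentiableAt X)]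
    ring
  have hsym := coefMatrix_isHermitian a (xPart X) (gradient v X)
  -- The cross terms of the two sides match. The factor ζ X is kept because the chain rule for r is
  -- available only where ∇_y v ≠ 0, and ζ vanishes elsewhere.
  have e3 : ζ X * (rY v X * quad (matrixAlong a v X) (pdv (rY v) X) (pdv ζ X))
      = ζ X * ∑ l : Fin d, pd (Sum.inr l) v X
        * quad (matrixAlong a v X) (pdv (pd (Sum.inr l) v) X) (pdv ζ X) := by
    by_cases hX : gradY v X = 0
    · have : ζ X = 0 := image_eq_zero_of_notMem_tsupport fun h => hζ.subset h hX
      simp [this]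
    · rw [← quad_smul_left, ← quad_sum_left]
      congr 2
      ext k
      exact rY_mul_pd_rY hv hX k
  simp only [e1, e2, quad_add_left, quad_add_right, quad_smul_left, quad_smul_right,
    Finset.sum_add_distrib, curv, sub_mul, Finset.sum_mul]
  have e4 : ∑ l : Fin d, 2 * ζ X * pd (Sum.inr l) v X
        * quad (matrixAlong a v X) (pdv (pd (Sum.inr l) v) X) (pdv ζ X)
      = 2 * (ζ X * ∑ l : Fin d, pd (Sum.inr l) v X
        * quad (matrixAlong a v X) (pdv (pd (Sum.inr l) v) X) (pdv ζ X)) := by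
    simp only [Finset.mul_sum]
    congr! 1; ring
  have e5 : quad (matrixAlong a v X) (pdv ζ X) (pdv (rY v) X)
      = quad (matrixAlong a v X) (pdv (rY v) X) (pdv ζ X) := quad_comm hsym _ _
  rw [e4, ← e3, e5]
  simp only [mul_comm (ζ X ^ 2)]
  ring

/-- The geometric Poincaré inequality. -/
theorem geometric_poincare {a : Fin n → EuclideanSpace ℝ (Fin m) → ℝ → ℝ}
    {F : EuclideanSpace ℝ (Fin m) → (Fin n → ℝ) → ℝ} {u : Fin n → FibSpace m d → ℝ}
    (ha : ∀ i, IsCoefficient (a i)) (hF : ∀ x, ContDiff ℝ 2 (F x))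
    (hreg : ∀ i, IsRegularSol (u i)) (hsol : IsWeakSolution a F u) (hst : IsStable a F u)
    {s : Fin n → ℝ} (hs : ∀ i, s i * s i = 1) {ζ : Fin n → FibSpace m d → ℝ}
    (hζ : ∀ i, IsTestC1 {X | gradY (u i) X ≠ 0} (ζ i)) :
    (∑ i, ∫ X, curv (a i) (u i) X * ζ i X ^ 2)
      + ∑ i, ∑ j, ∫ X, nlFF F i j (xPart X) (fun k => u k X) *
        (s i * s j * (rY (u i) X * ζ i X * (rY (u j) X * ζ j X))
          - (∑ l : Fin d, pd (Sum.inr l) (u i) X * pd (Sum.inr l) (u j) X) * ζ i X ^ 2)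
      ≤ ∑ i, ∫ X, rY (u i) X ^ 2 * quad (matrixAlong (a i) (u i) X) (pdv (ζ i) X) (pdv (ζ i) X) := by
  have hΩ := fun i => isOpen_gradY_ne (hreg i).1
  have hrζ : ∀ i, IsTestC1 {X | gradY (u i) X ≠ 0} fun Y => rY (u i) Y * ζ i Y := fun i =>
    (hζ i).mul_left (hΩ i) (contDiffOn_rY (hreg i))
  have hζ2 : ∀ i, IsTestC1 {X | gradY (u i) X ≠ 0} fun Y => ζ i Y * ζ i Y := fun i =>
    (hζ i).mul_left (hΩ i) (hζ i).contDiff.contDiffOn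
  have hvζ : ∀ i (l : Fin d), IsTestC1 {X | gradY (u i) X ≠ 0}
      fun Y => pd (Sum.inr l) (u i) Y * (ζ i Y * ζ i Y) := fun i l =>
    (hζ2 i).mul_left (hΩ i) (contDiffOn_pd_gradY (hreg i) _)
  -- The test functions for stability are s_i r_i ζ_i; the linearized equation is tested below with
  -- ∂_{y_l}u^i ζ_i².
  have hψ : ∀ i, IsTestC1 univ fun Y => s i * (rY (u i) Y * ζ i Y) := fun i =>
    ((hrζ i).mono (subset_univ _)).mul_left isOpen_univ contDiffOn_const
  have hstab := hst.nonneg_of_isTestC1 hψ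
  have hlin := fun i l => linearized_of_isTestC1 ha hF hreg hsol hst i l
    ((hvζ i l).mono (gradY_ne_subset _))
  have hI1 : ∀ i, Integrable fun X => rY (u i) X ^ 2 *
      quad (matrixAlong (a i) (u i) X) (pdv (ζ i) X) (pdv (ζ i) X) := by
    intro i
    simp only [quad, Finset.mul_sum, pdv]
    refine integrable_finsetSum _ fun k _ => integrable_finsetSum _ fun l _ => ?_
    have := integrable_mul_of_tsupport (hst.1 i k l)
      ((((continuous_rY (hreg i).1).pow 2).mul (continuous_pd (hζ i).contDiff l)).mul
        (continuous_pd (hζ i).contDiff k)) ((hζ i).compact.pd k).mul_left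
    refine this.congr (Eventually.of_forall fun X => ?_)
    simp only [Pi.mul_apply, Pi.pow_apply]
    ring
  have hI2 : ∀ i, Integrable fun X => curv (a i) (u i) X * ζ i X ^ 2 := fun i =>
    integrable_curv_mul_sq (hreg i) (hst.1 i) (hζ i)
  have hI3 : ∀ i (l : Fin d), Integrable fun X => quad (matrixAlong (a i) (u i) X)
      (pdv (pd (Sum.inr l) (u i)) X) (pdv (fun Y => pd (Sum.inr l) (u i) Y * (ζ i Y * ζ i Y)) X) := by
    intro i l
    refine integrable_quad fun k q => ?_
    exact integrable_mul_of_tsupport (hst.1 i k q)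
      (continuous_mul_of_tsupport (hΩ i) (continuousOn_pd (hΩ i) (contDiffOn_pd_gradY (hreg i) _) q)
        (continuous_pd (hvζ i l).contDiff k) ((tsupport_pd_subset _ k).trans (hvζ i l).subset))
      ((hvζ i l).compact.pd k).mul_left
  have hff : ∀ i j, Integrable fun X => nlFF F i j (xPart X) (fun k => u k X) *
      ((∑ l : Fin d, pd (Sum.inr l) (u i) X * pd (Sum.inr l) (u j) X) * ζ i X ^ 2) := by
    intro i j
    have hcs : HasCompactSupport (fun X => ζ i X ^ 2) := by
      simp_rw [sq]; exact (hζ i).compact.mul_left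
    exact integrable_mul_of_tsupport (hst.2.1 i j) ((continuous_finsetSum _ fun l _ =>
      (continuous_pd (hreg i).1 _).mul (continuous_pd (hreg j).1 _)).mul
      ((hζ i).contDiff.continuous.pow 2)) hcs.mul_left
  have hss : ∀ i j, Integrable fun X => nlFF F i j (xPart X) (fun k => u k X) *
      (s i * s j * (rY (u i) X * ζ i X * (rY (u j) X * ζ j X))) := by
    intro i j
    exact integrable_mul_of_tsupport (hst.2.1 i j) (continuous_const.mul
      ((hrζ i).contDiff.continuous.mul (hrζ j).contDiff.continuous))
      ((hrζ i).compact.mul_right).mul_left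
  have hlinsum : ∀ i, ∑ l : Fin d, ∫ X, quad (matrixAlong (a i) (u i) X)
      (pdv (pd (Sum.inr l) (u i)) X) (pdv (fun Y => pd (Sum.inr l) (u i) Y * (ζ i Y * ζ i Y)) X)
      = ∑ j, ∫ X, nlFF F i j (xPart X) (fun k => u k X) *
        ((∑ l : Fin d, pd (Sum.inr l) (u i) X * pd (Sum.inr l) (u j) X) * ζ i X ^ 2) := by
    intro i
    rw [Finset.sum_congr rfl fun l _ => hlin i l, ← integral_finsetSum _ fun j _ => hff i j,
      ← integral_finsetSum _ fun l _ => ?_]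
    · congr 1
      ext X
      simp only [Finset.mul_sum, Finset.sum_mul]
      rw [Finset.sum_comm]
      congr! 2; ring
    · simp_rw [Finset.sum_mul, mul_assoc]
      exact integrable_finsetSum _ fun j _ => integrable_mul_of_tsupport (hst.2.1 i j)
        ((continuous_pd (hreg j).1 _).mul (hvζ i l).contDiff.continuous) (hvζ i l).compact.mul_left
  have hquad : ∀ i, ∫ X, quad (matrixAlong (a i) (u i) X)
      (pdv (fun Y => s i * (rY (u i) Y * ζ i Y)) X) (pdv (fun Y => s i * (rY (u i) Y * ζ i Y)) X)
      = (∫ X, rY (u i) X ^ 2 * quad (matrixAlong (a i) (u i) X) (pdv (ζ i) X) (pdv (ζ i) X))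
        - (∫ X, curv (a i) (u i) X * ζ i X ^ 2)
        + ∑ j, ∫ X, nlFF F i j (xPart X) (fun k => u k X) *
        ((∑ l : Fin d, pd (Sum.inr l) (u i) X * pd (Sum.inr l) (u j) X) * ζ i X ^ 2) := by
    intro i
    have hsub : Integrable fun X => rY (u i) X ^ 2 * quad (matrixAlong (a i) (u i) X)
        (pdv (ζ i) X) (pdv (ζ i) X) - curv (a i) (u i) X * ζ i X ^ 2 := (hI1 i).sub (hI2 i)
    rw [← hlinsum, ← integral_finsetSum _ fun l _ => hI3 i l, ← integral_sub (hI1 i) (hI2 i),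
      ← integral_add hsub (integrable_finsetSum _ fun l _ => hI3 i l)]
    refine integral_congr_ae (Eventually.of_forall fun X => ?_)
    -- The sign squares to one in the quadratic form, so it survives only in the coupling between
    -- different components.
    have e : pdv (fun Y => s i * (rY (u i) Y * ζ i Y)) X
        = s i • pdv (fun Y => rY (u i) Y * ζ i Y) X := by
      ext k; exact pd_const_mul ((hrζ i).differentiableAt X) _ _
    refine Eq.trans ?_ (quad_pdv_rY_mul (a := a i) (hreg i) (hζ i) X)
    beta_reduce
    rw [e, quad_smul_left, quad_smul_right, ← mul_assoc, hs, one_mul]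
  rw [Finset.sum_congr rfl fun i _ => hquad i] at hstab
  have hsplit : ∀ i j, ∫ X, nlFF F i j (xPart X) (fun k => u k X) *
        (s i * s j * (rY (u i) X * ζ i X * (rY (u j) X * ζ j X))
          - (∑ l : Fin d, pd (Sum.inr l) (u i) X * pd (Sum.inr l) (u j) X) * ζ i X ^ 2)
      = (∫ X, nlFF F i j (xPart X) (fun k => u k X) *
          (s i * (rY (u i) X * ζ i X) * (s j * (rY (u j) X * ζ j X))))
        - ∫ X, nlFF F i j (xPart X) (fun k => u k X) *
          ((∑ l : Fin d, pd (Sum.inr l) (u i) X * pd (Sum.inr l) (u j) X) * ζ i X ^ 2) := by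
    intro i j
    have e : ∀ X, s i * (rY (u i) X * ζ i X) * (s j * (rY (u j) X * ζ j X))
        = s i * s j * (rY (u i) X * ζ i X * (rY (u j) X * ζ j X)) := fun X => by ring
    simp_rw [e]
    rw [← integral_sub (hss i j) (hff i j)]
    simp_rw [mul_sub]
  simp_rw [hsplit]
  simp only [Finset.sum_add_distrib, Finset.sum_sub_distrib] at hstab ⊢
  linarith

end Poincare

/-! ### Truncation near the zeros of ∇_y v, and integrability up to these zeros. -/

section Truncation

open Set Filter Topology

variable {m d n : ℕ}

/-- A cut-off of the line away from the origin. -/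
theorem exists_cutoff : ∃ (h : ℝ → ℝ) (M : ℝ), ContDiff ℝ 1 h ∧ (∀ t, 0 ≤ h t) ∧ (∀ t, h t ≤ 1) ∧
    (∀ t, t ≤ 1 → h t = 0) ∧ (∀ t, 2 ≤ t → h t = 1) ∧ (∀ t, |t * deriv h t| ≤ M) ∧
    ∀ t, 2 < t → deriv h t = 0 := by
  let h : ℝ → ℝ := fun t => Real.smoothTransition (t - 1)
  have hc : ContDiff ℝ 1 h := Real.smoothTransition.contDiff.comp (contDiff_id.sub contDiff_const)
  have h0 : ∀ t, t ≤ 1 → h t = 0 := fun t ht =>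
    Real.smoothTransition.zero_of_nonpos (by linarith)
  have h1 : ∀ t, 2 ≤ t → h t = 1 := fun t ht =>
    Real.smoothTransition.one_of_one_le (by linarith)
  have hd0 : ∀ t, t < 1 → deriv h t = 0 := by
    intro t ht
    have : h =ᶠ[𝓝 t] fun _ => 0 := by
      filter_upwards [Iio_mem_nhds ht] with s hs using h0 s (le_of_lt hs)
    rw [this.deriv_eq]; simp
  have hd2 : ∀ t, 2 < t → deriv h t = 0 := by
    intro t ht
    have : h =ᶠ[𝓝 t] fun _ => 1 := by
      filter_upwards [Ioi_mem_nhds ht] with s hs using h1 s (le_of_lt hs)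
    rw [this.deriv_eq]; simp
  -- The quantity t h'(t) is scale invariant: r times the derivative of h(r(N+1)) with respect to r
  -- is t h'(t) at t = r(N+1), hence bounded uniformly in N.
  obtain ⟨M, hM⟩ := (isCompact_Icc (a := (1 : ℝ)) (b := 2)).exists_bound_of_continuousOn
    (f := fun t => t * deriv h t) (continuous_id.mul (hc.continuous_deriv le_rfl)).continuousOn
  have hM0 : 0 ≤ M := (norm_nonneg _).trans (hM 1 (by norm_num))
  refine ⟨h, M, hc, fun t => Real.smoothTransition.nonneg _, fun t =>
    Real.smoothTransition.le_one _, h0, h1, fun t => ?_, hd2⟩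
  rcases lt_or_ge t 1 with ht | ht
  · simpa [hd0 t ht] using hM0
  rcases lt_or_ge 2 t with ht2 | ht2
  · simpa [hd2 t ht2] using hM0
  · exact hM t ⟨ht, ht2⟩

theorem MemL2Loc.locallyIntegrable {g : FibSpace m d → ℝ} (hg : MemL2Loc g) :
    LocallyIntegrable g volume := by
  intro X
  refine ⟨Metric.ball 0 (‖X‖ + 1), Metric.isOpen_ball.mem_nhds (by simp), ?_⟩
  have : IsFiniteMeasure (volume.restrict (Metric.ball (0 : FibSpace m d) (‖X‖ + 1))) :=
    ⟨by simpa using measure_ball_lt_top⟩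
  exact (hg (‖X‖ + 1)).integrable (by norm_num)

/-- The weak second derivatives are the classical ones where the gradient does not vanish. -/
theorem memLp_two_pd_pd {v : FibSpace m d → ℝ} (hv : IsRegularSol v) (k l : Fin m ⊕ Fin d)
    (R : ℝ) : MemLp (pd l (pd k v)) 2
      (volume.restrict ({X | gradient v X ≠ 0} ∩ Metric.ball 0 R)) := by
  have hΩ := isOpen_gradient_ne hv.1
  obtain ⟨g, hg, hw⟩ := (hv.2.2.2.2 k).2 l
  have hvk : ContDiffOn ℝ 1 (pd k v) {X | gradient v X ≠ 0} :=
    contDiffOn_pd hΩ hv.2.1 (by norm_num) k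
  have hW : ContinuousOn (pd l (pd k v)) {X | gradient v X ≠ 0} := continuousOn_pd hΩ hvk l
  have hae : ∀ᵐ X ∂(volume : Measure (FibSpace m d)), X ∈ {X | gradient v X ≠ 0} →
      g X - pd l (pd k v) X = 0 := by
    -- On the open set {∇v ≠ 0} the classical derivative is also a distributional one, so its
    -- difference with g is orthogonal to all test functions supported there.
    refine hΩ.ae_eq_zero_of_integral_contDiff_smul_eq_zero
      ((hg.locallyIntegrable.locallyIntegrableOn _).sub
        (hW.locallyIntegrableOn hΩ.measurableSet)) ?_
    intro φ hφ hc hs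
    have hT : IsTestC1 {X | gradient v X ≠ 0} φ := IsTestC1.isTestFun_mono ⟨hφ, hc⟩ hs
    have hi1 : Integrable fun X => g X * φ X :=
      integrable_mul_of_tsupport hg.locallyIntegrable hφ.continuous hc
    have hi2 : Integrable fun X => pd l (pd k v) X * φ X :=
      (continuous_mul_of_tsupport hΩ hW hφ.continuous hs).integrable_of_hasCompactSupport
        hc.mul_left
    have e1 := hw φ ⟨hφ, hc⟩
    have e2 : ∫ X, pd k v X * pd l φ X = - ∫ X, pd l (pd k v) X * φ X := by
      refine integral_mul_lineDeriv hi2 ?_ ?_ (fun X hX => hasLineDerivAt_pd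
        ((hvk.contDiffAt (hΩ.mem_nhds (hs hX))).differentiableAt one_ne_zero) l)
        (fun X => hasLineDerivAt_pd (hT.differentiableAt X) l)
      · exact ((continuous_pd hv.1 k).mul (continuous_pd hT.contDiff l)).integrable_of_hasCompactSupport
          (hc.pd l).mul_left
      · exact ((continuous_pd hv.1 k).mul hφ.continuous).integrable_of_hasCompactSupport hc.mul_left
    simp only [gradient_coord] at e1
    have e3 : ∀ X, φ X • (g X - pd l (pd k v) X) = g X * φ X - pd l (pd k v) X * φ X := by
      intro X; rw [smul_eq_mul]; ring
    simp_rw [e3]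
    rw [integral_sub hi1 hi2]
    linarith
  refine ((hg R).mono_measure (Measure.restrict_mono inter_subset_right le_rfl)).ae_eq ?_
  filter_upwards [ae_restrict_of_ae hae,
    ae_restrict_mem (hΩ.measurableSet.inter Metric.isOpen_ball.measurableSet)] with X h1 h2
  exact sub_eq_zero.mp (h1 h2.1)

/-- Since |∂_{y_l}v| ≤ r, dividing the chain rule by r gives |∂_q r| ≤ ∑_l |∂_q ∂_{y_l}v|; the L²
bound on the Hessian passes to r with no loss as r tends to 0. -/
theorem memLp_two_pd_rY {v : FibSpace m d → ℝ} (hv : IsRegularSol v) (q : Fin m ⊕ Fin d)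
    (R : ℝ) : MemLp (pd q (rY v)) 2
      (volume.restrict ({X | gradY v X ≠ 0} ∩ Metric.ball 0 R)) := by
  have hΩ := isOpen_gradY_ne hv.1
  have hm : MeasurableSet ({X | gradY v X ≠ 0} ∩ Metric.ball 0 R) :=
    hΩ.measurableSet.inter Metric.isOpen_ball.measurableSet
  have hsum : MemLp (fun X => ∑ l : Fin d, ‖pd q (pd (Sum.inr l) v) X‖) 2
      (volume.restrict ({X | gradY v X ≠ 0} ∩ Metric.ball 0 R)) :=
    memLp_finsetSum _ fun l _ => ((memLp_two_pd_pd hv (Sum.inr l) q R).mono_measure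
      (Measure.restrict_mono (inter_subset_inter_left _ (gradY_ne_subset v)) le_rfl)).norm
  refine hsum.mono' (((continuousOn_pd hΩ (contDiffOn_rY hv) q).mono
    inter_subset_left).aestronglyMeasurable hm) ?_
  filter_upwards [ae_restrict_mem hm] with X hX
  have hr := (rY_pos_iff v X).mpr hX.1
  have h1 := rY_mul_pd_rY hv hX.1 q
  have h2 : rY v X * ‖pd q (rY v) X‖ ≤ rY v X * ∑ l : Fin d, ‖pd q (pd (Sum.inr l) v) X‖ := by
    rw [← abs_of_pos hr, ← Real.norm_eq_abs, ← norm_mul, h1, Real.norm_eq_abs (rY v X),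
      abs_of_pos hr, Finset.mul_sum]
    refine (norm_sum_le _ _).trans (Finset.sum_le_sum fun l _ => ?_)
    rw [norm_mul]
    refine mul_le_mul_of_nonneg_right ?_ (norm_nonneg _)
    rw [Real.norm_eq_abs]
    refine Real.abs_le_sqrt ?_
    exact Finset.single_le_sum (f := fun l : Fin d => pd (Sum.inr l) v X ^ 2)
      (fun _ _ => sq_nonneg _) (Finset.mem_univ l)
  exact le_of_mul_le_mul_left h2 hr

theorem integrableOn_quad {A : FibSpace m d → Matrix (Fin m ⊕ Fin d) (Fin m ⊕ Fin d) ℝ}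
    {μ : Measure (FibSpace m d)} (hA : ∀ k l, MemLp (fun X => A X k l) ⊤ μ)
    {w : FibSpace m d → ℝ} (hw : ∀ q, MemLp (pd q w) 2 μ) :
    Integrable (fun X => quad (A X) (pdv w X) (pdv w X)) μ := by
  refine integrable_quad fun k l => ?_
  have h1 : Integrable (fun X => pd l w X * pd k w X) μ := (hw l).integrable_mul (hw k)
  exact h1.mul_of_top_right (hA k l)

theorem integrableOn_quad_rY {a : EuclideanSpace ℝ (Fin m) → ℝ → ℝ} {v : FibSpace m d → ℝ}
    (hv : IsRegularSol v) (hA : HasBoundedMatrix a v) {R : ℝ} (hR : 0 < R) :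
    IntegrableOn (fun X => quad (matrixAlong a v X) (pdv (rY v) X) (pdv (rY v) X))
      ({X | gradY v X ≠ 0} ∩ Metric.ball 0 R) :=
  integrableOn_quad (fun k l => (hA R hR k l).mono_measure
    (Measure.restrict_mono (inter_subset_inter_left _ (gradY_ne_subset v)) le_rfl))
    fun q => memLp_two_pd_rY hv q R

/-- Integrability up to the zeros of ∇_y v, from 𝒜 ∈ L^∞ and second derivatives in L². It supplies
the majorant when the truncation is removed. -/
theorem integrableOn_curv {a : EuclideanSpace ℝ (Fin m) → ℝ → ℝ} {v : FibSpace m d → ℝ}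
    (hv : IsRegularSol v) (hA : HasBoundedMatrix a v) {R : ℝ} (hR : 0 < R) :
    IntegrableOn (curv a v) ({X | gradY v X ≠ 0} ∩ Metric.ball 0 R) := by
  have hmono : volume.restrict ({X | gradY v X ≠ 0} ∩ Metric.ball (0 : FibSpace m d) R)
      ≤ volume.restrict ({X | gradient v X ≠ 0} ∩ Metric.ball 0 R) :=
    Measure.restrict_mono (inter_subset_inter_left _ (gradY_ne_subset v)) le_rfl
  have h1 : ∀ l : Fin d, IntegrableOn (fun X => quad (matrixAlong a v X)
      (pdv (pd (Sum.inr l) v) X) (pdv (pd (Sum.inr l) v) X))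
      ({X | gradY v X ≠ 0} ∩ Metric.ball 0 R) := fun l =>
    integrableOn_quad (fun k l => (hA R hR k l).mono_measure hmono)
      fun q => (memLp_two_pd_pd hv (Sum.inr l) q R).mono_measure hmono
  exact (integrable_finsetSum _ fun l _ => h1 l).sub (integrableOn_quad_rY hv hA hR)

/-- Truncation of a test function away from the zeros of the fibre gradient. -/
theorem isTestC1_truncation {h : ℝ → ℝ} (hh : ContDiff ℝ 1 h) (h0 : ∀ t, t ≤ 1 → h t = 0)
    {v : FibSpace m d → ℝ} (hv : IsRegularSol v) {φ : FibSpace m d → ℝ} (hφ : IsTestC1 univ φ)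
    (N : ℕ) : IsTestC1 {X | gradY v X ≠ 0} fun X => h (rY v X * (N + 1)) * φ X := by
  have hΩ := isOpen_gradY_ne hv.1
  have hsub : tsupport (fun X => h (rY v X * (N + 1)) * φ X) ⊆ {X | gradY v X ≠ 0} := by
    -- The truncated function vanishes unless r(N+1) ≥ 1, a closed condition that forces r > 0.
    have hcl : IsClosed {X | 1 ≤ rY v X * ((N : ℝ) + 1)} :=
      isClosed_le continuous_const ((continuous_rY hv.1).mul continuous_const)
    refine (closure_minimal ?_ hcl).trans ?_
    · intro X hX
      by_contra hlt
      exact hX (by simp [h0 _ (le_of_not_ge hlt)])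
    · intro X hX
      rw [mem_ofPred_eq] at hX
      rw [mem_ofPred_eq, ← rY_pos_iff]
      by_contra hr
      have : rY v X = 0 := le_antisymm (not_lt.mp hr) (rY_nonneg v X)
      rw [this] at hX; norm_num at hX
  have hon : ContDiffOn ℝ 1 (fun X => h (rY v X * (N + 1)) * φ X) {X | gradY v X ≠ 0} :=
    (hh.comp_contDiffOn ((contDiffOn_rY hv).mul contDiffOn_const)).mul hφ.contDiff.contDiffOn
  exact ⟨hon.contDiff_of_tsupport hΩ hsub, hφ.compact.mul_left, hsub⟩

theorem pdv_truncation {h : ℝ → ℝ} (hh : ContDiff ℝ 1 h)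
    {v : FibSpace m d → ℝ} (hv : IsRegularSol v) {φ : FibSpace m d → ℝ} (hφ : IsTestC1 univ φ)
    (N : ℕ) {X : FibSpace m d} (hX : gradY v X ≠ 0) :
    pdv (fun X => h (rY v X * (N + 1)) * φ X) X = h (rY v X * (N + 1)) • pdv φ X
      + (deriv h (rY v X * (N + 1)) * (N + 1) * φ X) • pdv (rY v) X := by
  have hΩ := isOpen_gradY_ne hv.1
  have hr : DifferentiableAt ℝ (rY v) X :=
    ((contDiffOn_rY hv).contDiffAt (hΩ.mem_nhds hX)).differentiableAt one_ne_zero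
  have hg : ∀ k, pd k (fun X => h (rY v X * (N + 1))) X
      = deriv h (rY v X * (N + 1)) * ((N + 1) * pd k (rY v) X) := by
    intro k
    have hrN : DifferentiableAt ℝ (fun Y => ((N : ℝ) + 1) * rY v Y) X := hr.const_mul _
    simp_rw [mul_comm (rY v _) ((N : ℝ) + 1)]
    rw [pd_comp (f := fun Y => ((N : ℝ) + 1) * rY v Y) (hh.differentiable one_ne_zero _) hrN,
      pd_const_mul hr]
  have hd : DifferentiableAt ℝ (fun X => h (rY v X * (N + 1))) X :=
    (hh.differentiable one_ne_zero _).comp X (hr.mul_const _)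
  ext k
  simp only [pdv, pd_mul hd (hφ.differentiableAt X), hg, Pi.add_apply, Pi.smul_apply, smul_eq_mul]
  ring

end Truncation

/-! ### Removing the truncation. -/

section Limit

open Set Filter Topology

variable {m d n : ℕ}

/-- Expand the gradient of h(r(N+1))φ and use `quad_add_self_le`. The outer factor r² pairs with the
derivative of the cut-off to form (t h'(t))², and h ≤ 1 handles the other part. -/
theorem quad_truncation_le {a : EuclideanSpace ℝ (Fin m) → ℝ → ℝ} {h : ℝ → ℝ}
    (hh : ContDiff ℝ 1 h) (hh0 : ∀ t, 0 ≤ h t) (hh1 : ∀ t, h t ≤ 1)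
    {v : FibSpace m d → ℝ} (hv : IsRegularSol v) {φ : FibSpace m d → ℝ} (hφ : IsTestC1 univ φ)
    (N : ℕ) {X : FibSpace m d} (hX : gradY v X ≠ 0) (hpos : (matrixAlong a v X).PosDef) :
    rY v X ^ 2 * quad (matrixAlong a v X) (pdv (fun X => h (rY v X * (N + 1)) * φ X) X)
        (pdv (fun X => h (rY v X * (N + 1)) * φ X) X)
      ≤ 2 * (quad (matrixAlong a v X) (pdv (rY v) X) (pdv (rY v) X) * φ X ^ 2
          * (rY v X * (N + 1) * deriv h (rY v X * (N + 1))) ^ 2)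
        + 2 * (rY v X ^ 2 * quad (matrixAlong a v X) (pdv φ X) (pdv φ X)) := by
  rw [pdv_truncation hh hv hφ N hX]
  have h1 := quad_add_self_le hpos (h (rY v X * (N + 1)) • pdv φ X)
    ((deriv h (rY v X * (N + 1)) * (N + 1) * φ X) • pdv (rY v) X)
  simp only [quad_smul_left, quad_smul_right] at h1 ⊢
  have hq := quad_nonneg hpos (pdv φ X)
  have h2 : h (rY v X * (N + 1)) * (h (rY v X * (N + 1)) *
      quad (matrixAlong a v X) (pdv φ X) (pdv φ X))
      ≤ quad (matrixAlong a v X) (pdv φ X) (pdv φ X) := by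
    rw [← mul_assoc]
    exact mul_le_of_le_one_left hq (mul_le_one₀ (hh1 _) (hh0 _) (hh1 _))
  have h3 := mul_le_mul_of_nonneg_left h1 (sq_nonneg (rY v X))
  have h4 := mul_le_mul_of_nonneg_left h2 (sq_nonneg (rY v X))
  refine h3.trans ?_
  nlinarith

theorem gradY_dot_eq_zero {v w : FibSpace m d → ℝ} {X : FibSpace m d} (h : rY v X = 0) :
    ∑ l : Fin d, pd (Sum.inr l) v X * pd (Sum.inr l) w X = 0 := by
  have h2 : ∑ l : Fin d, pd (Sum.inr l) v X ^ 2 = 0 := by rw [← rY_sq, h]; simp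
  refine Finset.sum_eq_zero fun l _ => ?_
  have := (Finset.sum_eq_zero_iff_of_nonneg fun _ _ => sq_nonneg _).mp h2 l (Finset.mem_univ l)
  rw [pow_eq_zero_iff two_ne_zero] at this
  rw [this, zero_mul]

theorem eventually_two_lt_rY_mul {v : FibSpace m d → ℝ} {X : FibSpace m d} (hX : gradY v X ≠ 0) :
    ∀ᶠ N : ℕ in atTop, 2 < rY v X * (N + 1) := by
  have hp := (rY_pos_iff v X).mpr hX
  have := (tendsto_natCast_atTop_atTop (R := ℝ)).eventually_ge_atTop (2 / rY v X)
  filter_upwards [this] with N hN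
  rw [div_le_iff₀ hp] at hN; nlinarith

theorem tendsto_rY_mul_cutoff {h : ℝ → ℝ} (ho : ∀ t, 2 ≤ t → h t = 1) (v : FibSpace m d → ℝ)
    (X : FibSpace m d) :
    Tendsto (fun N : ℕ => rY v X * h (rY v X * (N + 1))) atTop (𝓝 (rY v X)) := by
  by_cases hX : gradY v X = 0
  · have : rY v X = 0 := by rw [← norm_gradY, hX, norm_zero]
    simp [this]
  · refine tendsto_const_nhds.congr' ?_
    filter_upwards [eventually_two_lt_rY_mul hX] with N hN
    rw [ho _ hN.le, mul_one]

/-- Convergence holds at every point, including the zeros of the fibre gradients: there the factors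
r_v r_w or ∇_y v vanish whatever the cut-off does. -/
theorem tendsto_integral_reaction {f : FibSpace m d → ℝ} (hf : LocallyIntegrable f volume) (c : ℝ)
    {v w : FibSpace m d → ℝ} (hv : ContDiff ℝ 1 v) (hw : ContDiff ℝ 1 w)
    {h : ℝ → ℝ} (hh : Continuous h) (hh0 : ∀ t, 0 ≤ h t) (hh1 : ∀ t, h t ≤ 1)
    (ho : ∀ t, 2 ≤ t → h t = 1) {φ : FibSpace m d → ℝ} (hφc : Continuous φ)
    (hφ : HasCompactSupport φ) :
    Tendsto (fun N : ℕ => ∫ X, f X *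
        (c * (rY v X * (h (rY v X * (N + 1)) * φ X) * (rY w X * (h (rY w X * (N + 1)) * φ X)))
          - (∑ l : Fin d, pd (Sum.inr l) v X * pd (Sum.inr l) w X)
            * (h (rY v X * (N + 1)) * φ X) ^ 2)) atTop
      (𝓝 (∫ X, f X * ((c * (rY v X * rY w X)
          - ∑ l : Fin d, pd (Sum.inr l) v X * pd (Sum.inr l) w X) * φ X ^ 2))) := by
  have c3 := continuous_rY hv
  have c4 := continuous_rY hw
  have hdotc : Continuous fun X => ∑ l : Fin d, pd (Sum.inr l) v X * pd (Sum.inr l) w X :=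
    continuous_finsetSum _ fun l _ => (continuous_pd hv _).mul (continuous_pd hw _)
  have hbc : Continuous fun X => (|c| * (rY v X * rY w X)
      + |∑ l : Fin d, pd (Sum.inr l) v X * pd (Sum.inr l) w X|) * φ X ^ 2 :=
    ((continuous_const.mul (c3.mul c4)).add hdotc.abs).mul (hφc.pow 2)
  obtain ⟨B', hB'⟩ := hφ.isCompact.exists_bound_of_continuousOn hbc.continuousOn
  have hgc : ∀ N : ℕ, Continuous fun X =>
      c * (rY v X * (h (rY v X * (N + 1)) * φ X) * (rY w X * (h (rY w X * (N + 1)) * φ X)))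
          - (∑ l : Fin d, pd (Sum.inr l) v X * pd (Sum.inr l) w X)
            * (h (rY v X * (N + 1)) * φ X) ^ 2 := by
    intro N
    have c5 : Continuous fun X => h (rY v X * (N + 1)) * φ X :=
      (hh.comp (c3.mul continuous_const)).mul hφc
    have c6 : Continuous fun X => h (rY w X * (N + 1)) * φ X :=
      (hh.comp (c4.mul continuous_const)).mul hφc
    exact (continuous_const.mul ((c3.mul c5).mul (c4.mul c6))).sub (hdotc.mul (c5.pow 2))
  refine tendsto_integral_mul_of_bounded (K := tsupport φ) (B := max B' 0)
    (hf.integrableOn_isCompact hφ) (fun N => (hgc N).aestronglyMeasurable) (fun N X hX => ?_)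
    (fun N X => ?_) fun X => ?_
  · simp [image_eq_zero_of_notMem_tsupport hX]
  · by_cases hX : X ∈ tsupport φ
    swap
    · simp [image_eq_zero_of_notMem_tsupport hX]
    refine le_trans ?_ ((le_abs_self _).trans ((hB' X hX).trans (le_max_left _ 0)))
    have hi0 := hh0 (rY v X * (N + 1))
    have hi1 := hh1 (rY v X * (N + 1))
    have hj0 := hh0 (rY w X * (N + 1))
    have hj1 := hh1 (rY w X * (N + 1))
    have e : c * (rY v X * (h (rY v X * (N + 1)) * φ X)
          * (rY w X * (h (rY w X * (N + 1)) * φ X)))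
        - (∑ l : Fin d, pd (Sum.inr l) v X * pd (Sum.inr l) w X)
          * (h (rY v X * (N + 1)) * φ X) ^ 2
        = (h (rY v X * (N + 1)) * h (rY w X * (N + 1)) * (c * (rY v X * rY w X))
          - h (rY v X * (N + 1)) ^ 2 *
            (∑ l : Fin d, pd (Sum.inr l) v X * pd (Sum.inr l) w X)) * φ X ^ 2 := by
      ring
    rw [e, abs_mul, abs_of_nonneg (sq_nonneg (φ X))]
    refine mul_le_mul_of_nonneg_right ?_ (sq_nonneg _)
    refine (abs_sub _ _).trans (add_le_add ?_ ?_)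
    · rw [abs_mul, abs_of_nonneg (mul_nonneg hi0 hj0), abs_mul c,
        abs_of_nonneg (mul_nonneg (rY_nonneg v X) (rY_nonneg w X))]
      exact mul_le_of_le_one_left (mul_nonneg (abs_nonneg _)
        (mul_nonneg (rY_nonneg _ _) (rY_nonneg _ _))) (mul_le_one₀ hi1 hj0 hj1)
    · rw [abs_mul, abs_of_nonneg (sq_nonneg (h _))]
      exact mul_le_of_le_one_left (abs_nonneg _) (pow_le_one₀ hi0 hi1)
  · have t1 : Tendsto (fun N : ℕ => c * ((rY v X * h (rY v X * (N + 1)))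
        * (rY w X * h (rY w X * (N + 1)))) * φ X ^ 2) atTop
        (𝓝 (c * (rY v X * rY w X) * φ X ^ 2)) :=
      (((tendsto_rY_mul_cutoff ho v X).mul (tendsto_rY_mul_cutoff ho w X)).const_mul _).mul_const _
    have t2 : Tendsto (fun N : ℕ => (∑ l : Fin d, pd (Sum.inr l) v X
        * pd (Sum.inr l) w X) * (h (rY v X * (N + 1)) * φ X) ^ 2) atTop
        (𝓝 ((∑ l : Fin d, pd (Sum.inr l) v X * pd (Sum.inr l) w X) * φ X ^ 2)) := by
      by_cases hX : gradY v X = 0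
      · have h0 : rY v X = 0 := by rw [← norm_gradY, hX, norm_zero]
        simp [gradY_dot_eq_zero h0]
      · refine tendsto_const_nhds.congr' ?_
        filter_upwards [eventually_two_lt_rY_mul hX] with N hN
        rw [ho _ hN.le, one_mul]
    rw [sub_mul]
    refine (t1.sub t2).congr fun N => ?_
    ring

theorem integrableOn_mul_sq {S : Set (FibSpace m d)} (hS : MeasurableSet S)
    {G φ : FibSpace m d → ℝ} {R B : ℝ} (hG : IntegrableOn G (S ∩ Metric.ball 0 R))
    (hφ : Continuous φ) (hB : ∀ X, ‖φ X‖ ≤ B) (hφR : ∀ X, X ∉ Metric.ball 0 R → φ X = 0) :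
    IntegrableOn (fun X => G X * φ X ^ 2) S := by
  have h1 : IntegrableOn (fun X => G X * φ X ^ 2) (S ∩ Metric.ball 0 R) :=
    Integrable.mul_bdd (c := B ^ 2) hG (hφ.pow 2).aestronglyMeasurable
      (Eventually.of_forall fun X => by
        rw [norm_pow]; exact pow_le_pow_left₀ (norm_nonneg _) (hB X) 2)
  refine h1.of_forall_sdiff_eq_zero hS fun X hX => ?_
  have : φ X = 0 := hφR X fun h' => hX.2 ⟨hX.1, h'⟩
  simp [this]

set_option maxHeartbeats 400000 in
/-- The geometric Poincaré inequality on the set where the fibre gradients do not vanish. -/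
theorem geometric_poincare_limit {a : Fin n → EuclideanSpace ℝ (Fin m) → ℝ → ℝ}
    {F : EuclideanSpace ℝ (Fin m) → (Fin n → ℝ) → ℝ} {u : Fin n → FibSpace m d → ℝ}
    (ha : ∀ i, IsCoefficient (a i)) (hF : ∀ x, ContDiff ℝ 2 (F x))
    (hreg : ∀ i, IsRegularSol (u i)) (hsol : IsWeakSolution a F u) (hst : IsStable a F u)
    (hbdd : ∀ i, HasBoundedMatrix (a i) (u i))
    (hpos : ∀ i, ∀ᵐ X : FibSpace m d, (matrixAlong (a i) (u i) X).PosDef)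
    {s : Fin n → ℝ} (hs : ∀ i, s i * s i = 1) {φ : FibSpace m d → ℝ} (hφ : IsTestC1 univ φ) :
    (∑ i, ∫ X in {X | gradY (u i) X ≠ 0}, curv (a i) (u i) X * φ X ^ 2)
      + ∑ i, ∑ j, ∫ X, nlFF F i j (xPart X) (fun k => u k X) *
        ((s i * s j * (rY (u i) X * rY (u j) X)
          - ∑ l : Fin d, pd (Sum.inr l) (u i) X * pd (Sum.inr l) (u j) X) * φ X ^ 2)
      ≤ ∑ i, 2 * ∫ X in {X | gradY (u i) X ≠ 0},
        rY (u i) X ^ 2 * quad (matrixAlong (a i) (u i) X) (pdv φ X) (pdv φ X) := by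
  obtain ⟨h, M, hh, hh0, hh1, hz, ho, hM, hd2⟩ := exists_cutoff
  have hM0 : 0 ≤ M := (abs_nonneg _).trans (hM 0)
  have hΩ := fun i => isOpen_gradY_ne (hreg i).1
  have hφc := hφ.contDiff.continuous
  obtain ⟨R, hR, hφR⟩ : ∃ R : ℝ, 0 < R ∧ ∀ X : FibSpace m d, X ∉ Metric.ball 0 R → φ X = 0 := by
    obtain ⟨R, hR⟩ := hφ.compact.isCompact.isBounded.subset_ball 0
    refine ⟨max R 1, by positivity, fun X hX => image_eq_zero_of_notMem_tsupport fun h' => hX ?_⟩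
    exact Metric.ball_subset_ball (le_max_left _ _) (hR h')
  obtain ⟨B, hB⟩ := hφ.compact.exists_bound_of_continuous hφc
  -- Each component is cut off near its own zeros, which is why `geometric_poincare` allows a
  -- different test function for every index.
  set ζ : ℕ → Fin n → FibSpace m d → ℝ := fun N i X => h (rY (u i) X * (N + 1)) * φ X with hζdef
  have hζ : ∀ N i, IsTestC1 {X | gradY (u i) X ≠ 0} (ζ N i) := fun N i =>
    isTestC1_truncation hh hz (hreg i) hφ N
  have hconv1 : ∀ i X, gradY (u i) X ≠ 0 → ∀ᶠ N : ℕ in atTop, 2 < rY (u i) X * (N + 1) :=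
    fun i X hX => eventually_two_lt_rY_mul hX
  have hcurvφ : ∀ (i : Fin n) (G : FibSpace m d → ℝ),
      IntegrableOn G ({X | gradY (u i) X ≠ 0} ∩ Metric.ball 0 R) →
      IntegrableOn (fun X => G X * φ X ^ 2) {X | gradY (u i) X ≠ 0} := fun i G hG =>
    integrableOn_mul_sq (hΩ i).measurableSet hG hφc hB hφR
  -- the curvature term
  have hT1 : Tendsto (fun N => ∑ i, ∫ X, curv (a i) (u i) X * ζ N i X ^ 2) atTop
      (𝓝 (∑ i, ∫ X in {X | gradY (u i) X ≠ 0}, curv (a i) (u i) X * φ X ^ 2)) := by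
    refine tendsto_finsetSum _ fun i _ => ?_
    have hset : ∀ N, ∫ X, curv (a i) (u i) X * ζ N i X ^ 2
        = ∫ X in {X | gradY (u i) X ≠ 0}, curv (a i) (u i) X * ζ N i X ^ 2 := fun N =>
      (setIntegral_eq_integral_of_forall_compl_eq_zero fun X hX => by
        rw [image_eq_zero_of_notMem_tsupport fun h' => hX ((hζ N i).subset h')]; simp).symm
    simp_rw [hset]
    have hint := hcurvφ i _ (integrableOn_curv (hreg i) (hbdd i) hR)
    refine tendsto_integral_of_dominated_convergence (fun X => |curv (a i) (u i) X * φ X ^ 2|)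
      (fun N => (integrable_curv_mul_sq (hreg i) (hst.1 i) (hζ N i)).integrableOn.1) hint.abs ?_ ?_
    · refine fun N => Eventually.of_forall fun X => ?_
      rw [Real.norm_eq_abs, abs_mul, abs_mul]
      refine mul_le_mul_of_nonneg_left ?_ (abs_nonneg _)
      rw [abs_pow, abs_pow]
      refine pow_le_pow_left₀ (abs_nonneg _) ?_ 2
      rw [abs_mul, abs_of_nonneg (hh0 _)]
      exact mul_le_of_le_one_left (abs_nonneg _) (hh1 _)
    · filter_upwards [ae_restrict_mem (hΩ i).measurableSet] with X hX
      refine tendsto_const_nhds.congr' ?_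
      filter_upwards [hconv1 i X hX] with N hN
      simp only [hζdef, ho _ hN.le, one_mul]
  -- the reaction term
  have hT2 : Tendsto (fun N => ∑ i, ∑ j, ∫ X, nlFF F i j (xPart X) (fun k => u k X) *
        (s i * s j * (rY (u i) X * ζ N i X * (rY (u j) X * ζ N j X))
          - (∑ l : Fin d, pd (Sum.inr l) (u i) X * pd (Sum.inr l) (u j) X) * ζ N i X ^ 2)) atTop
      (𝓝 (∑ i, ∑ j, ∫ X, nlFF F i j (xPart X) (fun k => u k X) *
        ((s i * s j * (rY (u i) X * rY (u j) X)
          - ∑ l : Fin d, pd (Sum.inr l) (u i) X * pd (Sum.inr l) (u j) X) * φ X ^ 2))) := by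
    exact tendsto_finsetSum _ fun i _ => tendsto_finsetSum _ fun j _ =>
      tendsto_integral_reaction (hst.2.1 i j) (s i * s j) (hreg i).1 (hreg j).1 hh.continuous
        hh0 hh1 ho hφc hφ.compact
  -- the right-hand side
  have hIφ : ∀ i, IntegrableOn (fun X => rY (u i) X ^ 2 *
      quad (matrixAlong (a i) (u i) X) (pdv φ X) (pdv φ X)) {X | gradY (u i) X ≠ 0} := by
    intro i
    refine Integrable.integrableOn ?_
    simp only [quad, Finset.mul_sum, pdv]
    refine integrable_finsetSum _ fun k _ => integrable_finsetSum _ fun l _ => ?_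
    have := integrable_mul_of_tsupport (hst.1 i k l)
      ((((continuous_rY (hreg i).1).pow 2).mul (continuous_pd hφ.contDiff l)).mul
        (continuous_pd hφ.contDiff k)) (hφ.compact.pd k).mul_left
    refine this.congr (Eventually.of_forall fun X => ?_)
    simp only [Pi.mul_apply, Pi.pow_apply]
    ring
  have hIr := fun i => hcurvφ i _ (integrableOn_quad_rY (hreg i) (hbdd i) hR)
  have hκ : Continuous fun t => t * deriv h t := continuous_id.mul (hh.continuous_deriv le_rfl)
  have hIE : ∀ i (N : ℕ), IntegrableOn (fun X =>
      quad (matrixAlong (a i) (u i) X) (pdv (rY (u i)) X) (pdv (rY (u i)) X) * φ X ^ 2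
        * (rY (u i) X * (N + 1) * deriv h (rY (u i) X * (N + 1))) ^ 2)
      {X | gradY (u i) X ≠ 0} := by
    intro i N
    refine Integrable.mul_bdd (c := M ^ 2) (hIr i) ?_ (Eventually.of_forall fun X => ?_)
    · exact ((hκ.comp ((continuous_rY (hreg i).1).mul continuous_const)).pow 2).aestronglyMeasurable
    · rw [norm_pow]; exact pow_le_pow_left₀ (norm_nonneg _) (hM _) 2
  -- The factor 2 lost in the parallelogram inequality is harmless, since the right-hand side will
  -- be driven to zero.
  have hT3 : Tendsto (fun N : ℕ => ∑ i, (2 * (∫ X in {X | gradY (u i) X ≠ 0},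
        quad (matrixAlong (a i) (u i) X) (pdv (rY (u i)) X) (pdv (rY (u i)) X) * φ X ^ 2
        * (rY (u i) X * (N + 1) * deriv h (rY (u i) X * (N + 1))) ^ 2)
      + 2 * ∫ X in {X | gradY (u i) X ≠ 0},
        rY (u i) X ^ 2 * quad (matrixAlong (a i) (u i) X) (pdv φ X) (pdv φ X))) atTop
      (𝓝 (∑ i, 2 * ∫ X in {X | gradY (u i) X ≠ 0},
        rY (u i) X ^ 2 * quad (matrixAlong (a i) (u i) X) (pdv φ X) (pdv φ X))) := by
    refine tendsto_finsetSum _ fun i _ => ?_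
    have hE : Tendsto (fun N : ℕ => ∫ X in {X | gradY (u i) X ≠ 0},
        quad (matrixAlong (a i) (u i) X) (pdv (rY (u i)) X) (pdv (rY (u i)) X) * φ X ^ 2
        * (rY (u i) X * (N + 1) * deriv h (rY (u i) X * (N + 1))) ^ 2) atTop (𝓝 0) := by
      -- The truncation error tends to zero pointwise: for fixed X with r > 0 eventually r(N+1) > 2,
      -- where h' = 0. The majorant is M² times an integrable function.
      rw [← integral_zero (FibSpace m d) ℝ (μ := volume.restrict {X | gradY (u i) X ≠ 0})]
      refine tendsto_integral_of_dominated_convergence (fun X =>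
        |quad (matrixAlong (a i) (u i) X) (pdv (rY (u i)) X) (pdv (rY (u i)) X) * φ X ^ 2| * M ^ 2)
        (fun N => (hIE i N).1) ((hIr i).abs.mul_const _) ?_ ?_
      · refine fun N => Eventually.of_forall fun X => ?_
        rw [Real.norm_eq_abs, abs_mul]
        refine mul_le_mul_of_nonneg_left ?_ (abs_nonneg _)
        rw [abs_pow]; exact pow_le_pow_left₀ (abs_nonneg _) (hM _) 2
      · filter_upwards [ae_restrict_mem (hΩ i).measurableSet] with X hX
        refine tendsto_const_nhds.congr' ?_
        filter_upwards [hconv1 i X hX] with N hN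
        rw [hd2 _ hN]; simp
    simpa using (hE.const_mul 2).add_const (2 * ∫ X in {X | gradY (u i) X ≠ 0},
        rY (u i) X ^ 2 * quad (matrixAlong (a i) (u i) X) (pdv φ X) (pdv φ X))
  refine le_of_tendsto_of_tendsto' (hT1.add hT2) hT3 fun N => ?_
  refine (geometric_poincare ha hF hreg hsol hst hs (hζ N)).trans (Finset.sum_le_sum fun i _ => ?_)
  have hset : ∫ X, rY (u i) X ^ 2 * quad (matrixAlong (a i) (u i) X) (pdv (ζ N i) X) (pdv (ζ N i) X)
      = ∫ X in {X | gradY (u i) X ≠ 0}, rY (u i) X ^ 2 *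
        quad (matrixAlong (a i) (u i) X) (pdv (ζ N i) X) (pdv (ζ N i) X) :=
    (setIntegral_eq_integral_of_forall_compl_eq_zero fun X hX => by
      have : pdv (ζ N i) X = 0 := by
        ext k; exact pd_eq_zero_of_notMem_tsupport (fun h' => hX ((hζ N i).subset h')) k
      rw [this, quad_zero_left, mul_zero]).symm
  rw [hset, ← integral_const_mul, ← integral_const_mul, ← integral_add ((hIE i N).const_mul 2)
    ((hIφ i).const_mul 2)]
  refine integral_mono_of_nonneg ?_ (((hIE i N).const_mul 2).add ((hIφ i).const_mul 2)) ?_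
  · filter_upwards [ae_restrict_of_ae (hpos i)] with X hX
    exact mul_nonneg (sq_nonneg _) (quad_nonneg hX _)
  · filter_upwards [ae_restrict_of_ae (hpos i), ae_restrict_mem (hΩ i).measurableSet] with X hX hX2
    exact quad_truncation_le hh hh0 hh1 (hreg i) hφ N hX2 hX

end Limit

/-! ### Curvature as a sum of squares; the logarithmic cut-off. -/

section Rigidity

open Set Filter Topology

variable {m d n : ℕ}

/-- The curvature term is a sum of squares. -/
theorem curv_eq_sum (a : EuclideanSpace ℝ (Fin m) → ℝ → ℝ) {v : FibSpace m d → ℝ}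
    (hv : IsRegularSol v) {X : FibSpace m d} (hX : gradY v X ≠ 0) :
    curv a v X = ∑ l : Fin d, quad (matrixAlong a v X)
      (pdv (pd (Sum.inr l) v) X + (-(pd (Sum.inr l) v X / rY v X)) • pdv (rY v) X)
      (pdv (pd (Sum.inr l) v) X + (-(pd (Sum.inr l) v X / rY v X)) • pdv (rY v) X) := by
  have hr := (rY_pos_iff v X).mpr hX
  have hsym := coefMatrix_isHermitian a (xPart X) (gradient v X)
  -- With c_l = ∂_{y_l}v / r one has ∑ c_l ∇∂_{y_l}v = ∇r and ∑ c_l² = 1. Expanding the squares, the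
  -- cross terms give −2 and the last terms +1 times the form at ∇r.
  have h1 : ∑ l : Fin d, (pd (Sum.inr l) v X / rY v X) * quad (matrixAlong a v X)
      (pdv (pd (Sum.inr l) v) X) (pdv (rY v) X)
      = quad (matrixAlong a v X) (pdv (rY v) X) (pdv (rY v) X) := by
    rw [← quad_sum_left]
    congr 1
    ext q
    have := rY_mul_pd_rY hv hX q
    simp_rw [div_mul_eq_mul_div]
    rw [← Finset.sum_div, div_eq_iff hr.ne', mul_comm (pdv (rY v) X q)]
    exact this.symm
  have h2 : ∑ l : Fin d, (pd (Sum.inr l) v X / rY v X) ^ 2 = 1 := by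
    simp_rw [div_pow]
    rw [← Finset.sum_div, ← rY_sq, div_self (pow_ne_zero 2 hr.ne')]
  have e : ∀ l : Fin d, quad (matrixAlong a v X)
      (pdv (pd (Sum.inr l) v) X + (-(pd (Sum.inr l) v X / rY v X)) • pdv (rY v) X)
      (pdv (pd (Sum.inr l) v) X + (-(pd (Sum.inr l) v X / rY v X)) • pdv (rY v) X)
      = quad (matrixAlong a v X) (pdv (pd (Sum.inr l) v) X) (pdv (pd (Sum.inr l) v) X)
        - 2 * ((pd (Sum.inr l) v X / rY v X) * quad (matrixAlong a v X)
          (pdv (pd (Sum.inr l) v) X) (pdv (rY v) X))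
        + (pd (Sum.inr l) v X / rY v X) ^ 2
          * quad (matrixAlong a v X) (pdv (rY v) X) (pdv (rY v) X) := by
    intro l
    have hc : quad (matrixAlong a v X) (pdv (rY v) X) (pdv (pd (Sum.inr l) v) X)
        = quad (matrixAlong a v X) (pdv (pd (Sum.inr l) v) X) (pdv (rY v) X) := quad_comm hsym _ _
    simp only [quad_add_left, quad_add_right, quad_smul_left, quad_smul_right, hc]
    ring
  simp_rw [e]
  rw [Finset.sum_add_distrib, Finset.sum_sub_distrib, ← Finset.mul_sum, h1, ← Finset.sum_mul, h2,
    curv]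
  ring

theorem curv_nonneg {a : EuclideanSpace ℝ (Fin m) → ℝ → ℝ} {v : FibSpace m d → ℝ}
    (hv : IsRegularSol v) {X : FibSpace m d} (hX : gradY v X ≠ 0)
    (hpos : (matrixAlong a v X).PosDef) : 0 ≤ curv a v X := by
  rw [curv_eq_sum a hv hX]
  exact Finset.sum_nonneg fun _ _ => quad_nonneg hpos _

/-- Where the curvature term vanishes, the rows of the Hessian are proportional. -/
theorem pd_pd_eq_of_curv_eq_zero {a : EuclideanSpace ℝ (Fin m) → ℝ → ℝ} {v : FibSpace m d → ℝ}
    (hv : IsRegularSol v) {X : FibSpace m d} (hX : gradY v X ≠ 0)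
    (hpos : (matrixAlong a v X).PosDef) (h0 : curv a v X = 0) (l : Fin d) (q : Fin m ⊕ Fin d) :
    pd q (pd (Sum.inr l) v) X = pd (Sum.inr l) v X / rY v X * pd q (rY v) X := by
  rw [curv_eq_sum a hv hX, Finset.sum_eq_zero_iff_of_nonneg fun _ _ => quad_nonneg hpos _] at h0
  have h1 := h0 l (Finset.mem_univ l)
  have h2 : pdv (pd (Sum.inr l) v) X + (-(pd (Sum.inr l) v X / rY v X)) • pdv (rY v) X = 0 := by
    by_contra hne
    exact (quad_pos hpos hne).ne' h1
  have h3 := congrFun h2 q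
  simp only [pdv, Pi.add_apply, Pi.smul_apply, smul_eq_mul, Pi.zero_apply] at h3
  linarith

/-- Cauchy–Schwarz for the fibre gradients. -/
theorem abs_gradY_dot_le (v w : FibSpace m d → ℝ) (X : FibSpace m d) :
    |∑ l : Fin d, pd (Sum.inr l) v X * pd (Sum.inr l) w X| ≤ rY v X * rY w X := by
  rw [rY, rY, ← Real.sqrt_mul (Finset.sum_nonneg fun _ _ => sq_nonneg _)]
  exact Real.abs_le_sqrt (Finset.sum_mul_sq_le_sq_mul_sq _ _ _)

/-- For gradients living on disjoint annuli: no cross terms, so averaging k of them gains a full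
factor 1/k in the energy. -/
theorem sum_sq_of_pairwise_mul_eq_zero {κ : Type*} (S : Finset κ) (f : κ → ℝ)
    (h : ∀ i j, i ≠ j → f i * f j = 0) : (∑ j ∈ S, f j) ^ 2 = ∑ j ∈ S, f j ^ 2 := by
  rw [sq, Finset.sum_mul_sum]
  refine Finset.sum_congr rfl fun i hi => ?_
  rw [Finset.sum_eq_single i (fun j _ hj => h i j hj.symm) (fun h' => absurd hi h'), sq]

/-- A dyadic logarithmic cut-off. -/
theorem exists_log_cutoff : ∃ C : ℝ, 0 ≤ C ∧ ∀ N k : ℕ, 0 < k → ∃ φ : FibSpace m d → ℝ,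
    IsTestC1 univ φ ∧ (∀ X ∈ Metric.ball (0 : FibSpace m d) (2 ^ N), φ X = 1) ∧
    ∀ X, ∑ q, pd q φ X ^ 2 ≤ ∑ j ∈ Finset.range k, (C / (k ^ 2 * 4 ^ (N + j))) *
      (Metric.ball (0 : FibSpace m d) (2 ^ (N + j + 1))).indicator 1 X := by
  -- The radii 5/4 and 7/4 lie strictly between 1 and 2, so ∇χ lives in the open annulus 1 < |Y| <
  -- 2, and dilations by distinct powers of 2 have gradients with disjoint supports.
  let χ : ContDiffBump (0 : FibSpace m d) := ⟨5 / 4, 7 / 4, by norm_num, by norm_num⟩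
  have hχ : ContDiff ℝ 1 χ := χ.contDiff
  have hχc : HasCompactSupport χ := χ.hasCompactSupport
  have hχ0 : ∀ q (Y : FibSpace m d), pd q χ Y ≠ 0 → 1 < ‖Y‖ ∧ ‖Y‖ < 2 := by
    intro q Y hY
    constructor
    · by_contra hle
      have : (χ : FibSpace m d → ℝ) =ᶠ[𝓝 Y] fun _ => 1 := by
        filter_upwards [Metric.isOpen_ball.mem_nhds
          (show Y ∈ Metric.ball (0 : FibSpace m d) (5 / 4) by simp; linarith)] with Z hZ
        exact χ.one_of_mem_closedBall (Metric.ball_subset_closedBall hZ)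
      refine hY ?_
      rw [pd_congr this]
      simp [pd]
    · by_contra hle
      refine hY (pd_eq_zero_of_notMem_tsupport (fun h => hle ?_) q)
      rw [χ.tsupport_eq] at h
      have : ‖Y‖ ≤ 7 / 4 := by simpa using h
      linarith
  obtain ⟨C, hC⟩ : ∃ C, ∀ Y : FibSpace m d, ∑ q, pd q χ Y ^ 2 ≤ C := by
    have hcont : Continuous fun Y : FibSpace m d => ∑ q, pd q χ Y ^ 2 :=
      continuous_finsetSum _ fun q _ => (continuous_pd hχ q).pow 2
    obtain ⟨C, hC⟩ := hχc.isCompact.exists_bound_of_continuousOn hcont.continuousOn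
    refine ⟨max C 0, fun Y => ?_⟩
    by_cases hY : Y ∈ tsupport χ
    · exact ((le_abs_self _).trans (hC Y hY)).trans (le_max_left _ _)
    · simp [pd_eq_zero_of_notMem_tsupport hY]
  have hC0 : 0 ≤ C := (Finset.sum_nonneg fun _ _ => sq_nonneg _).trans (hC 0)
  refine ⟨C, hC0, fun N k hk => ?_⟩
  let c : ℕ → ℝ := fun j => ((2 : ℝ) ^ (N + j))⁻¹
  have hc : ∀ j, 0 < c j := fun j => by positivity
  let f : ℕ → FibSpace m d → ℝ := fun j X => χ (c j • X)
  have hf : ∀ j, ContDiff ℝ 1 (f j) := fun j => hχ.comp (contDiff_const_smul (c j))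
  have hfd : ∀ j X, DifferentiableAt ℝ (f j) X := fun j X => (hf j).differentiable one_ne_zero X
  have hpd : ∀ j q X, pd q (f j) X = c j * pd q χ (c j • X) := by
    intro j q X
    have h1 : HasFDerivAt (f j) ((fderiv ℝ χ (c j • X)).comp
        (c j • ContinuousLinearMap.id ℝ (FibSpace m d))) X :=
      (hχ.differentiable one_ne_zero (c j • X)).hasFDerivAt.comp X
        ((hasFDerivAt_id X).const_smul (c j))
    unfold pd
    rw [h1.fderiv]
    simp
  have hloc : ∀ j q X, pd q (f j) X ≠ 0 → 2 ^ (N + j) < ‖X‖ ∧ ‖X‖ < 2 ^ (N + j + 1) := by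
    intro j q X h
    rw [hpd] at h
    obtain ⟨h1, h2⟩ := hχ0 q _ (right_ne_zero_of_mul h)
    rw [norm_smul, Real.norm_of_nonneg (hc j).le] at h1 h2
    have hp : (0 : ℝ) < 2 ^ (N + j) := by positivity
    simp only [c] at h1 h2
    rw [inv_mul_eq_div] at h1 h2
    rw [lt_div_iff₀ hp] at h1
    rw [div_lt_iff₀ hp] at h2
    refine ⟨by linarith, ?_⟩
    rw [pow_succ]; linarith
  have hdisj : ∀ q X i j, i ≠ j → pd q (f i) X * pd q (f j) X = 0 := by
    have key : ∀ q X i j, i < j → pd q (f i) X * pd q (f j) X = 0 := by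
      intro q X i j hij
      by_contra hne
      have h1 := (hloc i q X (left_ne_zero_of_mul hne)).2
      have h2 := (hloc j q X (right_ne_zero_of_mul hne)).1
      have h3 : (2 : ℝ) ^ (N + i + 1) ≤ 2 ^ (N + j) :=
        pow_le_pow_right₀ (by norm_num) (by omega)
      linarith
    intro q X i j hij
    rcases hij.lt_or_gt with h | h
    · exact key q X i j h
    · rw [mul_comm]; exact key q X j i h
  have hk' : (0 : ℝ) < k := by exact_mod_cast hk
  -- The average of k dyadic dilates of χ imitates a function linear in log |X|. Its squared
  -- gradient on the j-th annulus is at most C/(k² 4^(N+j)), against an energy of order 4^(N+j)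
  -- there.
  refine ⟨fun X => (k : ℝ)⁻¹ * ∑ j ∈ Finset.range k, f j X, ⟨?_, ?_, subset_univ _⟩, ?_, ?_⟩
  · exact contDiff_const.mul (ContDiff.sum fun j _ => hf j)
  · refine HasCompactSupport.intro (isCompact_closedBall (0 : FibSpace m d) (2 ^ (N + k + 1)))
      fun X hX => ?_
    rw [Finset.sum_eq_zero, mul_zero]
    intro j hj
    refine χ.zero_of_le_dist ?_
    rw [dist_zero_right, norm_smul, Real.norm_of_nonneg (hc j).le]
    have h1 : (2 : ℝ) ^ (N + k + 1) < ‖X‖ := by simpa using hX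
    have h2 : (2 : ℝ) ^ (N + j + 1) ≤ 2 ^ (N + k + 1) :=
      pow_le_pow_right₀ (by norm_num) (by have := Finset.mem_range.mp hj; omega)
    have hp : (0 : ℝ) < 2 ^ (N + j) := by positivity
    simp only [c]
    rw [inv_mul_eq_div, le_div_iff₀ hp]
    rw [pow_succ] at h2
    change 7 / 4 * (2 : ℝ) ^ (N + j) ≤ ‖X‖
    linarith
  · intro X hX
    have : ∀ j ∈ Finset.range k, f j X = 1 := by
      intro j _
      refine χ.one_of_mem_closedBall ?_
      rw [mem_closedBall_zero_iff, norm_smul, Real.norm_of_nonneg (hc j).le]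
      have h1 : ‖X‖ < 2 ^ N := by simpa using hX
      have h2 : (2 : ℝ) ^ N ≤ 2 ^ (N + j) := pow_le_pow_right₀ (by norm_num) (by omega)
      have hp : (0 : ℝ) < 2 ^ (N + j) := by positivity
      simp only [c]
      rw [inv_mul_eq_div, div_le_iff₀ hp]
      change ‖X‖ ≤ 5 / 4 * (2 : ℝ) ^ (N + j)
      linarith
    beta_reduce
    rw [Finset.sum_congr rfl this]
    simp [hk'.ne']
  · intro X
    have hpdφ : ∀ q, pd q (fun X => (k : ℝ)⁻¹ * ∑ j ∈ Finset.range k, f j X) X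
        = (k : ℝ)⁻¹ * ∑ j ∈ Finset.range k, pd q (f j) X := by
      intro q
      rw [pd_const_mul (DifferentiableAt.fun_sum fun j _ => hfd j X)]
      unfold pd
      rw [fderiv_fun_sum fun j _ => hfd j X]
      simp
    simp_rw [hpdφ, mul_pow, sum_sq_of_pairwise_mul_eq_zero _ _ (hdisj _ X)]
    rw [← Finset.mul_sum, Finset.sum_comm, Finset.mul_sum]
    refine Finset.sum_le_sum fun j _ => ?_
    by_cases hX : X ∈ Metric.ball (0 : FibSpace m d) (2 ^ (N + j + 1))
    · rw [indicator_of_mem hX, Pi.one_apply, mul_one]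
      simp_rw [hpd, mul_pow]
      rw [← Finset.mul_sum]
      have e : c j ^ 2 = ((4 : ℝ) ^ (N + j))⁻¹ := by
        simp only [c]
        rw [inv_pow, ← pow_mul, mul_comm, pow_mul]; norm_num
      rw [e, div_eq_mul_inv, mul_inv, inv_pow, mul_comm C, mul_assoc]
      gcongr
      exact hC _
    · rw [indicator_of_notMem hX, mul_zero]
      have : ∀ q, pd q (f j) X = 0 := fun q => by
        by_contra hne
        exact hX (by simpa using (hloc j q X hne).2)
      simp [this]

/-- A nonnegative function whose integrals against cut-offs tend to zero vanishes. -/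
theorem ae_eq_zero_of_integral_cutoff_le {μ : Measure (FibSpace m d)} {G : FibSpace m d → ℝ}
    {ρ C : ℝ} (hG : ∀ᵐ X ∂μ, 0 ≤ G X) {φ : ℕ → FibSpace m d → ℝ}
    (hφ : ∀ k, ∀ X ∈ Metric.ball (0 : FibSpace m d) ρ, φ k X = 1)
    (hi : ∀ k, Integrable (fun X => G X * φ k X ^ 2) μ)
    (hle : ∀ k : ℕ, ∫ X, G X * φ k X ^ 2 ∂μ ≤ C / (k + 1)) :
    ∀ᵐ X ∂μ, X ∈ Metric.ball (0 : FibSpace m d) ρ → G X = 0 := by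
  have hb : MeasurableSet (Metric.ball (0 : FibSpace m d) ρ) := Metric.isOpen_ball.measurableSet
  have hint : IntegrableOn G (Metric.ball 0 ρ) μ :=
    (hi 0).integrableOn.congr_fun (fun X hX => by simp [hφ 0 X hX]) hb
  have hle2 : ∀ k : ℕ, ∫ X in Metric.ball 0 ρ, G X ∂μ ≤ C / (k + 1) := by
    intro k
    refine le_trans ?_ (hle k)
    have e : ∫ X in Metric.ball 0 ρ, G X ∂μ = ∫ X in Metric.ball 0 ρ, G X * φ k X ^ 2 ∂μ :=
      setIntegral_congr_fun hb fun X hX => by simp [hφ k X hX]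
    rw [e]
    refine setIntegral_le_integral (hi k) ?_
    filter_upwards [hG] with X hX using mul_nonneg hX (sq_nonneg _)
  have h0 : ∫ X in Metric.ball 0 ρ, G X ∂μ ≤ 0 :=
    ge_of_tendsto' (tendsto_const_div_atTop_nhds_zero_nat C |>.comp (tendsto_add_atTop_nat 1))
      fun k => by simpa using hle2 k
  have h1 : ∫ X in Metric.ball 0 ρ, G X ∂μ = 0 :=
    le_antisymm h0 (integral_nonneg_of_ae (ae_restrict_of_ae hG))
  have h2 := (integral_eq_zero_iff_of_nonneg_ae (ae_restrict_of_ae hG) hint).mp h1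
  exact (ae_restrict_iff' hb).mp h2

end Rigidity

/-! ### Vanishing of the curvature and of the coupling term. -/

section Conclusion

open Set Filter Topology

variable {m d n : ℕ}

/-- Schwarz's theorem; it carries the sign condition, given for `i < j`, over to all pairs of
distinct indices. -/
theorem nlFF_comm {F : EuclideanSpace ℝ (Fin m) → (Fin n → ℝ) → ℝ}
    (hF : ∀ x, ContDiff ℝ 2 (F x)) (i j : Fin n) (x : EuclideanSpace ℝ (Fin m))
    (ξ : Fin n → ℝ) : nlFF F i j x ξ = nlFF F j i x ξ := by
  have hs : IsSymmSndFDerivAt ℝ (F x) ξ := (hF x).contDiffAt.isSymmSndFDerivAt (by simp)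
  have hd : DifferentiableAt ℝ (fderiv ℝ (F x)) ξ :=
    ((hF x).fderiv_right (m := 1) (by norm_num)).differentiable one_ne_zero ξ
  have key : ∀ a b : Fin n, nlFF F b a x ξ =
      fderiv ℝ (fderiv ℝ (F x)) ξ (Pi.single a 1) (Pi.single b 1) := by
    intro a b
    have : HasFDerivAt (nlF F b x)
        ((ContinuousLinearMap.apply ℝ ℝ (Pi.single b (1 : ℝ) : Fin n → ℝ)).comp
          (fderiv ℝ (fderiv ℝ (F x)) ξ)) ξ :=
      (ContinuousLinearMap.apply ℝ ℝ (Pi.single b (1 : ℝ) : Fin n → ℝ)).hasFDerivAt.comp ξ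
        hd.hasFDerivAt
    unfold nlFF pderivXi
    rw [this.fderiv]
    rfl
  rw [key, key, hs.eq]

/-- The energy of a logarithmic cut-off. -/
theorem integral_quad_cutoff_le {a : EuclideanSpace ℝ (Fin m) → ℝ → ℝ} {v : FibSpace m d → ℝ}
    (hv : IsRegularSol v) (hpos : ∀ᵐ X : FibSpace m d, (matrixAlong a v X).PosDef)
    {c C : ℝ} (hC : 0 ≤ C) {N k : ℕ} (hk : 0 < k)
    (hgrowth : ∀ R : ℝ, 2 ^ N ≤ R →
      IntegrableOn (fun X => largestEigenvalue (matrixAlong a v X) * ‖gradient v X‖ ^ 2)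
        (Metric.ball 0 R) ∧
      ∫ X in Metric.ball 0 R, largestEigenvalue (matrixAlong a v X) * ‖gradient v X‖ ^ 2
        ≤ c * R ^ 2)
    {φ : FibSpace m d → ℝ}
    (hφ : ∀ X, ∑ q, pd q φ X ^ 2 ≤ ∑ j ∈ Finset.range k, (C / (k ^ 2 * 4 ^ (N + j))) *
      (Metric.ball (0 : FibSpace m d) (2 ^ (N + j + 1))).indicator 1 X) :
    ∫ X in {X | gradY v X ≠ 0}, rY v X ^ 2 * quad (matrixAlong a v X) (pdv φ X) (pdv φ X)
      ≤ 4 * C * c / k := by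
  have hk' : (0 : ℝ) < k := by exact_mod_cast hk
  set g : FibSpace m d → ℝ := fun X =>
    largestEigenvalue (matrixAlong a v X) * ‖gradient v X‖ ^ 2 with hg
  have hR : ∀ j, (2 : ℝ) ^ N ≤ 2 ^ (N + j + 1) := fun j =>
    pow_le_pow_right₀ (by norm_num) (by omega)
  have hgi : ∀ j, Integrable ((Metric.ball (0 : FibSpace m d) (2 ^ (N + j + 1))).indicator g) :=
    fun j => (hgrowth _ (hR j)).1.integrable_indicator Metric.isOpen_ball.measurableSet
  have hsumi : Integrable fun X => ∑ j ∈ Finset.range k, (C / (k ^ 2 * 4 ^ (N + j))) *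
      (Metric.ball (0 : FibSpace m d) (2 ^ (N + j + 1))).indicator g X :=
    integrable_finsetSum _ fun j _ => (hgi j).const_mul _
  have hnn : ∀ᵐ X : FibSpace m d, 0 ≤ rY v X ^ 2 * quad (matrixAlong a v X) (pdv φ X) (pdv φ X) := by
    filter_upwards [hpos] with X hX using mul_nonneg (sq_nonneg _) (quad_nonneg hX _)
  have hle : ∀ᵐ X : FibSpace m d, X ∈ {X | gradY v X ≠ 0} →
      rY v X ^ 2 * quad (matrixAlong a v X) (pdv φ X) (pdv φ X)
      ≤ ∑ j ∈ Finset.range k, (C / (k ^ 2 * 4 ^ (N + j))) *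
      (Metric.ball (0 : FibSpace m d) (2 ^ (N + j + 1))).indicator g X := by
    filter_upwards [hpos] with X hX hX2
    set L := largestEigenvalue (matrixAlong a v X) with hL
    -- Compare the form with L on a nonzero vector; at these points ∇v is one.
    have hL0 : 0 ≤ L := by
      have hη : pdv v X ≠ 0 := by
        intro h
        refine gradY_ne_subset v hX2 ?_
        ext q
        rw [gradient_coord]; exact congrFun h q
      have h1 := (quad_pos hX hη).trans_le (quad_le_largestEigenvalue hX (pdv v X))
      exact (pos_of_mul_pos_left h1 (Finset.sum_nonneg fun _ _ => sq_nonneg _)).le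
    have h1 := quad_le_largestEigenvalue hX (pdv φ X)
    have h2 : rY v X ^ 2 ≤ ‖gradient v X‖ ^ 2 :=
      pow_le_pow_left₀ (rY_nonneg v X) (rY_le_norm_gradient v X) 2
    have h3 : (0 : ℝ) ≤ ∑ q, pdv φ X q ^ 2 := Finset.sum_nonneg fun _ _ => sq_nonneg _
    calc rY v X ^ 2 * quad (matrixAlong a v X) (pdv φ X) (pdv φ X)
        ≤ ‖gradient v X‖ ^ 2 * (L * ∑ q, pdv φ X q ^ 2) :=
          mul_le_mul h2 h1 (quad_nonneg hX _) (sq_nonneg _)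
      _ = g X * ∑ q, pd q φ X ^ 2 := by simp only [hg, pdv]; ring
      _ ≤ g X * ∑ j ∈ Finset.range k, (C / (k ^ 2 * 4 ^ (N + j))) *
          (Metric.ball (0 : FibSpace m d) (2 ^ (N + j + 1))).indicator 1 X :=
          mul_le_mul_of_nonneg_left (hφ X) (mul_nonneg hL0 (sq_nonneg _))
      _ = _ := by
          rw [Finset.mul_sum]
          refine Finset.sum_congr rfl fun j _ => ?_
          by_cases hX : X ∈ Metric.ball (0 : FibSpace m d) (2 ^ (N + j + 1))
          · simp only [indicator_of_mem hX, Pi.one_apply]; ring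
          · simp only [indicator_of_notMem hX]; ring
  have hΩ := (isOpen_gradY_ne hv.1).measurableSet
  have hg0 : ∀ᵐ X : FibSpace m d, 0 ≤ g X := by
    filter_upwards [hpos] with X hX
    by_cases hη : pdv v X = 0
    · have : gradient v X = 0 := by
        ext q
        rw [gradient_coord]; exact congrFun hη q
      simp [hg, this]
    · have h1 := (quad_pos hX hη).trans_le (quad_le_largestEigenvalue hX (pdv v X))
      exact mul_nonneg (pos_of_mul_pos_left h1 (Finset.sum_nonneg fun _ _ => sq_nonneg _)).le
        (sq_nonneg _)
  have hsum0 : ∀ᵐ X : FibSpace m d, 0 ≤ ∑ j ∈ Finset.range k, (C / (k ^ 2 * 4 ^ (N + j))) *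
      (Metric.ball (0 : FibSpace m d) (2 ^ (N + j + 1))).indicator g X := by
    filter_upwards [hg0] with X hX
    refine Finset.sum_nonneg fun j _ => mul_nonneg (by positivity) ?_
    by_cases hX2 : X ∈ Metric.ball (0 : FibSpace m d) (2 ^ (N + j + 1))
    · rwa [indicator_of_mem hX2]
    · rw [indicator_of_notMem hX2]
  refine (integral_mono_of_nonneg (ae_restrict_of_ae hnn) hsumi.integrableOn
    ((ae_restrict_iff' hΩ).mpr hle)).trans ?_
  refine (setIntegral_le_integral hsumi hsum0).trans ?_
  rw [integral_finsetSum _ fun j _ => (hgi j).const_mul _]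
  have hterm : ∀ j ∈ Finset.range k, ∫ X, (C / (k ^ 2 * 4 ^ (N + j))) *
      (Metric.ball (0 : FibSpace m d) (2 ^ (N + j + 1))).indicator g X ≤ 4 * C * c / k ^ 2 := by
    intro j _
    rw [integral_const_mul, integral_indicator Metric.isOpen_ball.measurableSet]
    have h1 := (hgrowth _ (hR j)).2
    -- The square of the radius 2^(N+j+1) is 4·4^(N+j): the scale cancels and each annulus costs the
    -- same 4Cc/k². Summing k of them leaves 4Cc/k.
    have e : C / (k ^ 2 * 4 ^ (N + j)) * (c * ((2 : ℝ) ^ (N + j + 1)) ^ 2) = 4 * C * c / k ^ 2 := by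
      have : ((2 : ℝ) ^ (N + j + 1)) ^ 2 = 4 * 4 ^ (N + j) := by
        rw [← pow_mul, mul_comm (N + j + 1), pow_mul, pow_succ]; norm_num; ring
      rw [this]
      field_simp
    rw [← e]
    exact mul_le_mul_of_nonneg_left h1 (by positivity)
  refine (Finset.sum_le_sum hterm).trans ?_
  rw [Finset.sum_const, Finset.card_range, nsmul_eq_mul]
  refine le_of_eq ?_
  field_simp

/-- The pointwise consequences of stability. -/
theorem curv_and_reaction_eq_zero {a : Fin n → EuclideanSpace ℝ (Fin m) → ℝ → ℝ}
    {F : EuclideanSpace ℝ (Fin m) → (Fin n → ℝ) → ℝ} {u : Fin n → FibSpace m d → ℝ}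
    (ha : ∀ i, IsCoefficient (a i)) (hF : ∀ x, ContDiff ℝ 2 (F x))
    (hreg : ∀ i, IsRegularSol (u i)) (hsol : IsWeakSolution a F u) (hst : IsStable a F u)
    (hbdd : ∀ i, HasBoundedMatrix (a i) (u i))
    (hpos : ∀ i, ∀ᵐ X : FibSpace m d, (matrixAlong (a i) (u i) X).PosDef)
    {s : Fin n → ℝ} (hs : ∀ i, s i * s i = 1)
    (hsign : ∀ i j, i ≠ j → ∀ X, 0 ≤ nlFF F i j (xPart X) (fun k => u k X) * s i * s j)
    (C₀ : Fin n → ℝ)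
    (hgrowth : ∀ i, ∀ R : ℝ, (∀ j, C₀ j ≤ R) →
      IntegrableOn (fun X => largestEigenvalue (matrixAlong (a i) (u i) X)
        * ‖gradient (u i) X‖ ^ 2) (Metric.ball 0 R) ∧
      ∫ X in Metric.ball 0 R, largestEigenvalue (matrixAlong (a i) (u i) X)
        * ‖gradient (u i) X‖ ^ 2 ≤ C₀ i * R ^ 2) :
    (∀ i, ∀ᵐ X : FibSpace m d, gradY (u i) X ≠ 0 → curv (a i) (u i) X = 0) ∧
    ∀ i j, ∀ᵐ X : FibSpace m d, nlFF F i j (xPart X) (fun k => u k X) *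
      (s i * s j * (rY (u i) X * rY (u j) X)
        - ∑ l : Fin d, pd (Sum.inr l) (u i) X * pd (Sum.inr l) (u j) X) = 0 := by
  obtain ⟨C, hC, hcut⟩ := exists_log_cutoff (m := m) (d := d)
  have hΩ := fun i => isOpen_gradY_ne (hreg i).1
  have hrnn : ∀ i j X, 0 ≤ nlFF F i j (xPart X) (fun k => u k X) *
      (s i * s j * (rY (u i) X * rY (u j) X)
        - ∑ l : Fin d, pd (Sum.inr l) (u i) X * pd (Sum.inr l) (u j) X) := by
    intro i j X
    rcases eq_or_ne i j with rfl | hij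
    -- On the diagonal the Cauchy–Schwarz defect is identically zero, so no sign of F_ii is needed.
    · have : ∑ l : Fin d, pd (Sum.inr l) (u i) X * pd (Sum.inr l) (u i) X = rY (u i) X ^ 2 := by
        rw [rY_sq]; simp_rw [sq]
      rw [hs, this, one_mul, sq, sub_self, mul_zero]
    · have hss : s i * s j * (s i * s j) = 1 := by
        rw [mul_mul_mul_comm, hs, hs, one_mul]
      set D := ∑ l : Fin d, pd (Sum.inr l) (u i) X * pd (Sum.inr l) (u j) X with hD
      have h1 : s i * s j * D ≤ rY (u i) X * rY (u j) X := by
        have h2 : |s i * s j| = 1 := by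
          rcases mul_self_eq_one_iff.mp hss with h | h <;> rw [h] <;> simp
        refine (le_abs_self _).trans ?_
        rw [abs_mul, h2, one_mul]
        exact abs_gradY_dot_le _ _ _
      -- Because (s_i s_j)² = 1, the sign can be factored out; what remains is F_ij s_i s_j ≥ 0
      -- times a nonnegative Cauchy–Schwarz defect.
      have e : nlFF F i j (xPart X) (fun k => u k X) * (s i * s j * (rY (u i) X * rY (u j) X) - D)
          = nlFF F i j (xPart X) (fun k => u k X) * s i * s j *
            (rY (u i) X * rY (u j) X - s i * s j * D) := by
        linear_combination (nlFF F i j (xPart X) (fun k => u k X) * D) * hss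
      rw [e]
      exact mul_nonneg (hsign i j hij X) (sub_nonneg.mpr h1)
  obtain ⟨N₀, hN₀⟩ : ∃ N₀ : ℕ, ∀ j, C₀ j ≤ 2 ^ N₀ := by
    obtain ⟨N₀, hN₀⟩ := pow_unbounded_of_one_lt (∑ j, |C₀ j|) (by norm_num : (1 : ℝ) < 2)
    exact ⟨N₀, fun j => (le_abs_self _).trans ((Finset.single_le_sum (f := fun j => |C₀ j|)
      (fun _ _ => abs_nonneg _) (Finset.mem_univ j)).trans hN₀.le)⟩
  have main : ∀ N : ℕ, N₀ ≤ N →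
      (∀ i, ∀ᵐ X : FibSpace m d, X ∈ Metric.ball (0 : FibSpace m d) (2 ^ N) →
        gradY (u i) X ≠ 0 → curv (a i) (u i) X = 0) ∧
      ∀ i j, ∀ᵐ X : FibSpace m d, X ∈ Metric.ball (0 : FibSpace m d) (2 ^ N) →
        nlFF F i j (xPart X) (fun k => u k X) * (s i * s j * (rY (u i) X * rY (u j) X)
        - ∑ l : Fin d, pd (Sum.inr l) (u i) X * pd (Sum.inr l) (u j) X) = 0 := by
    intro N hN
    choose φ hφT hφ1 hφd using fun k : ℕ => hcut N (k + 1) k.succ_pos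
    have hgrow : ∀ i R, (2 : ℝ) ^ N ≤ R → _ := fun i R hR =>
      hgrowth i R fun j => (hN₀ j).trans ((pow_le_pow_right₀ (by norm_num) hN).trans hR)
    have hbound : ∀ k : ℕ, _ ≤ (∑ i, 2 * (4 * C * C₀ i)) / ((k : ℝ) + 1) := fun k =>
      (geometric_poincare_limit ha hF hreg hsol hst hbdd hpos hs (hφT k)).trans (by
        rw [Finset.sum_div]
        refine Finset.sum_le_sum fun i _ => ?_
        have := integral_quad_cutoff_le (hreg i) (hpos i) hC k.succ_pos (hgrow i) (hφd k)
        rw [mul_div_assoc]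
        push_cast at this
        exact mul_le_mul_of_nonneg_left this (by norm_num))
    have hcnn : ∀ i, ∀ᵐ X ∂(volume.restrict {X | gradY (u i) X ≠ 0}), 0 ≤ curv (a i) (u i) X := by
      intro i
      filter_upwards [ae_restrict_of_ae (hpos i), ae_restrict_mem (hΩ i).measurableSet]
        with X h1 h2 using curv_nonneg (hreg i) h2 h1
    have hc1 : ∀ k i, 0 ≤ ∫ X in {X | gradY (u i) X ≠ 0}, curv (a i) (u i) X * φ k X ^ 2 := by
      intro k i
      refine integral_nonneg_of_ae ?_
      filter_upwards [hcnn i] with X hX using mul_nonneg hX (sq_nonneg _)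
    have hc2 : ∀ k i j, 0 ≤ ∫ X, nlFF F i j (xPart X) (fun k => u k X) *
        ((s i * s j * (rY (u i) X * rY (u j) X)
          - ∑ l : Fin d, pd (Sum.inr l) (u i) X * pd (Sum.inr l) (u j) X) * φ k X ^ 2) := by
      intro k i j
      refine integral_nonneg fun X => ?_
      simp only [Pi.zero_apply]
      rw [← mul_assoc]
      exact mul_nonneg (hrnn i j X) (sq_nonneg _)
    -- All the summands on the left are nonnegative, so each one separately is bounded by the
    -- right-hand side, which is O(1/(k+1)).
    have hS1 := fun k => Finset.sum_nonneg fun i (_ : i ∈ Finset.univ) => hc1 k i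
    have hS2 := fun k => Finset.sum_nonneg fun i (_ : i ∈ Finset.univ) =>
      Finset.sum_nonneg fun j (_ : j ∈ Finset.univ) => hc2 k i j
    constructor
    · intro i
      have := ae_eq_zero_of_integral_cutoff_le (C := ∑ i, 2 * (4 * C * C₀ i)) (hcnn i) hφ1
        (fun k => ?_) (fun k => ?_)
      · filter_upwards [(ae_restrict_iff' (hΩ i).measurableSet).mp this] with X h1 h2 h3
          using h1 h3 h2
      · obtain ⟨B, hB⟩ := (hφT k).compact.exists_bound_of_continuous (hφT k).contDiff.continuous
        obtain ⟨R, hR⟩ := (hφT k).compact.isCompact.isBounded.subset_ball 0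
        refine integrableOn_mul_sq (R := max R 1) (hΩ i).measurableSet
          (integrableOn_curv (hreg i) (hbdd i) (by positivity)) (hφT k).contDiff.continuous hB
          fun X hX => image_eq_zero_of_notMem_tsupport fun h' => hX ?_
        exact Metric.ball_subset_ball (le_max_left _ _) (hR h')
      · have h1 := Finset.single_le_sum (f := fun i => ∫ X in {X | gradY (u i) X ≠ 0},
          curv (a i) (u i) X * φ k X ^ 2) (fun i _ => hc1 k i) (Finset.mem_univ i)
        linarith [hbound k, hS2 k]
    · intro i j
      refine ae_eq_zero_of_integral_cutoff_le (C := ∑ i, 2 * (4 * C * C₀ i))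
        (Eventually.of_forall (hrnn i j)) hφ1 (fun k => ?_) (fun k => ?_)
      · simp_rw [mul_assoc (nlFF F i j _ _)]
        have c1 := continuous_rY (hreg i).1
        have c2 := continuous_rY (hreg j).1
        have c3 : Continuous fun X => ∑ l : Fin d, pd (Sum.inr l) (u i) X * pd (Sum.inr l) (u j) X :=
          continuous_finsetSum _ fun l _ =>
            (continuous_pd (hreg i).1 _).mul (continuous_pd (hreg j).1 _)
        have hcs : HasCompactSupport fun X => φ k X ^ 2 := by
          simp_rw [sq]; exact (hφT k).compact.mul_left
        have c4 : Continuous fun X => s i * s j * (rY (u i) X * rY (u j) X)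
            - ∑ l : Fin d, pd (Sum.inr l) (u i) X * pd (Sum.inr l) (u j) X :=
          (continuous_const.mul (c1.mul c2)).sub c3
        exact integrable_mul_of_tsupport (hst.2.1 i j)
          (c4.mul ((hφT k).contDiff.continuous.pow 2))
          (HasCompactSupport.mul_left (f := fun X => s i * s j * (rY (u i) X * rY (u j) X)
            - ∑ l : Fin d, pd (Sum.inr l) (u i) X * pd (Sum.inr l) (u j) X) hcs)
      · simp_rw [mul_assoc (nlFF F i j _ _)]
        have h1 := Finset.single_le_sum (f := fun j => ∫ X, nlFF F i j (xPart X) (fun k => u k X) *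
          ((s i * s j * (rY (u i) X * rY (u j) X)
          - ∑ l : Fin d, pd (Sum.inr l) (u i) X * pd (Sum.inr l) (u j) X) * φ k X ^ 2))
          (fun j _ => hc2 k i j) (Finset.mem_univ j)
        have h2 := Finset.single_le_sum (f := fun i => ∑ j, ∫ X, nlFF F i j (xPart X)
          (fun k => u k X) * ((s i * s j * (rY (u i) X * rY (u j) X)
          - ∑ l : Fin d, pd (Sum.inr l) (u i) X * pd (Sum.inr l) (u j) X) * φ k X ^ 2))
          (fun i _ => Finset.sum_nonneg fun j _ => hc2 k i j) (Finset.mem_univ i)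
        linarith [hbound k, hS1 k]
  have hball : ∀ X : FibSpace m d, ∃ N, N₀ ≤ N ∧ X ∈ Metric.ball (0 : FibSpace m d) (2 ^ N) := by
    intro X
    obtain ⟨N, hN⟩ := pow_unbounded_of_one_lt ‖X‖ (by norm_num : (1 : ℝ) < 2)
    refine ⟨max N N₀, le_max_right _ _, ?_⟩
    rw [mem_ball_zero_iff]
    exact hN.trans_le (pow_le_pow_right₀ (by norm_num) (le_max_left _ _))
  constructor
  · intro i
    have := ae_all_iff.mpr fun N : ℕ => ae_all_iff.mpr fun hN : N₀ ≤ N => (main N hN).1 i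
    filter_upwards [this] with X hX
    obtain ⟨N, hN, hXN⟩ := hball X
    exact hX N hN hXN
  · intro i j
    have := ae_all_iff.mpr fun N : ℕ => ae_all_iff.mpr fun hN : N₀ ≤ N => (main N hN).2 i j
    filter_upwards [this] with X hX
    obtain ⟨N, hN, hXN⟩ := hball X
    exact hX N hN hXN

end Conclusion

/-! ### Functions on one fibre whose gradient has locally constant direction. -/

section Slices

open Set Filter Topology

variable {E : Type*} [NormedAddCommGroup E] [InnerProductSpace ℝ E]

/-- Take the part of q orthogonal to p. Lines in this direction stay in a hyperplane orthogonal to p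
and cross every hyperplane orthogonal to q. -/
theorem exists_orthogonal_part {p q : E} (hp : p ≠ 0) (h : ¬ ∃ c : ℝ, q = c • p) :
    ∃ w : E, inner ℝ p w = 0 ∧ inner ℝ q w ≠ 0 := by
  refine ⟨q - (inner ℝ p q / inner ℝ p p) • p, ?_, ?_⟩
  · rw [inner_sub_right, inner_smul_right, div_mul_cancel₀ _ (inner_self_ne_zero.mpr hp), sub_self]
  · set w := q - (inner ℝ p q / inner ℝ p p) • p with hw
    have hpw : inner ℝ p w = 0 := by
      rw [hw, inner_sub_right, inner_smul_right, div_mul_cancel₀ _ (inner_self_ne_zero.mpr hp),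
        sub_self]
    have hq : q = w + (inner ℝ p q / inner ℝ p p) • p := by rw [hw]; abel
    have hne : w ≠ 0 := fun h0 => h ⟨_, by rw [hq, h0, zero_add]⟩
    have : inner ℝ q w = inner ℝ w w := by
      conv_lhs => rw [hq]
      rw [inner_add_left, inner_smul_left, hpw, mul_zero, add_zero]
    rw [this]
    exact inner_self_ne_zero.mpr hne

variable [CompleteSpace E]

/-- The gradient of `g` has locally constant direction. -/
def HasLocallyConstDir (g : E → ℝ) : Prop :=
  ∀ y, gradient g y ≠ 0 → ∀ᶠ z in 𝓝 y, ∃ c : ℝ, gradient g z = c • gradient g y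

theorem hasDerivAt_line {g : E → ℝ} (hg : ContDiff ℝ 1 g) (y w : E) (t : ℝ) :
    HasDerivAt (fun t : ℝ => g (y + t • w)) (inner ℝ (gradient g (y + t • w)) w) t := by
  have h1 : HasDerivAt (fun t : ℝ => y + t • w) w t := by
    simpa using ((hasDerivAt_id t).smul_const w).const_add y
  have h2 := (hg.differentiable one_ne_zero (y + t • w)).hasFDerivAt.comp_hasDerivAt t h1
  refine h2.congr_deriv ?_
  rw [gradient, InnerProductSpace.toDual_symm_apply]

theorem continuous_gradient_of_contDiff {g : E → ℝ} (hg : ContDiff ℝ 1 g) :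
    Continuous (gradient g) := by
  unfold gradient
  exact (LinearIsometryEquiv.continuous _).comp (hg.continuous_fderiv one_ne_zero)

theorem eq_of_inner_gradient_eq_zero {g : E → ℝ} (hg : ContDiff ℝ 1 g) {y w : E}
    (h : ∀ t ∈ Icc (0 : ℝ) 1, inner ℝ (gradient g (y + t • w)) w = 0) : g (y + w) = g y := by
  have h1 : ∀ t ∈ Icc (0 : ℝ) 1, (fun t : ℝ => g (y + t • w)) t = (fun t : ℝ => g (y + t • w)) 0 := by
    refine constant_of_has_deriv_right_zero
      (fun t _ => (hasDerivAt_line hg y w t).continuousAt.continuousWithinAt) fun t ht => ?_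
    have := (hasDerivAt_line hg y w t).hasDerivWithinAt (s := Ici t)
    rwa [h t ⟨ht.1, ht.2.le⟩] at this
  simpa using h1 1 (by simp)

/-- The gradient is constant along the hyperplanes orthogonal to it. -/
theorem HasLocallyConstDir.gradient_add {g : E → ℝ} (hg : ContDiff ℝ 1 g)
    (hdir : HasLocallyConstDir g) {y w : E} (hy : gradient g y ≠ 0)
    (hw : inner ℝ (gradient g y) w = 0) : gradient g (y + w) = gradient g y := by
  have hcont : Continuous fun t : ℝ => gradient g (y + t • w) :=
    (continuous_gradient_of_contDiff hg).comp (by fun_prop)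
  -- Closed by continuity. Open because near y + t•w all gradients are multiples of ∇g(y), so g is
  -- invariant under short translations δ orthogonal to it, and hence so is its gradient. Second
  -- derivatives of g are not needed.
  have hclopen : IsClopen {t : ℝ | gradient g (y + t • w) = gradient g y} := by
    refine ⟨isClosed_eq hcont continuous_const, ?_⟩
    rw [isOpen_iff_mem_nhds]
    intro t ht
    rw [mem_ofPred_eq] at ht
    obtain ⟨ε, hε, hball⟩ := Metric.eventually_nhds_iff.mp (hdir (y + t • w) (by rwa [ht]))
    have hlim : Tendsto (fun s : ℝ => ‖(s - t) • w‖) (𝓝 t) (𝓝 0) := by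
      have : Continuous fun s : ℝ => ‖(s - t) • w‖ := by fun_prop
      simpa using this.tendsto t
    filter_upwards [hlim.eventually (gt_mem_nhds (half_pos hε))] with s hs
    set δ := (s - t) • w with hδ
    have hδw : inner ℝ (gradient g y) δ = 0 := by rw [hδ, inner_smul_right, hw, mul_zero]
    have hev : (fun z => g (z + δ)) =ᶠ[𝓝 (y + t • w)] g := by
      filter_upwards [Metric.ball_mem_nhds (y + t • w) (half_pos hε)] with z hz
      refine eq_of_inner_gradient_eq_zero hg fun τ hτ => ?_
      have hd : dist (z + τ • δ) (y + t • w) < ε := by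
        have h1 : dist (z + τ • δ) z ≤ ‖δ‖ := by
          rw [dist_eq_norm, add_sub_cancel_left, norm_smul, Real.norm_of_nonneg hτ.1]
          exact mul_le_of_le_one_left (norm_nonneg _) hτ.2
        have h2 := dist_triangle (z + τ • δ) z (y + t • w)
        rw [Metric.mem_ball] at hz
        linarith
      obtain ⟨c, hc⟩ := hball hd
      rw [hc, ht, inner_smul_left, hδw, mul_zero]
    have e1 : gradient g (y + t • w + δ) = gradient g (y + t • w) := by
      have h3 : fderiv ℝ (fun z => g (z + δ)) (y + t • w) = fderiv ℝ g (y + t • w) := hev.fderiv_eq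
      rw [fderiv_comp_add_right] at h3
      rw [gradient, gradient, h3]
    have e2 : y + t • w + δ = y + s • w := by rw [hδ, sub_smul]; abel
    rw [← e2, e1, ht]
  have huniv := hclopen.eq_univ ⟨0, by simp⟩
  have : (1 : ℝ) ∈ {t : ℝ | gradient g (y + t • w) = gradient g y} := by rw [huniv]; trivial
  simpa using this

/-- All the gradients are parallel. -/
theorem HasLocallyConstDir.parallel {g : E → ℝ} (hg : ContDiff ℝ 1 g)
    (hdir : HasLocallyConstDir g) {y z : E} (hy : gradient g y ≠ 0) (hz : gradient g z ≠ 0) :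
    ∃ c : ℝ, gradient g z = c • gradient g y := by
  by_contra h
  obtain ⟨w, hw1, hw2⟩ := exists_orthogonal_part hy h
  -- If two gradients were not parallel, their orthogonal hyperplanes through y and z would meet; τ
  -- is chosen so that y + τ•w lies on both, where the gradient would take both values.
  set τ := inner ℝ (gradient g z) (z - y) / inner ℝ (gradient g z) w with hτ
  have h1 := hdir.gradient_add hg hy (w := τ • w) (by rw [inner_smul_right, hw1, mul_zero])
  have h2 := hdir.gradient_add hg hz (w := y + τ • w - z) (by
    have : y + τ • w - z = τ • w - (z - y) := by abel
    rw [this, inner_sub_right, inner_smul_right, hτ, div_mul_cancel₀ _ hw2, sub_self])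
  rw [add_sub_cancel, h1] at h2
  exact h ⟨1, by rw [h2, one_smul]⟩

/-- A function whose gradients are multiples of `e` depends only on the coordinate along `e`. -/
theorem eq_comp_inner_of_gradient {g : E → ℝ} (hg : ContDiff ℝ 1 g) {e : E} (he : ‖e‖ = 1)
    (h : ∀ y, ∃ c : ℝ, gradient g y = c • e) (y : E) : g y = g ((inner ℝ e y : ℝ) • e) := by
  have h1 : inner ℝ e (y - (inner ℝ e y : ℝ) • e) = 0 := by
    rw [inner_sub_right, inner_smul_right, real_inner_self_eq_norm_sq, he]; ring
  have := eq_of_inner_gradient_eq_zero hg (y := (inner ℝ e y : ℝ) • e)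
    (w := y - (inner ℝ e y : ℝ) • e) fun t _ => by
      obtain ⟨c, hc⟩ := h ((inner ℝ e y : ℝ) • e + t • (y - (inner ℝ e y : ℝ) • e))
      rw [hc, inner_smul_left, h1, mul_zero]
  rwa [add_sub_cancel] at this

/-- Along a line through `V` on which some function varies, some function varies inside `V`. -/
theorem exists_mem_inner_gradient_ne_zero {κ : Type*} [Finite κ] {g : κ → E → ℝ}
    (hg : ∀ k, ContDiff ℝ 1 (g k)) {I : κ → Set ℝ} (hI : ∀ k, IsOpen (I k)) {y w : E}
    (hy : ∀ k, g k y ∈ I k) (h : ∃ (t : ℝ) (k : κ), inner ℝ (gradient (g k) (y + t • w)) w ≠ 0) :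
    ∃ t : ℝ, (∀ k, g k (y + t • w) ∈ I k) ∧
      ∃ k, inner ℝ (gradient (g k) (y + t • w)) w ≠ 0 := by
  by_contra! hcon
  -- If nothing varies while the values stay in the box, then a point with the initial values has a
  -- neighbourhood with the initial values, so all the functions are constant on the entire line.
  have hclopen : IsClopen {t : ℝ | ∀ k, g k (y + t • w) = g k y} := by
    have hc : ∀ k, Continuous fun t : ℝ => g k (y + t • w) := fun k =>
      (hg k).continuous.comp (by fun_prop)
    refine ⟨?_, ?_⟩
    · simp only [ofPred_forall]
      exact isClosed_iInter fun k => isClosed_eq (hc k) continuous_const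
    rw [isOpen_iff_mem_nhds]
    intro t ht
    have hV : ∀ᶠ s in 𝓝 t, ∀ k, g k (y + s • w) ∈ I k :=
      eventually_all.mpr fun k => (hc k).continuousAt.eventually_mem
        ((hI k).mem_nhds (by rw [ht k]; exact hy k))
    obtain ⟨ε, hε, hball⟩ := Metric.eventually_nhds_iff_ball.mp hV
    filter_upwards [Metric.ball_mem_nhds t hε] with s hs k
    rw [← ht k]
    refine IsOpen.is_const_of_deriv_eq_zero Metric.isOpen_ball (convex_ball t ε).isPreconnected
      (f := fun s : ℝ => g k (y + s • w))
      (fun r _ => (hasDerivAt_line (hg k) y w r).differentiableAt.differentiableWithinAt)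
      (fun r hr => ?_) hs (Metric.mem_ball_self hε)
    rw [(hasDerivAt_line (hg k) y w r).deriv]
    exact hcon r (hball r hr) k
  have huniv := hclopen.eq_univ ⟨0, by simp⟩
  obtain ⟨t, k, htk⟩ := h
  refine htk ?_
  have hconst : (fun t : ℝ => g k (y + t • w)) = fun _ => g k y := by
    funext s
    have : s ∈ {t : ℝ | ∀ k, g k (y + t • w) = g k y} := by rw [huniv]; trivial
    exact this k
  have h1 := hasDerivAt_line (hg k) y w t
  rw [hconst] at h1
  exact h1.unique (hasDerivAt_const t _)

/-- If the gradients are parallel on a nonempty set `{g ∈ I}`, then they are parallel. -/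
theorem parallel_of_parallel_on_box {κ : Type*} [Finite κ] {g : κ → E → ℝ}
    (hg : ∀ k, ContDiff ℝ 1 (g k)) (hdir : ∀ k, HasLocallyConstDir (g k)) {I : κ → Set ℝ}
    (hI : ∀ k, IsOpen (I k)) (hne : ∃ y, ∀ k, g k y ∈ I k)
    (hpar : ∀ y, (∀ k, g k y ∈ I k) → ∀ i j, gradient (g i) y ≠ 0 →
      ∃ c : ℝ, gradient (g j) y = c • gradient (g i) y)
    {i j : κ} {y z : E} (hy : gradient (g i) y ≠ 0) (hz : gradient (g j) z ≠ 0) :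
    ∃ c : ℝ, gradient (g j) z = c • gradient (g i) y := by
  -- A base point in the box with a nonzero gradient: walk from the given box point to y. Either
  -- some function varies on the way, and then some function varies within the box, or none does and
  -- y is itself in the box.
  obtain ⟨y₂, hy₂, k, hk⟩ : ∃ y₂, (∀ k, g k y₂ ∈ I k) ∧ ∃ k, gradient (g k) y₂ ≠ 0 := by
    obtain ⟨y₀, hy₀⟩ := hne
    by_cases h : ∃ (t : ℝ) (k : κ), inner ℝ (gradient (g k) (y₀ + t • (y - y₀))) (y - y₀) ≠ 0
    · obtain ⟨t, ht, k, hk⟩ := exists_mem_inner_gradient_ne_zero hg hI hy₀ h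
      exact ⟨_, ht, k, fun h0 => hk (by rw [h0, inner_zero_left])⟩
    · push Not at h
      refine ⟨y, fun k => ?_, i, hy⟩
      have := eq_of_inner_gradient_eq_zero (hg k) (y := y₀) (w := y - y₀) fun t _ => h t k
      rw [add_sub_cancel] at this
      rw [this]; exact hy₀ k
  -- Suppose ∇g_j(z) is not parallel to p = ∇g_k(y₂), and move from y₂ along w ⟂ p. The gradient of
  -- g_k remains p, while the line reaches the hyperplane through z where ∇g_j has a component along
  -- w. So some g_q varies along w inside the box, where its gradient must be a multiple of p ⟂ w.
  have key : ∀ j z, gradient (g j) z ≠ 0 → ∃ c : ℝ, gradient (g j) z = c • gradient (g k) y₂ := by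
    intro j z hz
    by_contra h
    obtain ⟨w, hw1, hw2⟩ := exists_orthogonal_part hk h
    have hex : ∃ (t : ℝ) (k : κ), inner ℝ (gradient (g k) (y₂ + t • w)) w ≠ 0 := by
      refine ⟨inner ℝ (gradient (g j) z) (z - y₂) / inner ℝ (gradient (g j) z) w, j, ?_⟩
      set τ := inner ℝ (gradient (g j) z) (z - y₂) / inner ℝ (gradient (g j) z) w with hτ
      have h2 := (hdir j).gradient_add (hg j) hz (w := y₂ + τ • w - z) (by
        have : y₂ + τ • w - z = τ • w - (z - y₂) := by abel
        rw [this, inner_sub_right, inner_smul_right, hτ, div_mul_cancel₀ _ hw2, sub_self])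
      rw [add_sub_cancel] at h2
      rw [h2]; exact hw2
    obtain ⟨t, ht, q, hq⟩ := exists_mem_inner_gradient_ne_zero hg hI hy₂ hex
    have h1 := (hdir k).gradient_add (hg k) hk (w := t • w) (by rw [inner_smul_right, hw1, mul_zero])
    obtain ⟨c, hc⟩ := hpar _ ht k q (by rw [h1]; exact hk)
    exact hq (by rw [hc, h1, inner_smul_left, hw1, mul_zero])
  obtain ⟨c, hc⟩ := key i y hy
  obtain ⟨c', hc'⟩ := key j z hz
  have hc0 : c ≠ 0 := fun h => hy (by rw [hc, h, zero_smul])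
  exact ⟨c' / c, by rw [hc', hc, smul_smul, div_mul_cancel₀ _ hc0]⟩

end Slices

/-! ### The direction of ∇_y v is locally constant; restriction to fibres. -/

section Directions

open Set Filter Topology

variable {m d n : ℕ}

/-- The direction of the fibre gradient. -/
def dirY (v : FibSpace m d → ℝ) (X : FibSpace m d) : EuclideanSpace ℝ (Fin d) :=
  (rY v X)⁻¹ • gradY v X

theorem gradY_eq_smul_dirY {v : FibSpace m d → ℝ} {X : FibSpace m d} (hX : gradY v X ≠ 0) :
    gradY v X = rY v X • dirY v X := by
  rw [dirY, smul_smul, mul_inv_cancel₀ ((rY_pos_iff v X).mpr hX).ne', one_smul]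

theorem norm_dirY {v : FibSpace m d → ℝ} {X : FibSpace m d} (hX : gradY v X ≠ 0) :
    ‖dirY v X‖ = 1 := by
  have hr := (rY_pos_iff v X).mpr hX
  rw [dirY, norm_smul, norm_gradY, Real.norm_of_nonneg (inv_nonneg.mpr hr.le),
    inv_mul_cancel₀ hr.ne']

/-- The rows of the Hessian are proportional at every point of `{∇_y v ≠ 0}`. -/
theorem pd_pd_eq_on {a : EuclideanSpace ℝ (Fin m) → ℝ → ℝ} {v : FibSpace m d → ℝ}
    (hv : IsRegularSol v) (hpos : ∀ᵐ X : FibSpace m d, (matrixAlong a v X).PosDef)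
    (h0 : ∀ᵐ X : FibSpace m d, gradY v X ≠ 0 → curv a v X = 0) {X : FibSpace m d}
    (hX : gradY v X ≠ 0) (l : Fin d) (q : Fin m ⊕ Fin d) :
    pd q (pd (Sum.inr l) v) X = pd (Sum.inr l) v X / rY v X * pd q (rY v) X := by
  have hΩ := isOpen_gradY_ne hv.1
  refine Measure.eqOn_open_of_ae_eq (μ := volume) (U := {X | gradY v X ≠ 0})
    (f := pd q (pd (Sum.inr l) v)) (g := fun X => pd (Sum.inr l) v X / rY v X * pd q (rY v) X)
    ?_ hΩ ?_ ?_ hX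
  · rw [Filter.EventuallyEq, ae_restrict_iff' hΩ.measurableSet]
    filter_upwards [hpos, h0] with Y h1 h2 hY
    exact pd_pd_eq_of_curv_eq_zero hv hY h1 (h2 hY) l q
  · exact continuousOn_pd hΩ (contDiffOn_pd_gradY hv _) q
  · exact (((continuous_pd hv.1 _).continuousOn).div (continuous_rY hv.1).continuousOn
      fun Y hY => ((rY_pos_iff v Y).mpr hY).ne').mul (continuousOn_pd hΩ (contDiffOn_rY hv) q)

/-- The direction of the fibre gradient is constant on connected sets. -/
theorem dirY_eq_of_isPreconnected {a : EuclideanSpace ℝ (Fin m) → ℝ → ℝ} {v : FibSpace m d → ℝ}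
    (hv : IsRegularSol v) (hpos : ∀ᵐ X : FibSpace m d, (matrixAlong a v X).PosDef)
    (h0 : ∀ᵐ X : FibSpace m d, gradY v X ≠ 0 → curv a v X = 0) {S : Set (FibSpace m d)}
    (hSo : IsOpen S) (hS : IsPreconnected S) (hsub : S ⊆ {X | gradY v X ≠ 0})
    {X Y : FibSpace m d} (hX : X ∈ S) (hY : Y ∈ S) : dirY v X = dirY v Y := by
  have hΩ := isOpen_gradY_ne hv.1
  ext l
  have hd1 : ∀ Z ∈ S, DifferentiableAt ℝ (pd (Sum.inr l) v) Z := fun Z hZ =>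
    ((contDiffOn_pd_gradY hv _).contDiffAt (hΩ.mem_nhds (hsub hZ))).differentiableAt one_ne_zero
  have hd2 : ∀ Z ∈ S, DifferentiableAt ℝ (rY v) Z := fun Z hZ =>
    ((contDiffOn_rY hv).contDiffAt (hΩ.mem_nhds (hsub hZ))).differentiableAt one_ne_zero
  have hr : ∀ Z ∈ S, rY v Z ≠ 0 := fun Z hZ => ((rY_pos_iff v Z).mpr (hsub hZ)).ne'
  have hd3 : ∀ Z ∈ S, DifferentiableAt ℝ (fun Z => (rY v Z)⁻¹) Z := fun Z hZ =>
    (hd2 Z hZ).inv (hr Z hZ)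
  have hconst := hSo.is_const_of_fderiv_eq_zero (𝕜 := ℝ) hS
    (f := fun Z => pd (Sum.inr l) v Z * (rY v Z)⁻¹)
    (fun Z hZ => ((hd1 Z hZ).mul (hd3 Z hZ)).differentiableWithinAt)
    (fun Z hZ => ?_) hX hY
  · simpa [dirY, gradY_coord, mul_comm] using hconst
  -- The quotient rule gives ∂_q(∂_{y_l}v / r) = (∂_q∂_{y_l}v − (∂_{y_l}v / r) ∂_q r)/r, which is
  -- zero by proportionality of the Hessian rows.
  · have hpd : ∀ q, pd q (fun Z => pd (Sum.inr l) v Z * (rY v Z)⁻¹) Z = 0 := by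
      intro q
      rw [pd_mul (hd1 Z hZ) (hd3 Z hZ), pd_comp (h := fun t => t⁻¹) (differentiableAt_inv (hr Z hZ))
        (hd2 Z hZ), deriv_inv, pd_pd_eq_on hv hpos h0 (hsub hZ) l q]
      have := hr Z hZ
      field_simp
      ring
    refine ContinuousLinearMap.coe_injective ((EuclideanSpace.basisFun _ ℝ).toBasis.ext fun q => ?_)
    simpa [pd] using hpd q

theorem xPart_pairXY (x : EuclideanSpace ℝ (Fin m)) (y : EuclideanSpace ℝ (Fin d)) :
    xPart (pairXY x y) = x := by ext; simp [xPart, pairXY]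

theorem pairXY_xPart_yPart (X : FibSpace m d) : pairXY (xPart X) (yPart X) = X := by
  ext k; rcases k with k | k <;> simp [xPart, yPart, pairXY]

theorem continuous_pairXY : Continuous fun p : EuclideanSpace ℝ (Fin m) × EuclideanSpace ℝ (Fin d) =>
    pairXY p.1 p.2 := by
  refine (PiLp.continuous_toLp 2 _).comp (continuous_pi fun k => ?_)
  rcases k with k | k <;> simp only [Sum.elim_inl, Sum.elim_inr] <;> fun_prop

/-- The embedding of the fibre. -/
def fibreEmb : EuclideanSpace ℝ (Fin d) →L[ℝ] FibSpace m d :=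
  LinearMap.toContinuousLinearMap
    { toFun := fun y => pairXY 0 y
      map_add' := fun y z => by ext k; rcases k with k | k <;> simp [pairXY]
      map_smul' := fun c y => by ext k; rcases k with k | k <;> simp [pairXY] }

theorem fibreEmb_apply (y : EuclideanSpace ℝ (Fin d)) : fibreEmb (m := m) y = pairXY 0 y := rfl

theorem pairXY_eq_add (x : EuclideanSpace ℝ (Fin m)) (y : EuclideanSpace ℝ (Fin d)) :
    pairXY x y = pairXY x 0 + fibreEmb y := by
  rw [fibreEmb_apply]
  ext k; rcases k with k | k <;> simp [pairXY]

theorem contDiff_slice {v : FibSpace m d → ℝ} (hv : ContDiff ℝ 1 v) (x : EuclideanSpace ℝ (Fin m)) :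
    ContDiff ℝ 1 fun y => v (pairXY x y) := by
  rw [show (fun y => v (pairXY x y)) = fun y => v (pairXY x 0 + fibreEmb y) from
    funext fun y => by rw [← pairXY_eq_add]]
  exact hv.comp (contDiff_const.add fibreEmb.contDiff)

theorem gradient_slice {v : FibSpace m d → ℝ} (hv : ContDiff ℝ 1 v)
    (x : EuclideanSpace ℝ (Fin m)) (y : EuclideanSpace ℝ (Fin d)) :
    gradient (fun y => v (pairXY x y)) y = gradY v (pairXY x y) := by
  ext l
  rw [gradient_coord, gradY_coord, pd, pd]
  have h1 : HasFDerivAt (fun y => v (pairXY x y)) ((fderiv ℝ v (pairXY x y)).comp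
      (fibreEmb (m := m) (d := d))) y := by
    have h2 : HasFDerivAt (fun y : EuclideanSpace ℝ (Fin d) => pairXY x y)
        (fibreEmb (m := m) (d := d)) y := by
      rw [show (fun y => pairXY x y) = fun y => pairXY x 0 + fibreEmb (m := m) (d := d) y from
        funext fun y => pairXY_eq_add x y]
      exact fibreEmb.hasFDerivAt.const_add _
    exact (hv.differentiable one_ne_zero _).hasFDerivAt.comp y h2
  rw [h1.fderiv]
  have : fibreEmb (m := m) (EuclideanSpace.single l (1 : ℝ)) = EuclideanSpace.single (Sum.inr l) 1 := by
    rw [fibreEmb_apply]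
    ext k; rcases k with k | k <;> simp [pairXY, PiLp.single_apply]
  rw [ContinuousLinearMap.comp_apply, this]

/-- Almost every slice inherits an almost everywhere property. -/
theorem ae_ae_pairXY {P : FibSpace m d → Prop} (h : ∀ᵐ X : FibSpace m d, P X) :
    ∀ᵐ x : EuclideanSpace ℝ (Fin m), ∀ᵐ y : EuclideanSpace ℝ (Fin d), P (pairXY x y) := by
  have h1 : MeasurePreserving
      (fun p : EuclideanSpace ℝ (Fin m) × EuclideanSpace ℝ (Fin d) => pairXY p.1 p.2)
      (volume.prod volume) volume := by
    have e1 : MeasurePreserving (Prod.map (WithLp.ofLp : EuclideanSpace ℝ (Fin m) → _)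
        (WithLp.ofLp : EuclideanSpace ℝ (Fin d) → _)) (volume.prod volume) (volume.prod volume) :=
      (PiLp.volume_preserving_ofLp (Fin m)).prod (PiLp.volume_preserving_ofLp (Fin d))
    have e2 := volume_measurePreserving_sumPiEquivProdPi_symm (ι := Fin m) (ι' := Fin d) fun _ => ℝ
    have e3 := (PiLp.volume_preserving_toLp (Fin m ⊕ Fin d))
    have e4 := e3.comp (e2.comp e1)
    have e5 : (fun p : EuclideanSpace ℝ (Fin m) × EuclideanSpace ℝ (Fin d) => pairXY p.1 p.2)
        = WithLp.toLp 2 ∘ (MeasurableEquiv.sumPiEquivProdPi fun _ : Fin m ⊕ Fin d => ℝ).symm ∘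
          Prod.map WithLp.ofLp WithLp.ofLp := by
      funext p
      ext k
      rcases k with k | k <;> rfl
    rw [e5]
    exact e4
  exact Measure.ae_ae_of_ae_prod (h1.quasiMeasurePreserving.ae h)

end Directions

/-! ### One common direction on every fibre. -/

section Symmetry

open Set Filter Topology

variable {m d n : ℕ}

theorem inner_gradY (v w : FibSpace m d → ℝ) (X : FibSpace m d) :
    inner ℝ (gradY v X) (gradY w X) = ∑ l : Fin d, pd (Sum.inr l) v X * pd (Sum.inr l) w X := by
  rw [PiLp.inner_apply]
  refine Finset.sum_congr rfl fun l _ => ?_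
  simp [gradY_coord, mul_comm]

/-- The equality case of Cauchy–Schwarz. -/
theorem gradY_parallel_of_dot_eq {v w : FibSpace m d → ℝ} {X : FibSpace m d} {c : ℝ}
    (hc : |c| = 1) (h : c * (rY v X * rY w X)
      = ∑ l : Fin d, pd (Sum.inr l) v X * pd (Sum.inr l) w X) (hX : gradY v X ≠ 0) :
    ∃ c : ℝ, gradY w X = c • gradY v X := by
  by_cases hw : gradY w X = 0
  · exact ⟨0, by rw [hw, zero_smul]⟩
  · have h1 : ‖inner ℝ (gradY v X) (gradY w X)‖ = ‖gradY v X‖ * ‖gradY w X‖ := by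
      rw [inner_gradY, ← h, norm_mul, Real.norm_eq_abs, hc, one_mul, norm_gradY, norm_gradY,
        Real.norm_of_nonneg (mul_nonneg (rY_nonneg _ _) (rY_nonneg _ _))]
    obtain ⟨r, _, hr⟩ := (norm_inner_eq_norm_iff hX hw).mp h1
    exact ⟨r, hr⟩

theorem eventually_dirY_eq {a : EuclideanSpace ℝ (Fin m) → ℝ → ℝ} {v : FibSpace m d → ℝ}
    (hv : IsRegularSol v) (hpos : ∀ᵐ X : FibSpace m d, (matrixAlong a v X).PosDef)
    (h0 : ∀ᵐ X : FibSpace m d, gradY v X ≠ 0 → curv a v X = 0)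
    {X : FibSpace m d} (hX : gradY v X ≠ 0) :
    ∀ᶠ Z in 𝓝 X, gradY v Z ≠ 0 ∧ dirY v Z = dirY v X := by
  obtain ⟨ε, hε, hball⟩ := Metric.isOpen_iff.mp (isOpen_gradY_ne hv.1) X hX
  filter_upwards [Metric.ball_mem_nhds X hε] with Z hZ
  exact ⟨hball hZ, dirY_eq_of_isPreconnected hv hpos h0 Metric.isOpen_ball
    (convex_ball X ε).isPreconnected hball hZ (Metric.mem_ball_self hε)⟩

theorem hasLocallyConstDir_slice {a : EuclideanSpace ℝ (Fin m) → ℝ → ℝ} {v : FibSpace m d → ℝ}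
    (hv : IsRegularSol v) (hpos : ∀ᵐ X : FibSpace m d, (matrixAlong a v X).PosDef)
    (h0 : ∀ᵐ X : FibSpace m d, gradY v X ≠ 0 → curv a v X = 0) (x : EuclideanSpace ℝ (Fin m)) :
    HasLocallyConstDir fun y => v (pairXY x y) := by
  intro y hy
  simp_rw [gradient_slice hv.1] at hy ⊢
  have hc : Continuous fun z : EuclideanSpace ℝ (Fin d) => pairXY x z :=
    continuous_pairXY.comp (continuous_const.prodMk continuous_id)
  filter_upwards [hc.continuousAt.eventually (eventually_dirY_eq hv hpos h0 hy)] with z hz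
  refine ⟨rY v (pairXY x z) / rY v (pairXY x y), ?_⟩
  rw [gradY_eq_smul_dirY hz.1, hz.2, dirY, smul_smul, div_eq_mul_inv]

/-- On almost every fibre, all the fibre gradients are parallel. -/
theorem ae_parallel {a : Fin n → EuclideanSpace ℝ (Fin m) → ℝ → ℝ}
    {F : EuclideanSpace ℝ (Fin m) → (Fin n → ℝ) → ℝ} {u : Fin n → FibSpace m d → ℝ}
    (hreg : ∀ i, IsRegularSol (u i))
    (hpos : ∀ i, ∀ᵐ X : FibSpace m d, (matrixAlong (a i) (u i) X).PosDef)
    (h0 : ∀ i, ∀ᵐ X : FibSpace m d, gradY (u i) X ≠ 0 → curv (a i) (u i) X = 0)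
    {s : Fin n → ℝ} (hs : ∀ i, s i * s i = 1)
    (hreact : ∀ i j, ∀ᵐ X : FibSpace m d, nlFF F i j (xPart X) (fun k => u k X) *
      (s i * s j * (rY (u i) X * rY (u j) X)
        - ∑ l : Fin d, pd (Sum.inr l) (u i) X * pd (Sum.inr l) (u j) X) = 0)
    (hbox : ∀ x : EuclideanSpace ℝ (Fin m), ∃ I : Fin n → Set ℝ,
      (∀ i, IsOpen (I i) ∧ (I i).OrdConnected) ∧
      (∃ y : EuclideanSpace ℝ (Fin d), ∀ i, u i (pairXY x y) ∈ I i) ∧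
      ∀ k j, j ≠ k →
        (∀ ξ : Fin n → ℝ, (∀ i, ξ i ∈ I i) → 0 < nlFF F k j x ξ) ∨
        (∀ ξ : Fin n → ℝ, (∀ i, ξ i ∈ I i) → nlFF F k j x ξ < 0)) :
    ∀ᵐ x : EuclideanSpace ℝ (Fin m), ∀ i j y z, gradY (u i) (pairXY x y) ≠ 0 →
      gradY (u j) (pairXY x z) ≠ 0 →
      ∃ c : ℝ, gradY (u j) (pairXY x z) = c • gradY (u i) (pairXY x y) := by
  filter_upwards [ae_ae_pairXY (ae_all_iff.mpr fun i => ae_all_iff.mpr fun j => hreact i j)]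
    with x hx
  obtain ⟨I, hI, hne, hsign⟩ := hbox x
  have hsl : Continuous fun y : EuclideanSpace ℝ (Fin d) => pairXY x y :=
    continuous_pairXY.comp (continuous_const.prodMk continuous_id)
  have hV : IsOpen {y : EuclideanSpace ℝ (Fin d) | ∀ k, u k (pairXY x y) ∈ I k} := by
    simp only [ofPred_forall]
    exact isOpen_iInter_of_finite fun k =>
      (hI k).1.preimage ((hreg k).1.continuous.comp hsl)
  -- In the box F_ij is never zero, so the vanishing coupling forces equality in Cauchy–Schwarz
  -- almost everywhere there; continuity extends it to the whole open set.
  have hdot : ∀ i j, i ≠ j → EqOn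
      (fun y => s i * s j * (rY (u i) (pairXY x y) * rY (u j) (pairXY x y)))
      (fun y => ∑ l : Fin d, pd (Sum.inr l) (u i) (pairXY x y) * pd (Sum.inr l) (u j) (pairXY x y))
      {y : EuclideanSpace ℝ (Fin d) | ∀ k, u k (pairXY x y) ∈ I k} := by
    intro i j hij
    refine Measure.eqOn_open_of_ae_eq (μ := volume) ?_ hV ?_ ?_
    · rw [Filter.EventuallyEq, ae_restrict_iff' hV.measurableSet]
      filter_upwards [hx] with y hy hyV
      have h1 := hy i j
      rw [xPart_pairXY] at h1
      have h2 : nlFF F i j x (fun k => u k (pairXY x y)) ≠ 0 := by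
        rcases hsign i j hij.symm with h | h
        · exact (h _ hyV).ne'
        · exact (h _ hyV).ne
      exact sub_eq_zero.mp ((mul_eq_zero.mp h1).resolve_left h2)
    · exact (continuous_const.mul (((continuous_rY (hreg i).1).comp hsl).mul
        ((continuous_rY (hreg j).1).comp hsl))).continuousOn
    · exact (continuous_finsetSum _ fun l _ => ((continuous_pd (hreg i).1 _).comp hsl).mul
        ((continuous_pd (hreg j).1 _).comp hsl)).continuousOn
  intro i j y z hy hz
  have := parallel_of_parallel_on_box (g := fun k y => u k (pairXY x y))
    (fun k => contDiff_slice (hreg k).1 x)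
    (fun k => hasLocallyConstDir_slice (hreg k) (hpos k) (h0 k) x) (fun k => (hI k).1) hne
    (fun y hyV i j hi => ?_) (i := i) (j := j) (y := y) (z := z)
    (by rwa [gradient_slice (hreg i).1]) (by rwa [gradient_slice (hreg j).1])
  · simpa only [gradient_slice (hreg _).1] using this
  · rw [gradient_slice (hreg i).1] at hi ⊢
    rw [gradient_slice (hreg j).1]
    rcases eq_or_ne i j with rfl | hij
    · exact ⟨1, by rw [one_smul]⟩
    · refine gradY_parallel_of_dot_eq ?_ (hdot i j hij hyV) hi
      have hss : s i * s j * (s i * s j) = 1 := by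
        rw [mul_mul_mul_comm, hs, hs, one_mul]
      rcases mul_self_eq_one_iff.mp hss with h | h <;> rw [h] <;> simp

/-- On every fibre, all the fibre gradients are parallel. -/
theorem parallel_of_ae_parallel {a : Fin n → EuclideanSpace ℝ (Fin m) → ℝ → ℝ}
    {u : Fin n → FibSpace m d → ℝ} (hreg : ∀ i, IsRegularSol (u i))
    (hpos : ∀ i, ∀ᵐ X : FibSpace m d, (matrixAlong (a i) (u i) X).PosDef)
    (h0 : ∀ i, ∀ᵐ X : FibSpace m d, gradY (u i) X ≠ 0 → curv (a i) (u i) X = 0)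
    (hae : ∀ᵐ x : EuclideanSpace ℝ (Fin m), ∀ i j y z, gradY (u i) (pairXY x y) ≠ 0 →
      gradY (u j) (pairXY x z) ≠ 0 →
      ∃ c : ℝ, gradY (u j) (pairXY x z) = c • gradY (u i) (pairXY x y))
    {i j : Fin n} {x : EuclideanSpace ℝ (Fin m)} {y z : EuclideanSpace ℝ (Fin d)}
    (hy : gradY (u i) (pairXY x y) ≠ 0) (hz : gradY (u j) (pairXY x z) ≠ 0) :
    ∃ c : ℝ, dirY (u j) (pairXY x z) = c • dirY (u i) (pairXY x y) := by
  have hsl : ∀ y : EuclideanSpace ℝ (Fin d),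
      Continuous fun x : EuclideanSpace ℝ (Fin m) => pairXY x y := fun y =>
    continuous_pairXY.comp (continuous_id.prodMk continuous_const)
  have h1 := (hsl y).continuousAt.eventually (eventually_dirY_eq (hreg i) (hpos i) (h0 i) hy)
  have h2 := (hsl z).continuousAt.eventually (eventually_dirY_eq (hreg j) (hpos j) (h0 j) hz)
  -- The unit directions are locally constant in x as well, and fibres of full measure are dense:
  -- move to a nearby good fibre x', leaving both directions unchanged.
  obtain ⟨x', hx', ⟨hi0, hi⟩, hj0, hj⟩ := (Measure.dense_of_ae hae).inter_nhds_nonempty (h1.and h2)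
  obtain ⟨c, hc⟩ := hx' i j y z hi0 hj0
  rw [← hi, ← hj, dirY, dirY, hc]
  refine ⟨(rY (u j) (pairXY x' z))⁻¹ * c * rY (u i) (pairXY x' y), ?_⟩
  rw [smul_smul, smul_smul, mul_assoc, mul_assoc,
    mul_inv_cancel₀ ((rY_pos_iff _ _).mpr hi0).ne', mul_one]

theorem eq_or_eq_neg_of_parallel {E : Type*} [NormedAddCommGroup E] [NormedSpace ℝ E] {e f : E}
    (he : ‖e‖ = 1) (hf : ‖f‖ = 1) (h : ∃ c : ℝ, f = c • e) : f = e ∨ f = -e := by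
  obtain ⟨c, rfl⟩ := h
  rw [norm_smul, he, mul_one, Real.norm_eq_abs] at hf
  rcases (abs_eq zero_le_one).mp hf with h | h
  · left; rw [h, one_smul]
  · right; rw [h, neg_one_smul]

/-- A choice of one of the two unit vectors of each line. -/
theorem exists_line_representative (E : Type*) [AddCommGroup E] :
    ∃ rep : E → E, (∀ e, rep e = e ∨ rep e = -e) ∧ ∀ e, rep (-e) = rep e := by
  have hne : ∀ e : E, ({e, -e} : Set E).Nonempty := fun e => ⟨e, by simp⟩
  refine ⟨fun e => (hne e).some, fun e => ?_, fun e => ?_⟩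
  · simpa using (hne e).some_mem
  -- The choice depends only on the set {e, −e}, which is the same for e and −e.
  · have : ({-e, - -e} : Set E) = {e, -e} := by rw [neg_neg, pair_comm]
    simp only [this]

/-- The common direction of all the fibre gradients on each fibre. -/
theorem exists_common_direction {a : Fin n → EuclideanSpace ℝ (Fin m) → ℝ → ℝ} (hd : 1 ≤ d)
    {u : Fin n → FibSpace m d → ℝ} (hreg : ∀ i, IsRegularSol (u i))
    (hpos : ∀ i, ∀ᵐ X : FibSpace m d, (matrixAlong (a i) (u i) X).PosDef)
    (h0 : ∀ i, ∀ᵐ X : FibSpace m d, gradY (u i) X ≠ 0 → curv (a i) (u i) X = 0)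
    (hae : ∀ᵐ x : EuclideanSpace ℝ (Fin m), ∀ i j y z, gradY (u i) (pairXY x y) ≠ 0 →
      gradY (u j) (pairXY x z) ≠ 0 →
      ∃ c : ℝ, gradY (u j) (pairXY x z) = c • gradY (u i) (pairXY x y)) :
    ∃ ω : EuclideanSpace ℝ (Fin m) → EuclideanSpace ℝ (Fin d), (∀ x, ‖ω x‖ = 1) ∧
      (∀ i X, ∃ c : ℝ, gradY (u i) X = c • ω (xPart X)) ∧
      ∀ i X X', gradY (u i) X ≠ 0 → gradY (u i) X' ≠ 0 → dirY (u i) X = dirY (u i) X' →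
        ω (xPart X) = ω (xPart X') := by
  classical
  -- The directions of different components, or at different points of a fibre, agree only up to
  -- sign. A representative depending on the line alone makes ω well defined, and equal whenever the
  -- directions are equal.
  obtain ⟨rep, hrep, hneg⟩ := exists_line_representative (EuclideanSpace ℝ (Fin d))
  have hω : ∀ x : EuclideanSpace ℝ (Fin m), ∃ w : EuclideanSpace ℝ (Fin d), ‖w‖ = 1 ∧
      ∀ i y, gradY (u i) (pairXY x y) ≠ 0 → w = rep (dirY (u i) (pairXY x y)) := by
    intro x
    by_cases h : ∃ i y, gradY (u i) (pairXY x y) ≠ 0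
    · obtain ⟨i, y, hy⟩ := h
      refine ⟨rep (dirY (u i) (pairXY x y)), ?_, fun j z hz => ?_⟩
      · rcases hrep (dirY (u i) (pairXY x y)) with h | h <;> rw [h]
        · exact norm_dirY hy
        · rw [norm_neg]; exact norm_dirY hy
      · rcases eq_or_eq_neg_of_parallel (norm_dirY hy) (norm_dirY hz)
          (parallel_of_ae_parallel hreg hpos h0 hae hy hz) with h | h <;> rw [h]
        rw [hneg]
    · push Not at h
      -- On a fibre where every ∇_y u^i vanishes any unit vector will do; one exists because d ≥ 1.
      exact ⟨EuclideanSpace.single ⟨0, hd⟩ 1, by simp, fun i y hy => absurd (h i y) hy⟩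
  choose ω hω1 hω2 using hω
  have hω3 : ∀ i X, gradY (u i) X ≠ 0 → ω (xPart X) = rep (dirY (u i) X) := by
    intro i X hX
    rw [← pairXY_xPart_yPart X] at hX
    have := hω2 (xPart X) i (yPart X) hX
    rwa [pairXY_xPart_yPart] at this
  refine ⟨ω, hω1, fun i X => ?_, fun i X X' hX hX' hdir => ?_⟩
  · by_cases hX : gradY (u i) X = 0
    · exact ⟨0, by rw [hX, zero_smul]⟩
    · rw [hω3 i X hX, gradY_eq_smul_dirY hX]
      rcases hrep (dirY (u i) X) with h | h <;> rw [h]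
      · exact ⟨_, rfl⟩
      · exact ⟨-rY (u i) X, by rw [neg_smul_neg]⟩
  · rw [hω3 i X hX, hω3 i X' hX', hdir]

/-- The direction of the fibre gradient is constant on connected components. -/
theorem dirY_eq_of_mem_connectedComponentIn {a : EuclideanSpace ℝ (Fin m) → ℝ → ℝ}
    {v : FibSpace m d → ℝ}
    (hv : IsRegularSol v) (hpos : ∀ᵐ X : FibSpace m d, (matrixAlong a v X).PosDef)
    (h0 : ∀ᵐ X : FibSpace m d, gradY v X ≠ 0 → curv a v X = 0) {X X' : FibSpace m d}
    (hX : gradY v X ≠ 0) (hX' : X' ∈ connectedComponentIn {X | gradY v X ≠ 0} X) :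
    dirY v X' = dirY v X :=
  dirY_eq_of_isPreconnected hv hpos h0 (isOpen_gradY_ne hv.1).connectedComponentIn
    isPreconnected_connectedComponentIn (connectedComponentIn_subset _ _) hX'
    (mem_connectedComponentIn hX)

/-- Only the signs of the θ^i matter, and they are constant; constants ±1 create no gradient terms
in the stability inequality. -/
theorem exists_sign {θ : Fin n → FibSpace m d → ℝ}
    (hθsign : ∀ i, (∀ X, 0 < θ i X) ∨ (∀ X, θ i X < 0)) :
    ∃ s : Fin n → ℝ, (∀ i, s i * s i = 1) ∧ ∀ i X, 0 < s i * θ i X := by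
  have : ∀ i, ∃ s : ℝ, s * s = 1 ∧ ∀ X, 0 < s * θ i X := by
    intro i
    rcases hθsign i with h | h
    · exact ⟨1, by norm_num, fun X => by simpa using h X⟩
    · exact ⟨-1, by norm_num, fun X => by simpa using h X⟩
  choose s h1 h2 using this
  exact ⟨s, h1, h2⟩

/-- Insert s_i² s_j² = 1 and divide by the positive factors s_i θ^i and s_j θ^j. -/
theorem nlFF_sign {F : EuclideanSpace ℝ (Fin m) → (Fin n → ℝ) → ℝ}
    (hF : ∀ x, ContDiff ℝ 2 (F x)) {u : Fin n → FibSpace m d → ℝ}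
    {θ : Fin n → FibSpace m d → ℝ}
    (hFθ : ∀ i j, i < j → ∀ X, 0 ≤ nlFF F i j (xPart X) (fun k => u k X) * θ i X * θ j X)
    {s : Fin n → ℝ} (hs : ∀ i, s i * s i = 1) (hsθ : ∀ i X, 0 < s i * θ i X)
    {i j : Fin n} (hij : i ≠ j) (X : FibSpace m d) :
    0 ≤ nlFF F i j (xPart X) (fun k => u k X) * s i * s j := by
  have key : ∀ i j, i < j → 0 ≤ nlFF F i j (xPart X) (fun k => u k X) * s i * s j := by
    intro i j hij
    have h1 := hFθ i j hij X
    have e : nlFF F i j (xPart X) (fun k => u k X) * θ i X * θ j X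
        = (nlFF F i j (xPart X) (fun k => u k X) * s i * s j)
          * ((s i * θ i X) * (s j * θ j X)) := by
      calc _ = nlFF F i j (xPart X) (fun k => u k X) * θ i X * θ j X * (s i * s i) * (s j * s j) := by
            rw [hs, hs, mul_one, mul_one]
        _ = _ := by ring
    rw [e] at h1
    exact nonneg_of_mul_nonneg_left h1 (mul_pos (hsθ i X) (hsθ j X))
  rcases hij.lt_or_gt with h | h
  · exact key i j h
  · rw [nlFF_comm hF i j, mul_right_comm]; exact key j i h

end Symmetry

end

theorem mainTheorem4 (m d n : ℕ) (hm : 1 ≤ m) (hd : 1 ≤ d)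
    (a : Fin n → EuclideanSpace ℝ (Fin m) → ℝ → ℝ)
    (F : EuclideanSpace ℝ (Fin m) → (Fin n → ℝ) → ℝ)
    (u : Fin n → FibSpace m d → ℝ)
    -- standing assumptions on the system
    (ha : ∀ i, IsCoefficient (a i))
    (hF : ∀ x, ContDiff ℝ 2 (F x))
    -- a regular, stable weak solution in the whole space
    (hreg : ∀ i, IsRegularSol (u i))
    (hsol : IsWeakSolution a F u)
    (hstab : IsStable a F u)
    -- the sign condition on the mixed derivatives along the solution
    (θ : Fin n → FibSpace m d → ℝ)
    (hθ : ∀ i, ContDiff ℝ 1 (θ i))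
    (hθsign : ∀ i, (∀ X, 0 < θ i X) ∨ (∀ X, θ i X < 0))
    (hFθ : ∀ i j, i < j → ∀ X, 0 ≤ nlFF F i j (xPart X) (fun k => u k X) * θ i X * θ j X)
    -- boundedness, positivity and growth of the matrix fields
    (hbdd : ∀ i, HasBoundedMatrix (a i) (u i))
    (hpos : ∀ i, ∀ᵐ X : FibSpace m d, (matrixAlong (a i) (u i) X).PosDef)
    (C₀ : Fin n → ℝ) (hC₀ : ∀ i, 1 ≤ C₀ i)
    (hgrowth : ∀ i, ∀ R : ℝ, (∀ j, C₀ j ≤ R) →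
      IntegrableOn (fun X => largestEigenvalue (matrixAlong (a i) (u i) X)
        * ‖gradient (u i) X‖ ^ 2) (Metric.ball 0 R) ∧
      ∫ X in Metric.ball 0 R, largestEigenvalue (matrixAlong (a i) (u i) X)
        * ‖gradient (u i) X‖ ^ 2 ≤ C₀ i * R ^ 2)
    -- strict sign of the mixed derivatives on a box that meets the image of the slice at `x`
    (hbox : ∀ x : EuclideanSpace ℝ (Fin m), ∃ I : Fin n → Set ℝ,
      (∀ i, IsOpen (I i) ∧ (I i).OrdConnected) ∧
      (∃ y : EuclideanSpace ℝ (Fin d), ∀ i, u i (pairXY x y) ∈ I i) ∧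
      ∀ k j, j ≠ k →
        (∀ ξ : Fin n → ℝ, (∀ i, ξ i ∈ I i) → 0 < nlFF F k j x ξ) ∨
        (∀ ξ : Fin n → ℝ, (∀ i, ξ i ∈ I i) → nlFF F k j x ξ < 0)) :
    ∃ (ω : Fin n → EuclideanSpace ℝ (Fin m) → EuclideanSpace ℝ (Fin d))
      (ubar : Fin n → EuclideanSpace ℝ (Fin m) → ℝ → ℝ)
      (C : Fin n → Fin n → FibSpace m d → ℝ)
      (D : Fin n → Fin n → EuclideanSpace ℝ (Fin m) → ℝ),
      -- the one-dimensional symmetry on each slice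
      (∀ i x, ‖ω i x‖ = 1) ∧
      (∀ i x y, u i (pairXY x y) = ubar i x (inner ℝ (ω i x) y)) ∧
      (∀ i, ∀ X ∈ {X | gradY (u i) X ≠ 0},
        ∀ X' ∈ connectedComponentIn {X | gradY (u i) X ≠ 0} X,
          ω i (xPart X') = ω i (xPart X)) ∧
      -- the relations between the components
      (∀ j k X, gradY (u k) X ≠ 0 → gradY (u j) X = C j k X • gradY (u k) X) ∧
      (∀ j k x, (D j k x = 1 ∨ D j k x = -1) ∧ ω j x = D j k x • ω k x) ∧
      -- coincidence of the directions
      (IsConnected {X : FibSpace m d | ∀ i, gradY (u i) X ≠ 0} →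
        ∃ e : EuclideanSpace ℝ (Fin d),
          ∀ i, ∀ X ∈ {X : FibSpace m d | ∀ i, gradY (u i) X ≠ 0}, ω i (xPart X) = e) := by
  classical
  obtain ⟨s, hs, hsθ⟩ := exists_sign hθsign
  obtain ⟨h0, hreact⟩ := curv_and_reaction_eq_zero ha hF hreg hsol hstab hbdd hpos hs
    (fun i j hij X => nlFF_sign hF hFθ hs hsθ hij X) C₀ hgrowth
  obtain ⟨ω, hω1, hω2, hω3⟩ := exists_common_direction hd hreg hpos h0
    (ae_parallel hreg hpos h0 hs hreact hbox)
  have hC : ∀ j k X, ∃ c : ℝ, gradY (u k) X ≠ 0 → gradY (u j) X = c • gradY (u k) X := by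
    intro j k X
    by_cases hX : gradY (u k) X = 0
    · exact ⟨0, fun h => absurd hX h⟩
    · obtain ⟨c, hc⟩ := hω2 j X
      obtain ⟨c', hc'⟩ := hω2 k X
      have hne : c' ≠ 0 := fun h => hX (by rw [hc', h, zero_smul])
      exact ⟨c / c', fun _ => by rw [hc, hc', smul_smul, div_mul_cancel₀ _ hne]⟩
  choose C hC using hC
  have hcomp : ∀ i X X', gradY (u i) X ≠ 0 →
      X' ∈ connectedComponentIn {X | gradY (u i) X ≠ 0} X → ω (xPart X') = ω (xPart X) :=
    fun i X X' hX hX' => hω3 i X' X (connectedComponentIn_subset _ _ hX') hX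
      (dirY_eq_of_mem_connectedComponentIn (hreg i) (hpos i) (h0 i) hX hX')
  -- The same ω serves every component, so all D_jk equal 1, and the profile ū^i(x, ·) is u^i
  -- restricted to the line ℝω(x) in the fibre.
  refine ⟨fun _ => ω, fun i x t => u i (pairXY x (t • ω x)), C, fun _ _ _ => 1,
    fun _ x => hω1 x, fun i x y => ?_, fun i X hX X' hX' => hcomp i X X' hX hX', hC,
    fun _ _ x => ⟨Or.inl rfl, (one_smul ℝ (ω x)).symm⟩, fun hconn => ?_⟩
  · refine eq_comp_inner_of_gradient (contDiff_slice (hreg i).1 x) (hω1 x) (fun z => ?_) y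
    obtain ⟨c, hc⟩ := hω2 i (pairXY x z)
    rw [xPart_pairXY] at hc
    exact ⟨c, by rw [gradient_slice (hreg i).1, hc]⟩
  -- The connected set where no fibre gradient vanishes lies in a single component of {∇_y u^i ≠ 0}
  -- for each i, and the base point X₀ does not depend on i.
  · obtain ⟨X₀, hX₀⟩ := hconn.nonempty
    refine ⟨ω (xPart X₀), fun i X hX => hcomp i X₀ X (hX₀ i) ?_⟩
    exact hconn.isPreconnected.subset_connectedComponentIn hX₀ (fun Y hY => hY i) hX
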